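/- \textbf{Setting.} Let $f:(0,\infty)\to\mathbb R$ be smooth and nowhere zero, and let $M=\mathbb R^3\setminus\{0\}$ carry the Poisson bivector field $\alpha^{ij}(x)=f(|x|)\,\epsilon^{ijk}x^k$ (summation over repeated indices). Put $I=[0,1]$, $$A(R)=\frac{4\pi R}{f(R)},\qquad C(R)=\frac{R f'(R)}{f(R)}\qquad(R>0).$$ Let $\mathcal C$ be the set of pairs $(X,\eta)$ with $X\in C^1(I,M)$, $\eta\in C^0(I,\mathbb R^3)$ and $(X^i)'+\alpha^{ij}(X)\eta_j=0$; it is a Banach manifold with global chart $(X,\eta)\mapsto (X(0),\eta)\in\mathbb R^3\times C^0(I,\mathbb R^3)$. For $\beta\in C^1(I,\mathbb R^3)$ with $\beta(0)=\beta(1)=0$ the infinitesimal gauge transformation $\xi_\beta$ is $$\delta X^i=-\alpha^{ij}(X)\beta_j,\qquad \delta\eta_i=\beta_i'+\partial_i\alpha^{jk}(X)\,\eta_j\beta_k .$$ Two elements of $\mathcal C$ are gauge equivalent if they lie in the same leaf of the foliation spanned by the $\xi_\beta$, i.e. if they can be joined in $\mathcal C$ by finitely many $C^1$ curves tangent to the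 distribution spanned by the $\xi_\beta$. The phase space $\mathcal G$ is the set of gauge equivalence classes with the quotient topology, with projections $l[(X,\eta)]=X(0)$ and $r[(X,\eta)]=X(1)$. We call $\mathcal G$ \emph{singular} if there is no smooth finite-dimensional manifold $N$ (Hausdorff or not) with a smooth submersion of $\mathcal C$ onto $N$ whose fibres are the gauge equivalence classes. \textbf{Theorem.} \begin{enumerate} \item $\mathcal G$ is singular if and only if $A$ is nonconstant on $(0,\infty)$ and has a critical point in $(0,\infty)$. If $\mathcal G$ is not singular, then $N$ can be chosen Hausdorff, second countable and of dimension $6$. \item Let $U\subseteq(0,\infty)$ be open, let $V\subsetneq S^2$ be open, let $\mathcal G_{UV}\subseteq\mathcal G$ be the set of classes $g$ such that $l(g)$ and $r(g)$ both have norm in $U$ and direction in $V$, and let $Q$ be the quotient of $U\times\mathbb R$ by the equivalence relation generated by $$(R,p)\sim\Bigl(R,\;p+\frac{4\pi\,(1-C(R))}{f(R)}\Bigr),$$ with the quotient topology. Then there is a homeomorphism $\Phi:\mathcal G_{UV}\to V\times V\times Q$ of the form $$[(X,\eta)]\mapsto\Bigl(\tfrac{X(0)}{|X(0)|},\ \tfrac{X(1)}{|X(1)|},\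 \bigl[(|X(0)|,\,p)\bigr]\Bigr),$$ where near each point of the preimage of $\mathcal G_{UV}$ in $\mathcal C$ the number $p$ can be chosen as a smooth function of $(X,\eta)$, and where replacing $\eta$ by $\eta+t\,X/|X|$ with a constant $t\in\mathbb R$ replaces $[(R,p)]$ by $[(R,p+t)]$. \end{enumerate} -/

import Mathlib

open Set Topology
open scoped Manifold ContDiff unitInterval

noncomputable section

namespace PoissonSigma

/-- `ℝⁿ` with its Euclidean norm. -/
abbrev Vec (n : ℕ) : Type := EuclideanSpace ℝ (Fin n)

/-- The coordinates `αⁱʲ(x)` of a bivector field on (an open subset of) `ℝⁿ`. -/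
abbrev Bivector (n : ℕ) : Type := Vec n → Matrix (Fin n) (Fin n) ℝ

/-- The vector `αⁱʲ(x) pⱼ`. -/
def sharp {n : ℕ} (α : Bivector n) (x p : Vec n) : Vec n :=
  WithLp.toLp 2 (fun i => ∑ j, α x i j * p j)

/-- The partial derivative `∂ᵢ αʲᵏ(x)`. -/
def partialDeriv {n : ℕ} (α : Bivector n) (i j k : Fin n) (x : Vec n) : ℝ :=
  fderiv ℝ (fun y => α y j k) x (EuclideanSpace.single i 1)

/-- `dg` is the derivative of `g` on the closed interval `[0,1]` (one-sided at the end points). -/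
def HasDerivOnI {n : ℕ} (g dg : I → Vec n) : Prop :=
  ∀ u : I, HasDerivWithinAt (Set.IccExtend (zero_le_one' ℝ) g) (dg u) (Icc (0 : ℝ) 1) (u : ℝ)

/-- The constraint manifold of the Poisson sigma model with target the open set `M ⊆ ℝⁿ`:
pairs `(X, η)` with values in `M` and in `ℝⁿ` which solve `X' + α(X) η = 0`, `η` continuous
(so that `X` is continuously differentiable). -/
@[ext]
structure Constraint {n : ℕ} (M : Set (Vec n)) (α : Bivector n) : Type where
  X : C(I, Vec n)
  η : C(I, Vec n)
  mem : ∀ u, X u ∈ M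
  gauss : HasDerivOnI X (fun u => -sharp α (X u) (η u))

/-- The global chart `(X, η) ↦ (X 0, η)` of the constraint manifold, with values in the Banach
space `ℝⁿ × C⁰([0,1], ℝⁿ)`. Since the initial value problem has unique solutions, it is injective;
its range is open. -/
def Constraint.chart {n : ℕ} {M : Set (Vec n)} {α : Bivector n} (c : Constraint M α) :
    Vec n × C(I, Vec n) :=
  (c.X 0, c.η)

/-- The manifold topology of the constraint manifold, given by the chart. -/
instance {n : ℕ} (M : Set (Vec n)) (α : Bivector n) : TopologicalSpace (Constraint M α) :=
  TopologicalSpace.induced Constraint.chart inferInstance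

/-- `c₀` and `c₁` are joined by a `C¹` curve `s ↦ (X, η)` in the constraint manifold which is
tangent to the distribution spanned by the infinitesimal gauge transformations `ξ_β`, with
`β ∈ C¹([0,1], ℝⁿ)`, `β(0) = β(1) = 0`:
`∂ₛ Xⁱ = -αⁱʲ(X) βⱼ` and `∂ₛ ηᵢ = βᵢ' + ∂ᵢ αʲᵏ(X) ηⱼ βₖ`. Here `dβ s` is the derivative of
`β s` with respect to the variable in `[0,1]`. -/
def GaugeCurve {n : ℕ} {M : Set (Vec n)} {α : Bivector n} (c₀ c₁ : Constraint M α) : Prop :=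
  ∃ (γ : ℝ → Constraint M α) (β dβ : ℝ → C(I, Vec n)),
    Continuous γ ∧ Continuous β ∧ Continuous dβ ∧ γ 0 = c₀ ∧ γ 1 = c₁ ∧
    ∀ s : ℝ, HasDerivOnI (β s) (dβ s) ∧ β s 0 = 0 ∧ β s 1 = 0 ∧
      ∀ u : I,
        HasDerivAt (fun t => (γ t).X u) (-sharp α ((γ s).X u) (β s u)) s ∧
        HasDerivAt (fun t => (γ t).η u)
          (dβ s u + WithLp.toLp 2 (fun i => ∑ j, ∑ k,
            partialDeriv α i j k ((γ s).X u) * (γ s).η u j * β s u k)) s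

/-- The phase space: the space of leaves of the foliation of the constraint manifold by gauge
orbits. It carries the quotient topology. -/
def PhaseSpace {n : ℕ} (M : Set (Vec n)) (α : Bivector n) : Type :=
  Quot (GaugeCurve (M := M) (α := α))

instance {n : ℕ} (M : Set (Vec n)) (α : Bivector n) : TopologicalSpace (PhaseSpace M α) :=
  inferInstanceAs (TopologicalSpace (Quot (GaugeCurve (M := M) (α := α))))

/-- The class of a solution in the phase space. -/
def PhaseSpace.mk {n : ℕ} {M : Set (Vec n)} {α : Bivector n} (c : Constraint M α) :
    PhaseSpace M α :=
  Quot.mk _ c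

theorem sharp_zero {n : ℕ} (α : Bivector n) (x : Vec n) : sharp α x 0 = 0 := by
  ext i
  simp [sharp]

/-- Gauge transformations do not move a point of `[0,1]` at which all parameters vanish. -/
theorem GaugeCurve.endpoints {n : ℕ} {M : Set (Vec n)} {α : Bivector n} {c₀ c₁ : Constraint M α}
    (h : GaugeCurve c₀ c₁) : c₀.X 0 = c₁.X 0 ∧ c₀.X 1 = c₁.X 1 := by
  obtain ⟨γ, β, dβ, -, -, -, rfl, rfl, h⟩ := h
  constructor
  · refine is_const_of_deriv_eq_zero (f := fun t => (γ t).X 0)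
      (fun s => ((h s).2.2.2 0).1.differentiableAt) (fun s => ?_) 0 1
    rw [((h s).2.2.2 0).1.deriv, (h s).2.1, sharp_zero, neg_zero]
  · refine is_const_of_deriv_eq_zero (f := fun t => (γ t).X 1)
      (fun s => ((h s).2.2.2 1).1.differentiableAt) (fun s => ?_) 0 1
    rw [((h s).2.2.2 1).1.deriv, (h s).2.2.1, sharp_zero, neg_zero]

/-- The left projection `l [(X, η)] = X 0`. -/
def PhaseSpace.l {n : ℕ} {M : Set (Vec n)} {α : Bivector n} : PhaseSpace M α → Vec n :=
  Quot.lift (fun c => c.X 0) (fun _ _ h => h.endpoints.1)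

/-- The right projection `r [(X, η)] = X 1`. -/
def PhaseSpace.r {n : ℕ} {M : Set (Vec n)} {α : Bivector n} : PhaseSpace M α → Vec n :=
  Quot.lift (fun c => c.X 1) (fun _ _ h => h.endpoints.2)

/-- `π` is a smooth submersion from the constraint manifold onto the `k`-dimensional manifold `N`
whose fibres are the gauge orbits. Smoothness and the derivative are those of the expression `F`
of `π` in the global chart of the constraint manifold (the values of `F` off the open range of the
chart are irrelevant). -/
structure IsSmoothQuotient {n : ℕ} {M : Set (Vec n)} {α : Bivector n} (k : ℕ)
    {N : Type} [TopologicalSpace N] [ChartedSpace (Vec k) N] (π : Constraint M α → N) : Prop where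
  surjective : Function.Surjective π
  fibres : ∀ c c' : Constraint M α, π c = π c' ↔ PhaseSpace.mk c = PhaseSpace.mk c'
  submersion : ∃ F : Vec n × C(I, Vec n) → N,
    (∀ c : Constraint M α, F c.chart = π c) ∧
    ContMDiffOn 𝓘(ℝ, Vec n × C(I, Vec n)) (𝓡 k) ∞ F
      (range (Constraint.chart (M := M) (α := α))) ∧
    ∀ c : Constraint M α,
      Function.Surjective (mfderiv 𝓘(ℝ, Vec n × C(I, Vec n)) (𝓡 k) F c.chart)

/-- The phase space is singular if it is not a smooth manifold: there is no smooth manifold `N`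
(Hausdorff or not) with a smooth submersion from the constraint manifold onto `N` whose fibres
are the gauge orbits. -/
def IsSingular {n : ℕ} (M : Set (Vec n)) (α : Bivector n) : Prop :=
  ¬ ∃ (k : ℕ) (N : Type) (_ : TopologicalSpace N) (_ : ChartedSpace (Vec k) N)
      (_ : IsManifold (𝓡 k) ∞ N) (π : Constraint M α → N), IsSmoothQuotient k π

/-- The target `ℝ³ ∖ {0}`. -/
def puncturedSpace : Set (Vec 3) := {x | x ≠ 0}

/-- The symbol `ε` with `ε 0 1 2 = 1`, totally antisymmetric. -/
def epsilon (i j k : Fin 3) : ℝ :=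
  (((j : ℕ) : ℝ) - ((i : ℕ) : ℝ)) * (((k : ℕ) : ℝ) - ((j : ℕ) : ℝ)) *
    (((k : ℕ) : ℝ) - ((i : ℕ) : ℝ)) / 2

/-- The rotation invariant bivector field `αⁱʲ(x) = f(|x|) εⁱʲᵏ xᵏ`. -/
def rotBivector (f : ℝ → ℝ) : Bivector 3 :=
  fun x => Matrix.of (fun i j => f ‖x‖ * ∑ k, epsilon i j k * x k)

/-- The symplectic area `A(R) = 4πR / f(R)` of the sphere of radius `R`. -/
def leafArea (f : ℝ → ℝ) (R : ℝ) : ℝ := 4 * Real.pi * R / f R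

/-- The function `C(R) = R f'(R) / f(R)`. -/
def logSlope (f : ℝ → ℝ) (R : ℝ) : ℝ := R * deriv f R / f R

/-- The unit sphere in `ℝ³`. -/
abbrev S2 : Type := Metric.sphere (0 : Vec 3) 1

/-- The set of points of `ℝ³` with radius in `U` and direction in `V`. -/
def polarBox (U : Set ℝ) (V : Set S2) : Set (Vec 3) :=
  {x | ‖x‖ ∈ U ∧ ∃ v ∈ V, x = ‖x‖ • (v : Vec 3)}

/-- The part of the phase space whose end points both have radius in `U` and direction in `V`. -/
def localPhaseSpace (f : ℝ → ℝ) (U : Set ℝ) (V : Set S2) :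
    Set (PhaseSpace puncturedSpace (rotBivector f)) :=
  {g | g.l ∈ polarBox U V ∧ g.r ∈ polarBox U V}

/-- The quotient of `U × ℝ` by the equivalence relation generated by
`(R, p) ∼ (R, p + 4π (1 - C(R)) / f(R))`, with the quotient topology. -/
def QuotientQ (f : ℝ → ℝ) (U : Set ℝ) : Type :=
  Quot (fun a b : U × ℝ =>
    b = (a.1, a.2 + 4 * Real.pi * (1 - logSlope f (a.1 : ℝ)) / f (a.1 : ℝ)))

instance (f : ℝ → ℝ) (U : Set ℝ) : TopologicalSpace (QuotientQ f U) :=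
  inferInstanceAs (TopologicalSpace (Quot (fun a b : U × ℝ =>
    b = (a.1, a.2 + 4 * Real.pi * (1 - logSlope f (a.1 : ℝ)) / f (a.1 : ℝ)))))

/-- The class of `(R, p)`. -/
def QuotientQ.mk {f : ℝ → ℝ} {U : Set ℝ} (R : U) (p : ℝ) : QuotientQ f U :=
  Quot.mk _ (R, p)

/-- The homeomorphism `Φ` identifies the local phase space with `V × V × Q` as quotients of
manifolds: the first two components are the directions of the end points; the third one is
locally the class of `(|X 0|, p)` for a smooth function `p` on the constraint manifold; and adding
a constant `t` to the radial component of `η` adds `t` to `p`. -/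
structure IsPolarIdentification (f : ℝ → ℝ) (U : Set ℝ) (V : Set S2)
    (Φ : localPhaseSpace f U V ≃ₜ V × V × QuotientQ f U) : Prop where
  left : ∀ g, g.1.l = ‖g.1.l‖ • (((Φ g).1 : S2) : Vec 3)
  right : ∀ g, g.1.r = ‖g.1.r‖ • (((Φ g).2.1 : S2) : Vec 3)
  smooth : ∀ c₀ : Constraint puncturedSpace (rotBivector f),
    PhaseSpace.mk c₀ ∈ localPhaseSpace f U V →
    ∃ (O : Set (Vec 3 × C(I, Vec 3))) (p : Vec 3 × C(I, Vec 3) → ℝ),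
      IsOpen O ∧ c₀.chart ∈ O ∧ ContDiffOn ℝ ∞ p O ∧
      ∀ (c : Constraint puncturedSpace (rotBivector f))
        (h : PhaseSpace.mk c ∈ localPhaseSpace f U V), c.chart ∈ O →
        (Φ ⟨PhaseSpace.mk c, h⟩).2.2 = QuotientQ.mk ⟨‖c.X 0‖, h.1.1⟩ (p c.chart)
  translation : ∀ (c c' : Constraint puncturedSpace (rotBivector f)) (t : ℝ)
    (h : PhaseSpace.mk c ∈ localPhaseSpace f U V) (h' : PhaseSpace.mk c' ∈ localPhaseSpace f U V),
    c'.X = c.X → (∀ u, c'.η u = c.η u + t • (‖c.X u‖⁻¹ • c.X u)) →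
    ∀ (R : U) (p : ℝ), (Φ ⟨PhaseSpace.mk c, h⟩).2.2 = QuotientQ.mk R p →
      (Φ ⟨PhaseSpace.mk c', h'⟩).2.2 = QuotientQ.mk R (p + t)

end PoissonSigma

end

open scoped Quaternion

noncomputable section

namespace PoissonSigma

/-! ### Vectors as imaginary quaternions -/

/-! Identify `ℝ³` with the imaginary quaternions. The constraint keeps `|X| = R` fixed and becomes
`X' = [a, X]` with the su(2)-connection `a = -(f(R)/2) η`. Hence `X = R G v G*`, where `G` is the
parallel transport of `a` and `v` is the initial direction. Besides `X 0`, a solution has two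
invariants: the holonomy `g = G(1)` and the radial integral `ρ = ∫⟨a, X/R⟩`.

An infinitesimal gauge transformation is an ordinary su(2) gauge transformation of `a` plus a radial
term with factor `2C`, which comes from the derivative of `f`. Adding a multiple of `X` to the gauge
parameter absorbs this term, but the new parameter need not vanish at `u = 1`. So a leaf fixes `X 0`
and moves `(g, ρ)` along `(g exp(-Cθ v), ρ + (1 - C)θ)` (`hasDerivAt_of_gauge`, `GaugeCurve.orb`).
These orbits, given by `Orb`, are exactly the leaves (`PhaseSpace.mk_eq_iff`). For the converse, a
radial shift makes the two holonomies equal. Connections with equal holonomy can be deformed into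
each other because a cone over a `C¹` path misses a point of the four-dimensional space of
quaternions (`exists_curve_of_transport_eq`). A correction of the radial component then turns the
deformation into a gauge curve (`gaugeCurve_of_connections`).

Since `A' = 4π(1 - C)/f`, the critical points of `A` are the radii with `C = 1`. If `C ≠ 1`
everywhere, `θ` can be eliminated, and a leaf is a pair of `X 0` and a corrected holonomy in `S³`.
If `C = 1` everywhere, `ρ` is invariant and `g` matters only through `g v g*`, so that `X 0`, `ρ`
and the direction of `X 1` remain. In both cases an explicit submersion realises the leaf space as
an open subset of `ℝ⁶`. Otherwise connectedness of `(0,∞)` gives a radius with `C = 1` which is a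
limit of radii with `C ≠ 1`. On a ray, constant radial covectors are identified modulo the period
`4π(1 - C)/f`. This period is nonzero at the nearby radii and tends to zero, while nothing is
identified at the limit. So distinct leaves are limits of the same leaves, which cannot happen
inside one chart (`isSingular_of_critical`).

For the local description, a section of the circle bundle `SU(2) → S²` over a punctured sphere turns
`g` into an angle `ψ` modulo `2π`. The combination `p = -(2/f)(Cρ + (1 - C)ψ)` is invariant under
`θ`; with the end points it separates the leaves, and the ambiguity of `ψ` is the period. Solutions
depending continuously on the end points and `p` show that the resulting map is a quotient map
(`exists_continuous_section`, `isQuotientMap_polarMap`). -/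

/-- The identification of `ℝ³` with the imaginary quaternions. -/
def toQ : Vec 3 →L[ℝ] ℍ[ℝ] :=
  LinearMap.toContinuousLinearMap
    { toFun := fun x => ⟨0, x 0, x 1, x 2⟩
      map_add' := fun _ _ => Quaternion.ext _ _ (add_zero (0 : ℝ)).symm rfl rfl rfl
      map_smul' := fun c _ => Quaternion.ext _ _ (mul_zero c).symm rfl rfl rfl }

/-- The imaginary part of a quaternion as a vector. -/
def ofQ : ℍ[ℝ] →L[ℝ] Vec 3 :=
  LinearMap.toContinuousLinearMap
    { toFun := fun q => !₂[q.imI, q.imJ, q.imK]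
      map_add' := fun x y => by ext i; fin_cases i <;> simp
      map_smul' := fun c x => by ext i; fin_cases i <;> simp }

@[simp] theorem toQ_re (x : Vec 3) : (toQ x).re = 0 := rfl
@[simp] theorem toQ_imI (x : Vec 3) : (toQ x).imI = x 0 := rfl
@[simp] theorem toQ_imJ (x : Vec 3) : (toQ x).imJ = x 1 := rfl
@[simp] theorem toQ_imK (x : Vec 3) : (toQ x).imK = x 2 := rfl
@[simp] theorem ofQ_zero (q : ℍ[ℝ]) : ofQ q 0 = q.imI := rfl
@[simp] theorem ofQ_one (q : ℍ[ℝ]) : ofQ q 1 = q.imJ := rfl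
@[simp] theorem ofQ_two (q : ℍ[ℝ]) : ofQ q 2 = q.imK := rfl

@[simp] theorem ofQ_toQ (x : Vec 3) : ofQ (toQ x) = x := by
  ext i; fin_cases i <;> simp

theorem star_toQ (x : Vec 3) : star (toQ x) = -toQ x := by
  rw [Quaternion.star_eq_neg]; rfl

theorem toQ_ofQ {q : ℍ[ℝ]} (h : star q = -q) : toQ (ofQ q) = q := by
  rw [Quaternion.star_eq_neg] at h
  ext <;> simp [h]

theorem toQ_injective : Function.Injective toQ := fun x y h => by
  rw [← ofQ_toQ x, h, ofQ_toQ]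

theorem norm_toQ (x : Vec 3) : ‖toQ x‖ = ‖x‖ := by
  have h : ‖toQ x‖ ^ 2 = ‖x‖ ^ 2 := by
    rw [sq, ← Quaternion.normSq_eq_norm_mul_self, Quaternion.normSq_def', EuclideanSpace.norm_sq_eq]
    simp [Fin.sum_univ_three]
  exact (pow_left_inj₀ (norm_nonneg _) (norm_nonneg _) two_ne_zero).1 h

theorem mul_star_eq_norm_sq (q : ℍ[ℝ]) : q * star q = ((‖q‖ ^ 2 : ℝ) : ℍ[ℝ]) := by
  rw [Quaternion.self_mul_star, Quaternion.normSq_eq_norm_mul_self, sq]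

theorem toQ_mul_self (x : Vec 3) : toQ x * toQ x = -((‖x‖ ^ 2 : ℝ) : ℍ[ℝ]) := by
  have := mul_star_eq_norm_sq (toQ x)
  rw [star_toQ, norm_toQ] at this
  rw [← this]; simp

theorem star_mul_self_of_norm_eq_one {q : ℍ[ℝ]} (h : ‖q‖ = 1) : star q * q = 1 := by
  rw [Quaternion.star_mul_self, Quaternion.normSq_eq_norm_mul_self, h]; simp

theorem mul_star_self_of_norm_eq_one {q : ℍ[ℝ]} (h : ‖q‖ = 1) : q * star q = 1 := by
  rw [mul_star_eq_norm_sq, h]; simp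

theorem norm_eq_one_of_mul_star {q : ℍ[ℝ]} (h : q * star q = 1) : ‖q‖ = 1 := by
  have h1 : ‖q * star q‖ = 1 := by rw [h]; simp
  rw [norm_mul, norm_star] at h1
  nlinarith [norm_nonneg q]

theorem star_conj {g q : ℍ[ℝ]} (hq : star q = -q) : star (g * q * star g) = -(g * q * star g) := by
  simp [mul_assoc, hq]

/-- The commutator form of the contraction of the bivector field with a covector. -/
theorem toQ_sharp (f : ℝ → ℝ) (x p : Vec 3) :
    toQ (sharp (rotBivector f) x p) = (f ‖x‖ / 2) • (toQ p * toQ x - toQ x * toQ p) := by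
  ext <;> simp [sharp, rotBivector, epsilon, Fin.sum_univ_three]
  · exact Or.inr (by ring)
  all_goals ring

/-- The triple product of imaginary quaternions. -/
def triple (x a b : ℍ[ℝ]) : ℝ := -(x * a * b).re

theorem hasFDerivAt_norm_of_ne_zero {x : Vec 3} (hx : x ≠ 0) :
    HasFDerivAt (fun y : Vec 3 => ‖y‖) (‖x‖⁻¹ • innerSL ℝ x) x := by
  have h2 := (hasStrictFDerivAt_norm_sq x).hasFDerivAt.sqrt (by simpa using hx)
  have h3 : (fun y : Vec 3 => Real.sqrt (‖y‖ ^ 2)) = fun y => ‖y‖ := by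
    ext y; exact Real.sqrt_sq (norm_nonneg y)
  rw [h3] at h2
  refine h2.congr_fderiv ?_
  rw [Real.sqrt_sq (norm_nonneg x)]
  ext y
  simp
  ring

theorem partialDeriv_rotBivector {f : ℝ → ℝ} {x : Vec 3} (hx : x ≠ 0)
    (hf : DifferentiableAt ℝ f ‖x‖) (i j k : Fin 3) :
    partialDeriv (rotBivector f) i j k x =
      f ‖x‖ * epsilon j k i + deriv f ‖x‖ * (x i / ‖x‖) * ∑ l, epsilon j k l * x l := by
  have h1 := hasFDerivAt_norm_of_ne_zero hx
  have h4 : HasFDerivAt (fun y : Vec 3 => f ‖y‖) (deriv f ‖x‖ • (‖x‖⁻¹ • innerSL ℝ x)) x :=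
    hf.hasDerivAt.comp_hasFDerivAt x h1
  have h5 : HasFDerivAt (fun y : Vec 3 => ∑ l, epsilon j k l * y l)
      (∑ l, epsilon j k l • (EuclideanSpace.proj l : Vec 3 →L[ℝ] ℝ)) x := by
    refine HasFDerivAt.fun_sum fun l _ => ?_
    exact ((EuclideanSpace.proj l : Vec 3 →L[ℝ] ℝ).hasFDerivAt).const_mul _
  have h6 := (h4.mul h5).fderiv
  have h7 : (fun y : Vec 3 => rotBivector f y j k)
      = ((fun y : Vec 3 => f ‖y‖) * fun y => ∑ l, epsilon j k l * y l) := rfl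
  rw [partialDeriv, h7, h6]
  simp [EuclideanSpace.inner_single_right]
  ring

/-- The gauge variation of the covector, in terms of quaternions. -/
theorem toQ_gauge_term {f : ℝ → ℝ} {x : Vec 3} (hx : x ≠ 0)
    (hf : DifferentiableAt ℝ f ‖x‖) (η β : Vec 3) :
    toQ (WithLp.toLp 2 (fun i => ∑ j, ∑ k,
        partialDeriv (rotBivector f) i j k x * η j * β k)) =
      (f ‖x‖ / 2) • (toQ η * toQ β - toQ β * toQ η) +
        (deriv f ‖x‖ / ‖x‖ * triple (toQ x) (toQ η) (toQ β)) • toQ x := by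
  ext <;> simp [partialDeriv_rotBivector hx hf, Fin.sum_univ_three, triple, epsilon]
  · exact Or.inr (by ring)
  all_goals ring

/-! ### One-parameter subgroups of the unit quaternions -/

/-- `exp (t v)` for an imaginary unit `v`. -/
def circ (v : ℍ[ℝ]) (t : ℝ) : ℍ[ℝ] := Real.cos t • 1 + Real.sin t • v

@[simp] theorem circ_zero (v : ℍ[ℝ]) : circ v 0 = 1 := by simp [circ]

theorem circ_add {v : ℍ[ℝ]} (hv : v * v = -1) (s t : ℝ) :
    circ v (s + t) = circ v s * circ v t := by
  simp only [circ, Real.cos_add, Real.sin_add, add_mul, mul_add, smul_mul_assoc, mul_smul_comm,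
    hv, one_mul, mul_one]
  module

theorem circ_commute (v : ℍ[ℝ]) (t : ℝ) : circ v t * v = v * circ v t := by
  simp [circ, add_mul, mul_add]

theorem star_circ {v : ℍ[ℝ]} (hv : star v = -v) (t : ℝ) : star (circ v t) = circ v (-t) := by
  simp [circ, hv]

theorem circ_mul_star {v : ℍ[ℝ]} (hv : v * v = -1) (hv' : star v = -v) (t : ℝ) :
    circ v t * star (circ v t) = 1 := by
  rw [star_circ hv', ← circ_add hv, add_neg_cancel, circ_zero]

theorem hasDerivAt_circ {v : ℍ[ℝ]} (hv : v * v = -1) (t : ℝ) :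
    HasDerivAt (circ v) (v * circ v t) t := by
  have h1 := ((Real.hasDerivAt_cos t).smul_const (1 : ℍ[ℝ])).add
    ((Real.hasDerivAt_sin t).smul_const v)
  refine h1.congr_deriv ?_
  simp only [circ, mul_add, mul_smul_comm, hv, mul_one]
  module

theorem contDiff_circ : ContDiff ℝ ∞ (fun z : ℍ[ℝ] × ℝ => circ z.1 z.2) := by
  exact ((Real.contDiff_cos.comp contDiff_snd).smul contDiff_const).add
    ((Real.contDiff_sin.comp contDiff_snd).smul contDiff_fst)

theorem circ_eq_one_iff {v : ℍ[ℝ]} (hv' : star v = -v) (t : ℝ) :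
    circ v t = 1 ↔ ∃ m : ℤ, t = m * (2 * Real.pi) := by
  have hre : v.re = 0 := Quaternion.star_eq_neg.1 hv'
  constructor
  · intro h
    have h1 : Real.cos t = 1 := by
      have := congrArg QuaternionAlgebra.re h
      simpa [circ, hre] using this
    obtain ⟨m, hm⟩ := (Real.cos_eq_one_iff t).1 h1
    exact ⟨m, hm.symm⟩
  · rintro ⟨m, rfl⟩
    have h1 : Real.cos (m * (2 * Real.pi)) = 1 := (Real.cos_eq_one_iff _).2 ⟨m, rfl⟩
    have h2 : Real.sin (m * (2 * Real.pi)) = 0 := by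
      nlinarith [Real.sin_sq_add_cos_sq (m * (2 * Real.pi))]
    simp [circ, h1, h2]

/-- Two unit quaternions act on the imaginary unit `v` in the same way if and only if they differ
by an element of the circle through `v`. -/
theorem exists_circ_of_commute {q v : ℍ[ℝ]} (hv : v * v = -1) (hv' : star v = -v)
    (hq : ‖q‖ = 1) (h : q * v = v * q) : ∃ t, q = circ v t := by
  have hre : v.re = 0 := Quaternion.star_eq_neg.1 hv'
  have hn : v.imI ^ 2 + v.imJ ^ 2 + v.imK ^ 2 = 1 := by
    have := congrArg QuaternionAlgebra.re hv
    simp [hre] at this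
    linarith
  -- The three imaginary components of the commutation relation say that the cross product of the
  -- imaginary parts vanishes, so `q` has imaginary part parallel to `v`.
  have hI : q.imJ * v.imK = q.imK * v.imJ := by
    have := congrArg QuaternionAlgebra.imI h
    simp [hre] at this
    linarith
  have hJ : q.imI * v.imK = q.imK * v.imI := by
    have := congrArg QuaternionAlgebra.imJ h
    simp [hre] at this
    linarith
  have hK : q.imI * v.imJ = q.imJ * v.imI := by
    have := congrArg QuaternionAlgebra.imK h
    simp [hre] at this
    linarith
  set s : ℝ := q.imI * v.imI + q.imJ * v.imJ + q.imK * v.imK with hs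
  have e1 : q.imI = s * v.imI := by
    rw [hs]; linear_combination (-q.imI) * hn - v.imK * hJ * (-1) - v.imJ * hK * (-1)
  have e2 : q.imJ = s * v.imJ := by
    rw [hs]; linear_combination (-q.imJ) * hn + v.imK * hI - v.imI * hK
  have e3 : q.imK = s * v.imK := by
    rw [hs]; linear_combination (-q.imK) * hn - v.imJ * hI - v.imI * hJ
  have hqn : q.re ^ 2 + s ^ 2 = 1 := by
    have h1 : Quaternion.normSq q = 1 := by
      rw [Quaternion.normSq_eq_norm_mul_self, hq, one_mul]
    rw [Quaternion.normSq_def', e1, e2, e3] at h1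
    linear_combination h1 - s ^ 2 * hn
  obtain ⟨t, ht1, ht2⟩ : ∃ t, Real.cos t = q.re ∧ Real.sin t = s := by
    have hne : (⟨q.re, s⟩ : ℂ) ≠ 0 := by
      intro h0
      have h1 := congrArg Complex.re h0
      have h2 := congrArg Complex.im h0
      simp at h1 h2
      rw [h1, h2] at hqn
      norm_num at hqn
    have hnorm : ‖(⟨q.re, s⟩ : ℂ)‖ = 1 := by
      rw [Complex.norm_def, Complex.normSq_mk, ← sq, ← sq, hqn, Real.sqrt_one]
    refine ⟨Complex.arg ⟨q.re, s⟩, ?_, ?_⟩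
    · rw [Complex.cos_arg hne, hnorm, div_one]
    · rw [Complex.sin_arg, hnorm, div_one]
  refine ⟨t, ?_⟩
  ext <;> simp [circ, ht1, ht2, hre]
  · exact e1
  · exact e2
  · exact e3

/-! ### Differentiation and integration on the unit interval -/

section Calculus

variable {F G : Type*} [NormedAddCommGroup F] [NormedSpace ℝ F]
  [NormedAddCommGroup G] [NormedSpace ℝ G]

/-- `dg` is the derivative of `g` on `[0,1]`, one-sided at the end points. -/
def HasDerivI (g dg : I → F) : Prop :=
  ∀ u : I, HasDerivWithinAt (Set.IccExtend (zero_le_one' ℝ) g) (dg u) (Icc (0 : ℝ) 1) (u : ℝ)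

theorem HasDerivI.add {g h dg dh : I → F} (hg : HasDerivI g dg) (hh : HasDerivI h dh) :
    HasDerivI (fun u => g u + h u) (fun u => dg u + dh u) := fun u => (hg u).add (hh u)

theorem HasDerivI.sub {g h dg dh : I → F} (hg : HasDerivI g dg) (hh : HasDerivI h dh) :
    HasDerivI (fun u => g u - h u) (fun u => dg u - dh u) := fun u => (hg u).sub (hh u)

theorem HasDerivI.const (c : F) : HasDerivI (fun _ => c) (fun _ => 0) :=
  fun _ => hasDerivWithinAt_const _ _ _

theorem HasDerivI.clm (L : F →L[ℝ] G) {g dg : I → F} (hg : HasDerivI g dg) :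
    HasDerivI (fun u => L (g u)) (fun u => L (dg u)) :=
  fun u => L.hasFDerivAt.comp_hasDerivWithinAt (u : ℝ) (hg u)

theorem HasDerivI.congr {g h dg dh : I → F} (hg : HasDerivI g dg) (h1 : ∀ u, h u = g u)
    (h2 : ∀ u, dh u = dg u) : HasDerivI h dh := by
  rw [funext h1, funext h2]; exact hg

theorem HasDerivI.mul {A : Type*} [NormedRing A] [NormedAlgebra ℝ A] {g h dg dh : I → A}
    (hg : HasDerivI g dg) (hh : HasDerivI h dh) :
    HasDerivI (fun u => g u * h u) (fun u => dg u * h u + g u * dh u) := fun u => by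
  have := (hg u).mul (hh u)
  simpa using! this

theorem HasDerivI.smul {g dg : I → ℝ} {h dh : I → F}
    (hg : HasDerivI g dg) (hh : HasDerivI h dh) :
    HasDerivI (fun u => g u • h u) (fun u => dg u • h u + g u • dh u) := fun u => by
  have := (hg u).smul (hh u)
  rw [add_comm] at this
  simpa using! this

theorem HasDerivI.scomp {g : ℝ → F} {dg : I → F} (h : ∀ u : I, HasDerivAt g (dg u) u) :
    HasDerivI (fun u => g u) dg := fun u => by
  refine (h u).hasDerivWithinAt.congr (fun t ht => ?_) ?_
  · rw [Set.IccExtend_of_mem _ _ ht]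
  · simp

theorem HasDerivI.coe : HasDerivI (fun u : I => (u : ℝ)) (fun _ => 1) :=
  HasDerivI.scomp (g := fun t => t) fun _ => hasDerivAt_id _

theorem HasDerivI.const_smul (c : ℝ) {g dg : I → F} (hg : HasDerivI g dg) :
    HasDerivI (fun u => c • g u) (fun u => c • dg u) :=
  hg.clm (c • ContinuousLinearMap.id ℝ F)

theorem HasDerivI.neg {g dg : I → F} (hg : HasDerivI g dg) :
    HasDerivI (fun u => -g u) (fun u => -dg u) :=
  hg.clm (-ContinuousLinearMap.id ℝ F)

theorem HasDerivI.eq_const {g : I → F} (hg : HasDerivI g (fun _ => 0)) (u : I) : g u = g 0 := by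
  have h := constant_of_has_deriv_right_zero (f := Set.IccExtend (zero_le_one' ℝ) g)
    (a := 0) (b := 1)
    (fun x hx => (hg ⟨x, hx⟩).continuousWithinAt)
    (fun x hx => (hg ⟨x, hx.1, hx.2.le⟩).mono_of_mem_nhdsWithin
      (Filter.mem_of_superset (Icc_mem_nhdsGE hx.2) (Icc_subset_Icc_left hx.1)))
    u u.2
  rw [Set.IccExtend_val, Set.IccExtend_of_mem _ _ (left_mem_Icc.2 zero_le_one)] at h
  exact h

variable [CompleteSpace F]

theorem hasDerivAt_integral_IccExtend (φ : C(I, F)) (t : ℝ) :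
    HasDerivAt (fun t => ∫ r in (0 : ℝ)..t, Set.IccExtend (zero_le_one' ℝ) φ r)
      (Set.IccExtend (zero_le_one' ℝ) φ t) t :=
  (φ.continuous.Icc_extend' (h := zero_le_one' ℝ)).integral_hasStrictDerivAt 0 t |>.hasDerivAt

omit [NormedSpace ℝ F] [CompleteSpace F] in
theorem norm_IccExtend_le (φ : C(I, F)) (t : ℝ) :
    ‖Set.IccExtend (zero_le_one' ℝ) φ t‖ ≤ ‖φ‖ := φ.norm_coe_le_norm _

/-- The primitive vanishing at `0`. -/
def integI : C(I, F) →L[ℝ] C(I, F) :=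
  LinearMap.mkContinuous
    { toFun := fun φ => ⟨fun u => ∫ r in (0 : ℝ)..u, Set.IccExtend (zero_le_one' ℝ) φ r,
        (continuous_iff_continuousAt.2 fun t =>
          (hasDerivAt_integral_IccExtend φ t).continuousAt).comp continuous_subtype_val⟩
      map_add' := fun φ ψ => by
        ext u
        simp only [ContinuousMap.coe_mk, ContinuousMap.add_apply]
        rw [← intervalIntegral.integral_add]
        · rfl
        · exact (φ.continuous.Icc_extend' (h := zero_le_one' ℝ)).intervalIntegrable _ _
        · exact (ψ.continuous.Icc_extend' (h := zero_le_one' ℝ)).intervalIntegrable _ _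
      map_smul' := fun c φ => by
        ext u
        simp only [ContinuousMap.coe_mk, ContinuousMap.smul_apply, RingHom.id_apply]
        rw [← intervalIntegral.integral_smul]
        rfl } 1
    (fun φ => by
      rw [one_mul, ContinuousMap.norm_le _ (norm_nonneg φ)]
      intro u
      refine (intervalIntegral.norm_integral_le_of_norm_le_const
        (fun t _ => norm_IccExtend_le φ t)).trans ?_
      rw [sub_zero, abs_of_nonneg u.2.1]
      exact mul_le_of_le_one_right (norm_nonneg _) u.2.2)

theorem integI_apply (φ : C(I, F)) (u : I) :
    integI φ u = ∫ r in (0 : ℝ)..u, Set.IccExtend (zero_le_one' ℝ) φ r := rfl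

@[simp] theorem integI_zero (φ : C(I, F)) : integI φ 0 = 0 := by simp [integI_apply]

theorem hasDerivI_integI (φ : C(I, F)) : HasDerivI (integI φ) φ := by
  have h := HasDerivI.scomp (fun u : I => hasDerivAt_integral_IccExtend φ (u : ℝ))
  exact h.congr (fun u => rfl) (fun u => by simp)

theorem HasDerivI.eq_integI {g : I → F} {φ : C(I, F)} (h : HasDerivI g φ) (u : I) :
    g u = g 0 + integI φ u := by
  have h1 : HasDerivI (fun u => g u - integI φ u) (fun _ => 0) :=
    (h.sub (hasDerivI_integI φ)).congr (fun _ => rfl) (fun _ => by simp)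
  have h2 := h1.eq_const u
  simp only [integI_zero, sub_zero] at h2
  rw [← h2]; abel

theorem integI_clm [CompleteSpace G] (L : F →L[ℝ] G) (φ : C(I, F)) (u : I) :
    integI (L.compLeftContinuous ℝ I φ) u = L (integI φ u) := by
  have h : HasDerivI (fun u => L (integI φ u)) (L.compLeftContinuous ℝ I φ) :=
    (hasDerivI_integI φ).clm L
  rw [h.eq_integI u]; simp

end Calculus

/-! ### Parallel transport -/

section Resolvent

variable {E : Type*} [NormedAddCommGroup E] [NormedSpace ℝ E]

/-- The inverse of `1 - T`. -/
def resolventOne (T : E →L[ℝ] E) : E →L[ℝ] E := Ring.inverse (1 - T)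

theorem contDiffAt_resolventOne [CompleteSpace E] {T : E →L[ℝ] E} (h : IsUnit (1 - T)) :
    ContDiffAt ℝ ∞ (resolventOne (E := E)) T := by
  obtain ⟨w, hw⟩ := h
  have h1 := contDiffAt_ringInverse ℝ (R := E →L[ℝ] E) (n := ∞) w
  rw [hw] at h1
  exact h1.comp T (contDiff_const.sub contDiff_id).contDiffAt

theorem resolventOne_sub {T : E →L[ℝ] E} (h : IsUnit (1 - T)) (φ : E) :
    resolventOne T (φ - T φ) = φ :=
  congrArg (fun T : E →L[ℝ] E => T φ) (Ring.inverse_mul_cancel _ h)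

theorem sub_resolventOne {T : E →L[ℝ] E} (h : IsUnit (1 - T)) (φ : E) :
    resolventOne T φ - T (resolventOne T φ) = φ :=
  congrArg (fun T : E →L[ℝ] E => T φ) (Ring.mul_inverse_cancel _ h)

/-- The factor `1 - T` divides `1 - T ^ n`, with the geometric sum as a commuting cofactor, and the
latter is invertible by the Neumann series. -/
theorem isUnit_one_sub_of_norm_pow_lt_one [CompleteSpace E] {T : E →L[ℝ] E} {n : ℕ}
    (h1 : ‖T ^ n‖ < 1) : IsUnit (1 - T) := by
  have h2 : IsUnit (1 - T ^ n) := isUnit_one_sub_of_norm_lt_one (R := E →L[ℝ] E) h1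
  rw [← mul_neg_geom_sum] at h2
  have h3 : Commute (1 - T) (∑ i ∈ Finset.range n, T ^ i) :=
    (mul_neg_geom_sum _ _).trans (geom_sum_mul_neg _ _).symm
  exact (h3.isUnit_mul_iff.1 h2).1

end Resolvent

section Transport

variable {A : Type*} [NormedRing A] [NormedAlgebra ℝ A] [CompleteSpace A]

/-- The operator `φ ↦ ∫₀ᵘ a φ`. -/
def volterra : C(I, A) →L[ℝ] C(I, A) →L[ℝ] C(I, A) :=
  (ContinuousLinearMap.compL ℝ C(I, A) C(I, A) C(I, A) integI).comp
    (ContinuousLinearMap.mul ℝ C(I, A))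

theorem volterra_apply (a φ : C(I, A)) : volterra a φ = integI (a * φ) := rfl

/-- The factor `u ^ n` is what lets the induction produce the factorial: integrating it gives `u ^
(n+1) / (n+1)`. -/
theorem norm_volterra_pow_apply_le (a φ : C(I, A)) (n : ℕ) (u : I) :
    ‖(volterra a ^ n) φ u‖ ≤ ‖a‖ ^ n * (u : ℝ) ^ n / n.factorial * ‖φ‖ := by
  induction n generalizing u with
  | zero => simpa using φ.norm_coe_le_norm u
  | succ n ih =>
    rw [pow_succ', mul_apply_eq_comp, volterra_apply, integI_apply]
    have hb : ∀ t ∈ Ioc (0 : ℝ) u,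
        ‖Set.IccExtend (zero_le_one' ℝ) (a * (volterra a ^ n) φ) t‖ ≤
          ‖a‖ * (‖a‖ ^ n / n.factorial * ‖φ‖) * t ^ n := by
      intro t ht
      have hm : t ∈ Icc (0 : ℝ) 1 := ⟨ht.1.le, ht.2.trans u.2.2⟩
      rw [Set.IccExtend_of_mem _ _ hm, ContinuousMap.mul_apply]
      refine (norm_mul_le _ _).trans ?_
      calc _ ≤ ‖a‖ * (‖a‖ ^ n * t ^ n / n.factorial * ‖φ‖) :=
            mul_le_mul (a.norm_coe_le_norm _) (ih ⟨t, hm⟩) (norm_nonneg _) (norm_nonneg _)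
        _ = _ := by ring
    refine (intervalIntegral.norm_integral_le_of_norm_le u.2.1
      (Filter.Eventually.of_forall hb)
      (Continuous.intervalIntegrable (by fun_prop) _ _)).trans (le_of_eq ?_)
    rw [intervalIntegral.integral_const_mul, integral_pow, Nat.factorial_succ]
    push_cast
    field_simp
    ring

/-- The powers of a Volterra operator decay like `‖a‖ ^ n / n!`, so some power has norm below one,
however large `a` is. -/
theorem isUnit_one_sub_volterra (a : C(I, A)) : IsUnit (1 - volterra a) := by
  obtain ⟨n, hn⟩ : ∃ n : ℕ, ‖a‖ ^ n / n.factorial < 1 :=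
    ((FloorSemiring.tendsto_pow_div_factorial_atTop ‖a‖).eventually_lt_const one_pos).exists
  have h1 : ‖volterra a ^ n‖ < 1 := by
    refine lt_of_le_of_lt (ContinuousLinearMap.opNorm_le_bound _ (by positivity) fun φ => ?_) hn
    rw [ContinuousMap.norm_le _ (by positivity)]
    intro u
    refine (norm_volterra_pow_apply_le a φ n u).trans ?_
    have : (u : ℝ) ^ n ≤ 1 := pow_le_one₀ u.2.1 u.2.2
    gcongr
    exact mul_le_of_le_one_right (by positivity) this
  exact isUnit_one_sub_of_norm_pow_lt_one h1

/-- The solution of `G' = a G`, `G 0 = 1`. -/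
def transport (a : C(I, A)) : C(I, A) := resolventOne (volterra a) 1

/-- Inversion in the Banach algebra of operators is smooth and `volterra` is linear in `a`, so no
parameter dependence theorem for differential equations is needed. -/
theorem contDiff_transport : ContDiff ℝ ∞ (transport (A := A)) := by
  have h : ContDiff ℝ ∞ fun a : C(I, A) => resolventOne (volterra a) := by
    rw [contDiff_iff_contDiffAt]
    intro a
    have hv : ContDiffAt ℝ ∞ (fun a => volterra a) a := by fun_prop
    have h1 := contDiffAt_resolventOne (isUnit_one_sub_volterra a)
    exact h1.comp a hv
  exact (ContinuousLinearMap.apply ℝ C(I, A) (1 : C(I, A))).contDiff.comp h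

theorem eq_of_sub_volterra_eq {a φ ψ : C(I, A)}
    (h : φ - volterra a φ = ψ - volterra a ψ) : φ = ψ := by
  rw [← resolventOne_sub (isUnit_one_sub_volterra a) φ, h,
    resolventOne_sub (isUnit_one_sub_volterra a)]

theorem transport_sub_volterra (a : C(I, A)) : transport a - volterra a (transport a) = 1 :=
  sub_resolventOne (isUnit_one_sub_volterra a) 1

theorem transport_eq (a : C(I, A)) : transport a = 1 + integI (a * transport a) := by
  rw [← volterra_apply, ← transport_sub_volterra a]; abel

@[simp] theorem transport_zero (a : C(I, A)) : transport a 0 = 1 := by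
  have := congrArg (fun S : C(I, A) => S 0) (transport_eq a)
  simpa using this

theorem hasDerivI_transport (a : C(I, A)) :
    HasDerivI (transport a) (fun u => a u * transport a u) := by
  have h := (HasDerivI.const (1 : A)).add (hasDerivI_integI (a * transport a))
  refine h.congr (fun u => ?_) (fun u => by simp)
  exact congrArg (fun S : C(I, A) => S u) (transport_eq a)

theorem eq_transport_mul {a S : C(I, A)} (h : HasDerivI S (fun u => a u * S u)) (u : I) :
    S u = transport a u * S 0 := by
  have h1 : S = transport a * ContinuousMap.const I (S 0) := by
    apply eq_of_sub_volterra_eq (a := a)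
    have e1 : S - volterra a S = ContinuousMap.const I (S 0) := by
      ext1 u
      have h2 : HasDerivI S (a * S : C(I, A)) := h
      have := h2.eq_integI u
      rw [ContinuousMap.sub_apply, volterra_apply, this]; simp
    rw [e1]
    ext1 u
    have h2 : HasDerivI (fun u => transport a u * S 0)
        (a * (transport a * ContinuousMap.const I (S 0)) : C(I, A)) :=
      ((hasDerivI_transport a).mul (HasDerivI.const (S 0))).congr (fun _ => rfl)
        (fun u => by simp [mul_assoc])
    have := h2.eq_integI u
    rw [ContinuousMap.sub_apply, volterra_apply, ContinuousMap.mul_apply, ContinuousMap.const_apply,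
      this]
    simp
  exact congrArg (fun S : C(I, A) => S u) h1

end Transport

/-! ### Transport by imaginary connections and its derivative -/

/-- Continuous quaternion-valued functions on the unit interval. -/
abbrev QPath : Type := C(I, ℍ[ℝ])

/-- Conjugation of quaternions as a real linear map. -/
def starQ : ℍ[ℝ] →L[ℝ] ℍ[ℝ] :=
  LinearMap.toContinuousLinearMap
    { toFun := star
      map_add' := star_add
      map_smul' := fun c q => Quaternion.star_smul c q }

theorem starQ_apply (q : ℍ[ℝ]) : starQ q = star q := rfl

/-- Conjugation of quaternion-valued functions as a real linear map. -/
def starC : QPath →L[ℝ] QPath := starQ.compLeftContinuous ℝ I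

theorem HasDerivI.star {g dg : I → ℍ[ℝ]} (h : HasDerivI g dg) :
    HasDerivI (fun u => star (g u)) (fun u => star (dg u)) :=
  h.clm starQ

/-- For imaginary `a` the factors `a` and `star a = -a` cancel in the derivative of `star G * G`. -/
theorem star_transport_mul {a : QPath} (ha : star a = -a) (u : I) :
    star (transport a u) * transport a u = 1 := by
  have hu : ∀ u, star (a u) = -a u := fun u => congrArg (fun S : QPath => S u) ha
  have h1 : HasDerivI (fun u => star (transport a u) * transport a u) (fun _ => 0) :=
    ((hasDerivI_transport a).star.mul (hasDerivI_transport a)).congr (fun _ => rfl)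
      (fun u => by simp [hu, mul_assoc])
  rw [h1.eq_const u]; simp

theorem norm_transport {a : QPath} (ha : star a = -a) (u : I) : ‖transport a u‖ = 1 := by
  have := star_transport_mul ha u
  rw [← norm_star]
  exact norm_eq_one_of_mul_star (by simpa using this)

theorem transport_mul_star {a : QPath} (ha : star a = -a) (u : I) :
    transport a u * star (transport a u) = 1 :=
  mul_star_self_of_norm_eq_one (norm_transport ha u)

/-- The derivative of parallel transport. -/
theorem fderiv_transport {a : QPath} (ha : star a = -a) (b : QPath) :
    fderiv ℝ transport a b =
      transport a * integI (star (transport a) * b * transport a) := by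
  have hd : HasFDerivAt transport (fderiv ℝ transport a) a :=
    ((contDiff_transport (A := ℍ[ℝ])).differentiable (by simp) a).hasFDerivAt
  have h1 : HasFDerivAt (fun a : QPath => transport a - integI (a * transport a)) 
      (0 : QPath →L[ℝ] QPath) a := by
    have : (fun a : QPath => transport a - integI (a * transport a)) = fun _ => 1 := by
      ext1 a; exact transport_sub_volterra a
    rw [this]; exact hasFDerivAt_const _ _
  have h2 := hd.sub (integI.hasFDerivAt.comp a ((hasFDerivAt_id a).mul' hd))
  have h3 := congrArg (fun T : QPath →L[ℝ] QPath => T b) (h2.unique h1)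
  replace h3 : fderiv ℝ transport a b -
      integI (a * fderiv ℝ transport a b + b * transport a) = 0 := h3
  -- Variation of constants: the claimed derivative `D` solves `D' = a D + b G` with `D 0 = 0`,
  -- which is the linearised transport equation. Uniqueness for the integral form of that equation
  -- concludes.
  have hD : HasDerivI (transport a * integI (star (transport a) * b * transport a) : QPath)
      (a * (transport a * integI (star (transport a) * b * transport a)) + b * transport a
        : QPath) := by
    refine ((hasDerivI_transport a).mul (hasDerivI_integI _)).congr (fun _ => rfl) fun u => ?_
    simp only [ContinuousMap.add_apply, ContinuousMap.mul_apply, ContinuousMap.star_apply,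
      ← mul_assoc, transport_mul_star ha, one_mul]
  apply eq_of_sub_volterra_eq (a := a)
  trans integI (b * transport a)
  · rw [sub_eq_zero] at h3
    rw [volterra_apply]
    nth_rw 1 [h3]
    rw [map_add]
    abel
  · ext1 u
    have := hD.eq_integI u
    rw [ContinuousMap.sub_apply, volterra_apply, this, map_add]
    simp

/-! ### Transported frames and their variation -/

theorem compLeftContinuous_apply' {F G : Type*} [NormedAddCommGroup F] [NormedSpace ℝ F]
    [NormedAddCommGroup G] [NormedSpace ℝ G] (L : F →L[ℝ] G) (φ : C(I, F)) (u : I) :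
    L.compLeftContinuous ℝ I φ u = L (φ u) := rfl

theorem hasDerivAt_starC {A : ℝ → QPath} {A' : QPath} {s : ℝ} (h : HasDerivAt A A' s) :
    HasDerivAt (fun t => star (A t)) (star A') s :=
  starC.hasFDerivAt.comp_hasDerivAt s h

theorem contDiff_starC : ContDiff ℝ ∞ (fun a : QPath => star a) := starC.contDiff

/-- The real part as a real linear map. -/
def reQ : ℍ[ℝ] →L[ℝ] ℝ :=
  LinearMap.toContinuousLinearMap
    { toFun := fun q => q.re
      map_add' := fun _ _ => rfl
      map_smul' := fun _ _ => rfl }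

theorem reQ_apply (q : ℍ[ℝ]) : reQ q = q.re := rfl

theorem star_apply_of_star_eq_neg {a : QPath} (ha : star a = -a) (u : I) : star (a u) = -a u :=
  congrArg (fun S : QPath => S u) ha

theorem re_apply_of_star_eq_neg {a : QPath} (ha : star a = -a) (u : I) : (a u).re = 0 :=
  Quaternion.star_eq_neg.1 (star_apply_of_star_eq_neg ha u)

theorem hasDerivI_star_transport {a : QPath} (ha : star a = -a) :
    HasDerivI (fun u => star (transport a u)) (fun u => -(star (transport a u) * a u)) :=
  (hasDerivI_transport a).star.congr (fun _ => rfl)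
    (fun u => by simp [star_apply_of_star_eq_neg ha])

/-- Solutions of `D' = [a, D]` are conjugated by parallel transport. -/
theorem eq_conj_transport {a : QPath} (ha : star a = -a) {D : I → ℍ[ℝ]}
    (hD : HasDerivI D (fun u => a u * D u - D u * a u)) (u : I) :
    D u = transport a u * D 0 * star (transport a u) := by
  have h1 : HasDerivI (fun u => star (transport a u) * D u * transport a u) (fun _ => 0) :=
    (((hasDerivI_star_transport ha).mul hD).mul (hasDerivI_transport a)).congr (fun _ => rfl)
      (fun u => by noncomm_ring)
  have h2 := h1.eq_const u
  simp only [transport_zero, star_one, one_mul, mul_one] at h2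
  rw [← h2]
  calc D u = (transport a u * star (transport a u)) * D u *
        (transport a u * star (transport a u)) := by rw [transport_mul_star ha]; simp
    _ = _ := by noncomm_ring

/-- The vector `v` transported along the unit interval. -/
def frame (a : QPath) (v : ℍ[ℝ]) : QPath :=
  transport a * ContinuousMap.const I v * star (transport a)

theorem frame_apply (a : QPath) (v : ℍ[ℝ]) (u : I) :
    frame a v u = transport a u * v * star (transport a u) := rfl

@[simp] theorem frame_zero (a : QPath) (v : ℍ[ℝ]) : frame a v 0 = v := by
  simp [frame_apply]

theorem star_frame (a : QPath) {v : ℍ[ℝ]} (hv : star v = -v) : star (frame a v) = -frame a v := by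
  ext1 u
  exact star_conj hv

theorem frame_mul_self {a : QPath} (ha : star a = -a) {v : ℍ[ℝ]} (hv : v * v = -1) (u : I) :
    frame a v u * frame a v u = -1 := by
  rw [frame_apply]
  calc _ = transport a u * v * (star (transport a u) * transport a u) * v *
        star (transport a u) := by noncomm_ring
    _ = transport a u * (v * v) * star (transport a u) := by
        rw [star_transport_mul ha]; noncomm_ring
    _ = _ := by rw [hv]; simp [transport_mul_star ha]

theorem hasDerivI_frame {a : QPath} (ha : star a = -a) (v : ℍ[ℝ]) :
    HasDerivI (frame a v) (fun u => a u * frame a v u - frame a v u * a u) := by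
  refine (((hasDerivI_transport a).mul (HasDerivI.const v)).mul
    (hasDerivI_star_transport ha)).congr (fun _ => rfl) (fun u => ?_)
  rw [frame_apply]; noncomm_ring

/-- The integral of the component of `a` along the transported vector. -/
def radial (a : QPath) (v : ℍ[ℝ]) : ℝ := -(integI (a * frame a v) 1).re

/-- The logarithmic derivative of parallel transport in the direction `a'`. -/
def gaugeGen (a a' : QPath) : QPath :=
  transport a * integI (star (transport a) * a' * transport a) * star (transport a)

theorem gaugeGen_zero (a a' : QPath) : gaugeGen a a' 0 = 0 := by simp [gaugeGen]

theorem star_integI {φ : QPath} (h : star φ = -φ) : star (integI φ) = -integI φ := by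
  ext1 u
  have h1 : HasDerivI (fun u => star (integI φ u)) (-φ : QPath) :=
    (hasDerivI_integI φ).star.congr (fun _ => rfl) (fun u => congrArg (fun S : QPath => S u) h.symm)
  have := h1.eq_integI u
  simp only [integI_zero, star_zero, zero_add, map_neg] at this
  exact this

theorem star_gaugeGen (a : QPath) {a' : QPath} (ha' : star a' = -a') :
    star (gaugeGen a a') = -gaugeGen a a' := by
  have h : star (star (transport a) * a' * transport a) =
      -(star (transport a) * a' * transport a) := by
    simp [mul_assoc, ha']
  rw [gaugeGen, star_mul, star_mul, star_integI h, star_star]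
  noncomm_ring

/-- Every variation `a'` of a connection is thus the covariant derivative of a parameter vanishing
at `0`. Its value at `1` measures the change of the holonomy. -/
theorem hasDerivI_gaugeGen {a : QPath} (ha : star a = -a) (a' : QPath) :
    HasDerivI (gaugeGen a a')
      (fun u => a' u + (a u * gaugeGen a a' u - gaugeGen a a' u * a u)) := by
  refine (((hasDerivI_transport a).mul (hasDerivI_integI _)).mul
    (hasDerivI_star_transport ha)).congr (fun _ => rfl) (fun u => ?_)
  have h1 : transport a u * (star (transport a) * a' * transport a) u * star (transport a u)
      = a' u := by
    calc _ = (transport a u * star (transport a u)) * a' u *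
          (transport a u * star (transport a u)) := by
          simp only [ContinuousMap.mul_apply, ContinuousMap.star_apply]; noncomm_ring
      _ = _ := by rw [transport_mul_star ha]; simp
  rw [add_mul, h1]
  simp only [gaugeGen, ContinuousMap.mul_apply, ContinuousMap.star_apply]
  noncomm_ring

theorem hasDerivAt_transport {A : ℝ → QPath} {A' : QPath} {s : ℝ} (hA : star (A s) = -A s)
    (hd : HasDerivAt A A' s) :
    HasDerivAt (fun t => transport (A t)) (gaugeGen (A s) A' * transport (A s)) s := by
  have h : HasFDerivAt transport (fderiv ℝ transport (A s)) (A s) :=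
    ((contDiff_transport (A := ℍ[ℝ])).differentiable (by simp) (A s)).hasFDerivAt
  have h1 := h.comp_hasDerivAt s hd
  rw [fderiv_transport hA] at h1
  refine h1.congr_deriv ?_
  have h2 : star (transport (A s)) * transport (A s) = 1 := by
    ext1 u; exact star_transport_mul hA u
  rw [gaugeGen, mul_assoc (_ * _), h2, mul_one]

theorem hasDerivAt_frame {A : ℝ → QPath} {A' : QPath} {s : ℝ} (hA : star (A s) = -A s)
    (hA' : star A' = -A') (hd : HasDerivAt A A' s) (v : ℍ[ℝ]) :
    HasDerivAt (fun t => frame (A t) v)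
      (gaugeGen (A s) A' * frame (A s) v - frame (A s) v * gaugeGen (A s) A') s := by
  have h := hasDerivAt_transport hA hd
  refine ((h.mul_const (ContinuousMap.const I v)).mul (hasDerivAt_starC h)).congr_deriv ?_
  rw [frame, star_mul, star_gaugeGen _ hA']
  noncomm_ring

theorem re_mul_comm (p q : ℍ[ℝ]) : (p * q).re = (q * p).re := by
  simp only [Quaternion.re_mul]; ring

/-- The variation of the radial integral. -/
theorem hasDerivAt_radial {A : ℝ → QPath} {A' : QPath} {s : ℝ} (hA : star (A s) = -A s)
    (hA' : star A' = -A') (hd : HasDerivAt A A' s) {v : ℍ[ℝ]} (hv : star v = -v) :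
    HasDerivAt (fun t => radial (A t) v)
      (-(gaugeGen (A s) A' 1 * frame (A s) v 1).re
        - 2 * (integI (frame (A s) v * A s * gaugeGen (A s) A') 1).re) s := by
  set X := frame (A s) v with hX
  set b := gaugeGen (A s) A' with hb
  have h1 := hd.mul (hasDerivAt_frame hA hA' hd v)
  have h2 := (reQ.comp ((ContinuousMap.evalCLM ℝ (1 : I)).comp
    (integI (F := ℍ[ℝ])))).hasFDerivAt.comp_hasDerivAt s h1
  refine h2.neg.congr_deriv ?_
  -- A primitive of the varied integrand. Since `b' = a' + [a, b]` and `X' = [a, X]`, the derivative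
  -- of `Re (b X)` is `Re (a' X)`. The remaining term `Re (a [b, X])` equals `2 Re (X a b)` for
  -- imaginary quaternions.
  have h3 : HasDerivI (fun u => (b u * X u).re + 2 * (integI (X * A s * b) u).re)
      (reQ.compLeftContinuous ℝ I (A' * X + A s * (b * X - X * b))) := by
    refine ((((hasDerivI_gaugeGen hA A').mul (hasDerivI_frame hA v)).clm reQ).add
      (((hasDerivI_integI (X * A s * b)).clm reQ).const_smul 2)).congr (fun _ => rfl) fun u => ?_
    have e1 := re_apply_of_star_eq_neg hA u
    have e2 : (b u).re = 0 := re_apply_of_star_eq_neg (star_gaugeGen _ hA') u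
    have e3 : (X u).re = 0 := re_apply_of_star_eq_neg (star_frame _ hv) u
    simp only [← hX, ← hb, compLeftContinuous_apply', reQ_apply,
      ContinuousMap.mul_apply, ContinuousMap.add_apply, ContinuousMap.sub_apply, smul_eq_mul,
      Quaternion.re_mul, Quaternion.imI_mul, Quaternion.imJ_mul, Quaternion.imK_mul,
      Quaternion.re_add, Quaternion.imI_add, Quaternion.imJ_add, Quaternion.imK_add,
      Quaternion.re_sub, Quaternion.imI_sub, Quaternion.imJ_sub, Quaternion.imK_sub, e1, e2, e3]
    ring
  have h4 := h3.eq_integI 1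
  rw [integI_clm] at h4
  have h5 : b 0 = 0 := gaugeGen_zero _ _
  simp only [h5, zero_mul, integI_zero, Quaternion.re_zero, mul_zero, zero_add, reQ_apply] at h4
  show -(integI (A' * X + A s * (b * X - X * b)) 1).re = _
  rw [← h4]
  ring

/-- The variation of the holonomy and of the radial integral under an infinitesimal gauge
transformation. -/
theorem hasDerivAt_of_gauge {A : ℝ → QPath} {A' B dB : QPath} {s l : ℝ} {v : ℍ[ℝ]}
    (hA : star (A s) = -A s) (hA' : star A' = -A') (hd : HasDerivAt A A' s)
    (hv : star v = -v) (hv1 : v * v = -1) (hB : HasDerivI B dB)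
    (hB0 : B 0 = 0) (hB1 : B 1 = 0)
    (h : ∀ u, A' u = dB u - (A s u * B u - B u * A s u)
      - (l * triple (frame (A s) v u) (A s u) (B u)) • frame (A s) v u) :
    HasDerivAt (fun t => transport (A t) 1)
      ((l * (integI (frame (A s) v * A s * B) 1).re) • (transport (A s) 1 * v)) s ∧
    HasDerivAt (fun t => radial (A t) v)
      ((l - 2) * (integI (frame (A s) v * A s * B) 1).re) s := by
  set X := frame (A s) v with hX
  set b := gaugeGen (A s) A' with hb
  set m : I → ℝ := fun u => (integI (X * A s * B) u).re with hm
  have hmd : HasDerivI m (fun u => (X u * A s u * B u).re) :=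
    (hasDerivI_integI (X * A s * B)).clm reQ
  -- The multiple `l m X` absorbs the radial term of the variation. The difference of the two sides
  -- solves `D' = [a, D]` with `D 0 = 0`, hence vanishes. At `u = 1`, where `B` is zero, only the
  -- multiple of `X` is left.
  have hbB : ∀ u, b u = B u + (l * m u) • X u := by
    have h1 : HasDerivI (fun u => b u - (B u + (l * m u) • X u)) (fun u =>
        A s u * (b u - (B u + (l * m u) • X u)) - (b u - (B u + (l * m u) • X u)) * A s u) := by
      refine ((hasDerivI_gaugeGen hA A').sub (hB.add ((hmd.const_smul l).smul
        (hasDerivI_frame hA v)))).congr (fun _ => rfl) fun u => ?_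
      rw [h u]
      simp only [triple, ← hX, ← hb, smul_eq_mul, mul_add, add_mul, mul_sub, sub_mul,
        smul_mul_assoc, mul_smul_comm]
      module
    intro u
    have h2 := eq_conj_transport hA h1 u
    have h3 : b 0 = 0 := gaugeGen_zero _ _
    simp only [h3, hB0, hm, integI_zero, Quaternion.re_zero, mul_zero, zero_smul, add_zero,
      sub_zero, zero_mul] at h2
    exact sub_eq_zero.1 h2
  have hX1 : X 1 * transport (A s) 1 = transport (A s) 1 * v := by
    rw [hX, frame_apply, mul_assoc, star_transport_mul hA, mul_one]
  constructor
  · have h1 := (ContinuousMap.evalCLM ℝ (1 : I)).hasFDerivAt.comp_hasDerivAt s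
      (hasDerivAt_transport hA hd)
    refine h1.congr_deriv ?_
    show b 1 * transport (A s) 1 = _
    rw [hbB 1, hB1, zero_add, smul_mul_assoc, hX1]
  · refine (hasDerivAt_radial hA hA' hd hv).congr_deriv ?_
    have h2 : X * A s * b = X * A s * B + X * A s * (b - B) := by noncomm_ring
    have h3 : HasDerivI (fun u => (integI (X * A s * b) u).re - m u) (fun _ => 0) := by
      refine (((hasDerivI_integI (X * A s * b)).clm reQ).sub hmd).congr (fun _ => rfl) fun u => ?_
      have e1 := re_apply_of_star_eq_neg hA u
      have e3 : (X u).re = 0 := re_apply_of_star_eq_neg (star_frame _ hv) u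
      simp only [ContinuousMap.mul_apply, hbB u, mul_add, mul_smul_comm, reQ_apply,
        Quaternion.re_add, Quaternion.re_smul, smul_eq_mul]
      -- Changing the parameter by a multiple of `X` does not affect the triple product with `X`.
      have : (X u * A s u * X u).re = 0 := by
        rw [re_mul_comm, ← mul_assoc, hX, frame_mul_self hA hv1]
        simp [e1]
      rw [this]; ring
    have h4 := h3.eq_const 1
    simp only [integI_zero, hm, Quaternion.re_zero, sub_zero] at h4
    have h5 : (X 1 * X 1).re = -1 := by rw [hX, frame_mul_self hA hv1]; simp
    rw [← hX, ← hb, sub_eq_zero.1 h4, hbB 1, hB1, zero_add, smul_mul_assoc, Quaternion.re_smul, h5]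
    simp only [hm, smul_eq_mul]
    ring

/-! ### Adding a constant radial component -/

/-- In the moving frame the added component is the constant `t v`, which commutes with its own
exponential, so the transports multiply. -/
theorem transport_shift {a : QPath} (ha : star a = -a) {v : ℍ[ℝ]} (hv : v * v = -1) (t : ℝ)
    (u : I) : transport (a + t • frame a v) u = transport a u * circ v (t * u) := by
  set S : QPath := ⟨fun u => transport a u * circ v (t * u), by
    have : Continuous (circ v) :=
      continuous_iff_continuousAt.2 fun s => (hasDerivAt_circ hv s).continuousAt
    fun_prop⟩ with hS
  have h1 : HasDerivI (fun u : I => circ v (t * u)) (fun u => t • (v * circ v (t * u))) := by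
    refine HasDerivI.scomp (g := fun r => circ v (t * r)) fun u => ?_
    have h2 : HasDerivAt (fun r : ℝ => t * r) t (u : ℝ) := by
      simpa using (hasDerivAt_id (u : ℝ)).const_mul t
    exact (hasDerivAt_circ hv (t * u)).scomp (u : ℝ) h2
  have h3 : HasDerivI S (fun u => (a + t • frame a v) u * S u) := by
    refine ((hasDerivI_transport a).mul h1).congr (fun _ => rfl) fun u => ?_
    show (a u + t • frame a v u) * (transport a u * circ v (t * u)) = _
    rw [add_mul, smul_mul_assoc, frame_apply, mul_smul_comm]
    congr 1
    · noncomm_ring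
    · congr 1
      calc _ = transport a u * v * (star (transport a u) * transport a u) * circ v (t * u) := by
            noncomm_ring
        _ = _ := by rw [star_transport_mul ha]; noncomm_ring
  have h4 := eq_transport_mul h3 u
  have h5 : S 0 = 1 := by simp [hS]
  rw [h5, mul_one] at h4
  exact h4.symm

theorem star_shift {a : QPath} (ha : star a = -a) {v : ℍ[ℝ]} (hv : star v = -v) (t : ℝ) :
    star (a + t • frame a v) = -(a + t • frame a v) := by
  ext1 u
  have h1 := star_apply_of_star_eq_neg ha u
  have h2 := star_apply_of_star_eq_neg (star_frame a hv) u
  simp only [ContinuousMap.star_apply, ContinuousMap.add_apply, ContinuousMap.smul_apply,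
    ContinuousMap.neg_apply, star_add, Quaternion.star_smul, h1, h2]
  module

/-- The added term commutes with the transported vector, which therefore satisfies the same equation
for both connections. -/
theorem frame_shift {a : QPath} (ha : star a = -a) {v : ℍ[ℝ]} (hv : star v = -v) (t : ℝ) :
    frame (a + t • frame a v) v = frame a v := by
  ext1 u
  have h := eq_conj_transport (star_shift ha hv t) (D := frame a v)
    ((hasDerivI_frame ha v).congr (fun _ => rfl) fun u => by
      simp only [ContinuousMap.add_apply, ContinuousMap.smul_apply, add_mul, mul_add,
        smul_mul_assoc, mul_smul_comm]
      module) u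
  rw [h, frame_zero]; rfl

/-- The transported vector is unchanged and squares to `-1`, so the integrand grows by the constant
`t`. -/
theorem radial_shift {a : QPath} (ha : star a = -a) {v : ℍ[ℝ]} (hv : star v = -v)
    (hv1 : v * v = -1) (t : ℝ) : radial (a + t • frame a v) v = radial a v + t := by
  have h1 : frame a v * frame a v = -1 := by
    ext1 u; exact frame_mul_self ha hv1 u
  have h2 : integI (1 : QPath) 1 = 1 := by
    have h3 : HasDerivI (fun u : I => (u : ℝ) • (1 : ℍ[ℝ])) (1 : QPath) :=
      (HasDerivI.coe.smul (HasDerivI.const (1 : ℍ[ℝ]))).congr (fun _ => rfl) (fun u => by simp)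
    have := h3.eq_integI 1
    simpa using this.symm
  rw [radial, radial, frame_shift ha hv, add_mul, smul_mul_assoc, h1, map_add, map_smul, map_neg]
  simp [h2]
  ring

/-! ### The constraint manifold in terms of quaternions -/

/-- The direction of a vector as an imaginary unit. -/
def dirQ (x : Vec 3) : ℍ[ℝ] := toQ (‖x‖⁻¹ • x)

theorem star_dirQ (x : Vec 3) : star (dirQ x) = -dirQ x := star_toQ _

theorem dirQ_mul_self {x : Vec 3} (hx : x ≠ 0) : dirQ x * dirQ x = -1 := by
  rw [dirQ, toQ_mul_self, norm_smul, norm_inv, norm_norm, inv_mul_cancel₀ (norm_ne_zero_iff.2 hx)]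
  simp

theorem norm_smul_dirQ {x : Vec 3} (hx : x ≠ 0) : ‖x‖ • dirQ x = toQ x := by
  rw [dirQ, map_smul, smul_smul, mul_inv_cancel₀ (norm_ne_zero_iff.2 hx), one_smul]

/-- The pointwise identification of vector-valued with imaginary quaternion-valued functions. -/
def toQC : C(I, Vec 3) →L[ℝ] QPath := toQ.compLeftContinuous ℝ I

/-- The pointwise imaginary part. -/
def ofQC : QPath →L[ℝ] C(I, Vec 3) := ofQ.compLeftContinuous ℝ I

theorem toQC_apply (η : C(I, Vec 3)) (u : I) : toQC η u = toQ (η u) := rfl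
theorem ofQC_apply (a : QPath) (u : I) : ofQC a u = ofQ (a u) := rfl

theorem star_toQC (η : C(I, Vec 3)) : star (toQC η) = -toQC η := by
  ext1 u; exact star_toQ _

theorem toQC_ofQC {a : QPath} (ha : star a = -a) : toQC (ofQC a) = a := by
  ext1 u; exact toQ_ofQ (star_apply_of_star_eq_neg ha u)

theorem ofQC_toQC (η : C(I, Vec 3)) : ofQC (toQC η) = η := by
  ext1 u; exact ofQ_toQ _

/-- The `su(2)`-connection on the unit interval given by a covector field along a path. -/
def conn (f : ℝ → ℝ) (e : Vec 3 × C(I, Vec 3)) : QPath := (-(f ‖e.1‖ / 2)) • toQC e.2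

theorem star_smul_of_star_eq_neg {a : QPath} (ha : star a = -a) (c : ℝ) :
    star (c • a) = -(c • a) := by
  ext1 u
  have h1 := star_apply_of_star_eq_neg ha u
  simp [h1]

theorem star_conn (f : ℝ → ℝ) (e : Vec 3 × C(I, Vec 3)) : star (conn f e) = -conn f e :=
  star_smul_of_star_eq_neg (star_toQC _) _

theorem conn_apply (f : ℝ → ℝ) (e : Vec 3 × C(I, Vec 3)) (u : I) :
    conn f e u = (-(f ‖e.1‖ / 2)) • toQ (e.2 u) := rfl

section Constraint

variable {f : ℝ → ℝ}

/-- The constraint manifold over the punctured space. -/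
abbrev RotConstraint (f : ℝ → ℝ) : Type := Constraint puncturedSpace (rotBivector f)

theorem Constraint.X_ne_zero (c : RotConstraint f) (u : I) : c.X u ≠ 0 := c.mem u

theorem Constraint.hasDerivI_toQ (c : RotConstraint f) :
    HasDerivI (fun u => toQ (c.X u)) (fun u => (-(f ‖c.X u‖ / 2)) •
      (toQ (c.η u) * toQ (c.X u) - toQ (c.X u) * toQ (c.η u))) := by
  have h : HasDerivI c.X (fun u => -sharp (rotBivector f) (c.X u) (c.η u)) := c.gauss
  refine (h.clm toQ).congr (fun _ => rfl) fun u => ?_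
  rw [map_neg, toQ_sharp, neg_smul]

/-- The square of an imaginary quaternion is real, hence central, and the derivative of `X²` is a
multiple of `[η, X²]`. -/
theorem Constraint.norm_X (c : RotConstraint f) (u : I) : ‖c.X u‖ = ‖c.X 0‖ := by
  have h1 : HasDerivI (fun u => toQ (c.X u) * toQ (c.X u)) (fun _ => 0) := by
    refine (c.hasDerivI_toQ.mul c.hasDerivI_toQ).congr (fun _ => rfl) fun u => ?_
    rw [smul_mul_assoc, mul_smul_comm, ← smul_add]
    have h2 : (toQ (c.η u) * toQ (c.X u) - toQ (c.X u) * toQ (c.η u)) * toQ (c.X u) +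
        toQ (c.X u) * (toQ (c.η u) * toQ (c.X u) - toQ (c.X u) * toQ (c.η u)) =
        toQ (c.η u) * (toQ (c.X u) * toQ (c.X u)) - (toQ (c.X u) * toQ (c.X u)) * toQ (c.η u) := by
      noncomm_ring
    rw [h2, toQ_mul_self]
    simp only [mul_neg, neg_mul, Quaternion.coe_mul_eq_smul, Quaternion.mul_coe_eq_smul]
    simp
  have h3 := h1.eq_const u
  simp only [toQ_mul_self, neg_inj, Quaternion.coe_inj] at h3
  exact (pow_left_inj₀ (norm_nonneg _) (norm_nonneg _) two_ne_zero).1 h3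

/-- As the norm is constant, the coefficient `f(|X|)` is a constant too, and the constraint becomes
the linear equation `X' = [a, X]`. -/
theorem Constraint.toQ_X (c : RotConstraint f) (u : I) :
    toQ (c.X u) = ‖c.X 0‖ • frame (conn f c.chart) (dirQ (c.X 0)) u := by
  have h := eq_conj_transport (star_conn f c.chart) (c.hasDerivI_toQ.congr (fun _ => rfl)
    (dh := fun u => conn f c.chart u * toQ (c.X u) - toQ (c.X u) * conn f c.chart u) fun u => by
      rw [conn_apply, c.norm_X u, smul_mul_assoc, mul_smul_comm, ← smul_sub]
      rfl) u
  rw [h, frame_apply, ← norm_smul_dirQ (c.X_ne_zero 0), mul_smul_comm, smul_mul_assoc]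

theorem norm_ofQ_frame {a : QPath} (ha : star a = -a) {v : ℍ[ℝ]} (hv : star v = -v)
    (hv1 : v * v = -1) (u : I) : ‖ofQ (frame a v u)‖ = 1 := by
  have h1 : star (frame a v u) = -frame a v u :=
    star_apply_of_star_eq_neg (star_frame a hv) u
  rw [← norm_toQ, toQ_ofQ h1]
  apply norm_eq_one_of_mul_star
  rw [h1, mul_neg, frame_mul_self ha hv1, neg_neg]

/-- The solution with given initial point and covector field. -/
def solution (f : ℝ → ℝ) (x : Vec 3) (hx : x ≠ 0) (η : C(I, Vec 3)) : RotConstraint f where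
  X := ‖x‖ • ofQC (frame (conn f (x, η)) (dirQ x))
  η := η
  mem u := by
    have h := norm_ofQ_frame (star_conn f (x, η)) (star_dirQ x) (dirQ_mul_self hx) u
    refine smul_ne_zero (norm_ne_zero_iff.2 hx) (norm_ne_zero_iff.1 ?_)
    rw [ofQC_apply, h]; exact one_ne_zero
  gauss := by
    have hv := star_dirQ x
    have h := ((hasDerivI_frame (star_conn f (x, η)) (dirQ x)).clm ofQ).const_smul ‖x‖
    refine HasDerivI.congr h (fun _ => rfl) fun u => ?_
    have h1 : star (frame (conn f (x, η)) (dirQ x) u) = -frame (conn f (x, η)) (dirQ x) u :=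
      star_apply_of_star_eq_neg (star_frame _ hv) u
    have hn : ‖‖x‖ • ofQ (frame (conn f (x, η)) (dirQ x) u)‖ = ‖x‖ := by
      rw [norm_smul, norm_ofQ_frame (star_conn f (x, η)) hv (dirQ_mul_self hx)]; simp
    rw [← ofQ_toQ (-sharp _ _ _), map_neg, toQ_sharp]
    simp only [ContinuousMap.smul_apply, ofQC_apply]
    rw [hn, map_smul toQ, toQ_ofQ h1, ← map_smul ofQ]
    congr 1
    simp only [conn_apply, smul_mul_assoc, mul_smul_comm]
    module

theorem solution_chart (x : Vec 3) (hx : x ≠ 0) (η : C(I, Vec 3)) :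
    (solution f x hx η).chart = (x, η) := by
  refine Prod.ext ?_ rfl
  show ‖x‖ • ofQ (frame (conn f (x, η)) (dirQ x) 0) = x
  rw [frame_zero, ← map_smul, norm_smul_dirQ hx, ofQ_toQ]

theorem Constraint.chart_injective :
    Function.Injective (Constraint.chart (M := puncturedSpace) (α := rotBivector f)) := by
  intro c c' h
  have h1 : c.X 0 = c'.X 0 := congrArg Prod.fst h
  refine Constraint.ext (ContinuousMap.ext fun u => toQ_injective ?_) (congrArg Prod.snd h)
  rw [c.toQ_X, c'.toQ_X, h, h1]

theorem range_chart : range (Constraint.chart (M := puncturedSpace) (α := rotBivector f)) =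
    {e | e.1 ≠ 0} := by
  ext e
  constructor
  · rintro ⟨c, rfl⟩
    exact c.X_ne_zero 0
  · intro he
    exact ⟨solution f e.1 he e.2, solution_chart _ _ _⟩

theorem isOpen_ne_fst : IsOpen {e : Vec 3 × C(I, Vec 3) | e.1 ≠ 0} :=
  isOpen_ne.preimage continuous_fst

theorem Constraint.continuous_chart :
    Continuous (Constraint.chart (M := puncturedSpace) (α := rotBivector f)) :=
  continuous_induced_dom

end Constraint

/-! ### The equivalence relation on invariants -/

/-- The relation between the invariants of gauge equivalent solutions. -/
def Orb (f : ℝ → ℝ) (e e' : Vec 3 × C(I, Vec 3)) : Prop :=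
  e'.1 = e.1 ∧ ∃ θ : ℝ,
    transport (conn f e') 1 =
      transport (conn f e) 1 * circ (dirQ e.1) (-(logSlope f ‖e.1‖ * θ)) ∧
    radial (conn f e') (dirQ e.1) = radial (conn f e) (dirQ e.1) + (1 - logSlope f ‖e.1‖) * θ

theorem Orb.refl (f : ℝ → ℝ) (e : Vec 3 × C(I, Vec 3)) : Orb f e e :=
  ⟨rfl, 0, by simp, by simp⟩

theorem Orb.symm {f : ℝ → ℝ} {e e' : Vec 3 × C(I, Vec 3)} (he : e.1 ≠ 0) (h : Orb f e e') :
    Orb f e' e := by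
  obtain ⟨h1, θ, h2, h3⟩ := h
  refine ⟨h1.symm, -θ, ?_, ?_⟩
  · rw [h1, h2, mul_assoc, ← circ_add (dirQ_mul_self he)]
    simp
  · rw [h1, h3]; ring

theorem Orb.trans {f : ℝ → ℝ} {e e' e'' : Vec 3 × C(I, Vec 3)} (he : e.1 ≠ 0) (h : Orb f e e')
    (h' : Orb f e' e'') : Orb f e e'' := by
  obtain ⟨h1, θ, h2, h3⟩ := h
  obtain ⟨h1', θ', h2', h3'⟩ := h'
  rw [h1] at h1' h2' h3'
  refine ⟨h1', θ + θ', ?_, ?_⟩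
  · rw [h2', h2, mul_assoc, ← circ_add (dirQ_mul_self he)]
    congr 2; ring
  · rw [h3', h3]; ring

/-! ### Gauge curves preserve the invariants -/

/-- Gauge curves are only assumed differentiable at each point of `[0,1]`. Continuity of the
derivative field in the sup norm upgrades this to differentiability in the Banach space, by writing
the curve as an integral. -/
theorem hasDerivAt_of_forall_apply {F : Type*} [NormedAddCommGroup F] [NormedSpace ℝ F]
    [CompleteSpace F] {γ D : ℝ → C(I, F)} (hD : Continuous D)
    (h : ∀ s u, HasDerivAt (fun t => γ t u) (D s u) s) (s : ℝ) : HasDerivAt γ (D s) s := by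
  have h1 : γ = fun t => γ 0 + ∫ r in (0 : ℝ)..t, D r := by
    ext t u
    have h2 : (∫ r in (0 : ℝ)..t, D r) u = ∫ r in (0 : ℝ)..t, D r u :=
      ((ContinuousMap.evalCLM ℝ u).intervalIntegral_comp_comm (hD.intervalIntegrable 0 t)).symm
    have h3 : Continuous fun r => D r u := (ContinuousMap.evalCLM ℝ u).continuous.comp hD
    rw [ContinuousMap.add_apply, h2, intervalIntegral.integral_eq_sub_of_hasDerivAt
      (fun r _ => h r u) (h3.intervalIntegrable _ _)]
    abel
  rw [h1]
  exact (hD.integral_hasStrictDerivAt 0 s).hasDerivAt.const_add _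

/-- The real part, as a map from quaternions to quaternions. -/
def reQQ : ℍ[ℝ] →L[ℝ] ℍ[ℝ] := reQ.smulRight 1

/-- The pointwise real part. -/
def reC : QPath →L[ℝ] QPath := reQQ.compLeftContinuous ℝ I

theorem reC_apply (a : QPath) (u : I) : reC a u = (a u).re • 1 := rfl

theorem continuous_star_qpath : Continuous fun a : QPath => star a := contDiff_starC.continuous

theorem continuous_frame (v : ℍ[ℝ]) : Continuous fun a => frame a v := by
  have h1 : Continuous (transport : QPath → QPath) := contDiff_transport.continuous
  exact (h1.mul continuous_const).mul (continuous_star_qpath.comp h1)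

theorem contDiff_const_path : ContDiff ℝ ∞ (fun v : ℍ[ℝ] => ContinuousMap.const I v) :=
  (IsBoundedLinearMap.contDiff (𝕜 := ℝ)
    { map_add := fun _ _ => rfl
      map_smul := fun _ _ => rfl
      bound := ⟨1, one_pos, fun v => by
        rw [one_mul, ContinuousMap.norm_le _ (norm_nonneg v)]; intro u; rfl⟩ })

/-- The variation formulas of `hasDerivAt_of_gauge` are integrated along the curve. The initial
point does not move, so `R`, `v` and `C` are constants. -/
theorem GaugeCurve.orb {f : ℝ → ℝ} (hf : ContDiffOn ℝ ∞ f (Set.Ioi 0))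
    (hf0 : ∀ R : ℝ, 0 < R → f R ≠ 0) {c₀ c₁ : RotConstraint f} (h : GaugeCurve c₀ c₁) :
    Orb f c₀.chart c₁.chart := by
  have hend := h.endpoints.1
  obtain ⟨γ, β, dβ, hγ, hβ, hdβ, rfl, rfl, h⟩ := h
  set x := (γ 0).X 0 with hx
  have hx0 : x ≠ 0 := (γ 0).X_ne_zero 0
  have hR : 0 < ‖x‖ := norm_pos_iff.2 hx0
  have hX0 : ∀ s, (γ s).X 0 = x := fun s => by
    refine is_const_of_deriv_eq_zero (f := fun t => (γ t).X 0)
      (fun s => ((h s).2.2.2 0).1.differentiableAt) (fun s => ?_) s 0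
    rw [((h s).2.2.2 0).1.deriv, (h s).2.1, sharp_zero, neg_zero]
  set R := ‖x‖ with hRdef
  set v := dirQ x with hv
  have hv1 : v * v = -1 := dirQ_mul_self hx0
  have hv2 : star v = -v := star_dirQ x
  have hfR := hf0 R hR
  have hfd : DifferentiableAt ℝ f R :=
    (hf.differentiableOn (by simp)).differentiableAt (Ioi_mem_nhds hR)
  set A : ℝ → QPath := fun s => conn f (γ s).chart with hA
  have hAs : ∀ s, star (A s) = -A s := fun s => star_conn _ _
  have hAu : ∀ s u, A s u = (-(f R / 2)) • toQ ((γ s).η u) := fun s u => by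
    rw [hA]; simp only [conn_apply]
    rw [show (γ s).chart.1 = x from hX0 s]; rfl
  set B : ℝ → QPath := fun s => (-(f R / 2)) • toQC (β s) with hB
  set dB : ℝ → QPath := fun s => (-(f R / 2)) • toQC (dβ s) with hdB
  set X : ℝ → QPath := fun s => frame (A s) v with hXdef
  have hX : ∀ s u, toQ ((γ s).X u) = R • X s u := fun s u => by
    rw [(γ s).toQ_X, hX0 s]
  -- Rescaling `η` and `β` by `-f/2` turns the coefficient of the radial term into `-(f/2) f' R
  -- (2/f)² = -2C`.
  set l := 2 * logSlope f R with hl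
  set A' : ℝ → QPath := fun s => dB s - (A s * B s - B s * A s) +
    l • (reC (X s * A s * B s) * X s) with hA'
  have hAc : Continuous A := by
    have h1 : Continuous fun s => (γ s).chart := Constraint.continuous_chart.comp hγ
    have h2 : A = fun s => (-(f R / 2)) • toQC (γ s).chart.2 := by
      ext s u : 2; exact hAu s u
    rw [h2]
    exact (toQC.continuous.comp (continuous_snd.comp h1)).const_smul (-(f R / 2))
  have hBc : Continuous B := (toQC.continuous.comp hβ).const_smul (-(f R / 2))
  have hdBc : Continuous dB := (toQC.continuous.comp hdβ).const_smul (-(f R / 2))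
  have hXc : Continuous X := (continuous_frame v).comp hAc
  have hA'c : Continuous A' := (hdBc.sub ((hAc.mul hBc).sub (hBc.mul hAc))).add
    (((reC.continuous.comp ((hXc.mul hAc).mul hBc)).mul hXc).const_smul l)
  have hA'u : ∀ s u, A' s u = dB s u - (A s u * B s u - B s u * A s u)
      - (l * triple (X s u) (A s u) (B s u)) • X s u := fun s u => by
    simp only [hA', ContinuousMap.add_apply, ContinuousMap.sub_apply, ContinuousMap.mul_apply,
      ContinuousMap.smul_apply, reC_apply, triple, smul_mul_assoc, one_mul]
    module
  have hAd : ∀ s u, HasDerivAt (fun t => A t u) (A' s u) s := fun s u => by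
    have h1 := ((toQ.hasFDerivAt.comp_hasDerivAt s ((h s).2.2.2 u).2).const_smul (-(f R / 2)))
    have h2 : (fun t => A t u) = fun t => (-(f R / 2)) • toQ ((γ t).η u) := by
      ext1 t; exact hAu t u
    rw [h2]
    refine h1.congr_deriv ?_
    have hn : ‖(γ s).X u‖ = R := by rw [(γ s).norm_X, hX0 s]
    rw [map_add, toQ_gauge_term ((γ s).X_ne_zero u) (by rw [hn]; exact hfd), hn, hA'u]
    simp only [hX s u, hAu, hB, hdB, hl, logSlope, ContinuousMap.smul_apply, toQC_apply, triple,
      smul_mul_assoc, mul_smul_comm, Quaternion.re_smul, smul_eq_mul]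
    match_scalars <;> field_simp
  have hAd' : ∀ s, HasDerivAt A (A' s) s := hasDerivAt_of_forall_apply hA'c hAd
  have hA's : ∀ s, star (A' s) = -A' s := fun s => by
    have h1 := (hasDerivAt_starC (hAd' s)).unique ((hAd' s).neg.congr_of_eventuallyEq
      (Filter.Eventually.of_forall fun t => hAs t))
    exact h1
  set K : ℝ → ℝ := fun s => (integI (X s * A s * B s) 1).re with hK
  have hKc : Continuous K := (reQ.comp ((ContinuousMap.evalCLM ℝ (1 : I)).comp
    (integI (F := ℍ[ℝ])))).continuous.comp ((hXc.mul hAc).mul hBc)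
  have hvar := fun s => hasDerivAt_of_gauge (l := l) (hAs s) (hA's s) (hAd' s) hv2 hv1
    (B := B s) (dB := dB s)
    (by exact ((HasDerivI.clm toQ (h s).1).const_smul (-(f R / 2))))
    (by simp [hB, toQC_apply, (h s).2.1]) (by simp [hB, toQC_apply, (h s).2.2.1]) (hA'u s)
  -- With `θ' = -2K` the rates `2C K` of the holonomy angle and `(2C - 2) K` of the radial integral
  -- become `-C θ'` and `(1 - C) θ'`.
  set θ : ℝ → ℝ := fun s => ∫ r in (0 : ℝ)..s, -2 * K r with hθ
  have hθd : ∀ s, HasDerivAt θ (-2 * K s) s := fun s =>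
    ((continuous_const.mul hKc).integral_hasStrictDerivAt 0 s).hasDerivAt
  have hθ0 : θ 0 = 0 := by simp [hθ]
  refine ⟨hend.symm, θ 1, ?_, ?_⟩
  · have h1 : ∀ s, HasDerivAt (fun s => transport (A s) 1 * circ v (logSlope f R * θ s)) 0 s := by
      intro s
      have h2 := (hasDerivAt_circ hv1 (logSlope f R * θ s)).scomp s
        ((hθd s).const_mul (logSlope f R))
      refine ((hvar s).1.mul h2).congr_deriv ?_
      have hKs : (integI (frame (A s) v * A s * B s) 1).re = K s := rfl
      rw [hKs]
      simp only [hl, Function.comp_apply, mul_smul_comm, smul_mul_assoc, mul_assoc]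
      module
    have h3 := is_const_of_deriv_eq_zero (fun s => (h1 s).differentiableAt)
      (fun s => (h1 s).deriv) 1 0
    simp only [hθ0, mul_zero, circ_zero, mul_one] at h3
    show transport (A 1) 1 = transport (A 0) 1 * circ v (-(logSlope f R * θ 1))
    rw [← h3, mul_assoc, ← circ_add hv1]
    simp
  · have h1 : ∀ s, HasDerivAt (fun s => radial (A s) v - (1 - logSlope f R) * θ s) 0 s := by
      intro s
      refine ((hvar s).2.sub ((hθd s).const_mul (1 - logSlope f R))).congr_deriv ?_
      simp only [hl, hK]
      ring
    have h3 := is_const_of_deriv_eq_zero (fun s => (h1 s).differentiableAt)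
      (fun s => (h1 s).deriv) 1 0
    simp only [hθ0, mul_zero, sub_zero] at h3
    show radial (A 1) v = radial (A 0) v + (1 - logSlope f R) * θ 1
    rw [← h3]; ring

theorem PhaseSpace.orb_of_mk_eq {f : ℝ → ℝ} (hf : ContDiffOn ℝ ∞ f (Set.Ioi 0))
    (hf0 : ∀ R : ℝ, 0 < R → f R ≠ 0) {c₀ c₁ : RotConstraint f}
    (h : PhaseSpace.mk c₀ = PhaseSpace.mk c₁) : Orb f c₀.chart c₁.chart := by
  have h1 := Quot.eqvGen_exact h
  clear h
  induction h1 with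
  | rel c c' h => exact h.orb hf hf0
  | refl c => exact Orb.refl _ _
  | symm c c' h ih => exact ih.symm (c.X_ne_zero 0)
  | trans c c' c'' h h' ih ih' =>
    exact ih.trans (c.X_ne_zero 0) ih'

/-! ### Construction of gauge curves -/

theorem conn_smul_ofQC {f : ℝ → ℝ} {x : Vec 3} (hx : f ‖x‖ ≠ 0) {a : QPath}
    (ha : star a = -a) : conn f (x, ofQC ((-(2 / f ‖x‖)) • a)) = a := by
  rw [conn, toQC_ofQC (star_smul_of_star_eq_neg ha _), smul_smul]
  have : -(f ‖x‖ / 2) * -(2 / f ‖x‖) = 1 := by field_simp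
  simp [this]

theorem continuous_gaugeGen {a a' : ℝ → QPath} (ha : Continuous a) (ha' : Continuous a') :
    Continuous fun s => gaugeGen (a s) (a' s) := by
  have h1 : Continuous fun s => transport (a s) :=
    (contDiff_transport (A := ℍ[ℝ])).continuous.comp ha
  have h2 : Continuous fun s => star (transport (a s)) := continuous_star_qpath.comp h1
  exact (h1.mul (integI.continuous.comp ((h2.mul ha').mul h1))).mul h2

/-- The value at `1` is the logarithmic derivative of the holonomy, so constant holonomy yields an
admissible gauge parameter. -/
theorem gaugeGen_one_eq_zero {a : ℝ → QPath} {a' : QPath} {s : ℝ} (hs : ∀ s, star (a s) = -a s)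
    (hd : HasDerivAt a a' s) (hc : ∀ t, transport (a t) 1 = transport (a s) 1) :
    gaugeGen (a s) a' 1 = 0 := by
  have h1 := (ContinuousMap.evalCLM ℝ (1 : I)).hasFDerivAt.comp_hasDerivAt s
    (hasDerivAt_transport (hs s) hd)
  have h2 : HasDerivAt (fun t => transport (a t) 1) 0 s := by
    rw [funext hc]; exact hasDerivAt_const _ _
  have h3 : gaugeGen (a s) a' 1 * transport (a s) 1 = 0 := h1.unique h2
  calc _ = gaugeGen (a s) a' 1 * transport (a s) 1 * star (transport (a s) 1) := by
        rw [mul_assoc, transport_mul_star (hs s), mul_one]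
    _ = 0 := by rw [h3, zero_mul]

theorem star_eq_neg_of_hasDerivAt {a : ℝ → QPath} {a' : QPath} {s : ℝ}
    (hs : ∀ s, star (a s) = -a s) (hd : HasDerivAt a a' s) : star a' = -a' :=
  (hasDerivAt_starC hd).unique (hd.neg.congr_of_eventuallyEq (Filter.Eventually.of_forall hs))

/-- The triple product is alternating on imaginary quaternions, so it ignores multiples of `x` in
the other two entries. -/
theorem triple_shift {x a b : ℍ[ℝ]} (hx : x * x = -1) (ha : a.re = 0) (hb : b.re = 0)
    (hxr : x.re = 0) (s t : ℝ) : triple x (a + s • x) (b + t • x) = triple x a b := by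
  have h : x * (a + s • x) * (b + t • x) = x * a * b + t • (x * a * x) + s • ((x * x) * b)
      + (s * t) • ((x * x) * x) := by
    simp only [mul_add, add_mul, mul_smul_comm, smul_mul_assoc]
    module
  have h2 : (x * a * x).re = 0 := by
    rw [re_mul_comm, ← mul_assoc, hx]; simp [ha]
  simp only [triple, h, hx, Quaternion.re_add, Quaternion.re_smul, h2]
  simp [hb, hxr]

/-- A curve of connections with constant holonomy gives a gauge curve after a correction of the
radial component. -/
theorem gaugeCurve_of_connections {f : ℝ → ℝ} (hf : ContDiffOn ℝ ∞ f (Set.Ioi 0))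
    (hf0 : ∀ R : ℝ, 0 < R → f R ≠ 0) {x : Vec 3} (hx : x ≠ 0) {a a' : ℝ → QPath}
    (hs : ∀ s, star (a s) = -a s) (hd : ∀ s, HasDerivAt a (a' s) s) (ha' : Continuous a')
    (hc : ∀ s, transport (a s) 1 = transport (a 0) 1) (r : ℝ) {c₀ c₁ : RotConstraint f}
    (h0 : c₀.X 0 = x) (h1 : c₁.X 0 = x)
    (hA0 : conn f c₀.chart = a 0 + (-(logSlope f ‖x‖) * (radial (a 0) (dirQ x) - r)) •
      frame (a 0) (dirQ x))
    (hA1 : conn f c₁.chart = a 1 + (-(logSlope f ‖x‖) * (radial (a 1) (dirQ x) - r)) •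
      frame (a 1) (dirQ x)) : GaugeCurve c₀ c₁ := by
  have hR : 0 < ‖x‖ := norm_pos_iff.2 hx
  set v := dirQ x with hv
  have hv1 : v * v = -1 := dirQ_mul_self hx
  have hv2 : star v = -v := star_dirQ x
  have hfR := hf0 ‖x‖ hR
  have hfd : DifferentiableAt ℝ f ‖x‖ :=
    (hf.differentiableOn (by simp)).differentiableAt (Ioi_mem_nhds hR)
  set l := 2 * logSlope f ‖x‖ with hl
  have hac : Continuous a := continuous_iff_continuousAt.2 fun s => (hd s).continuousAt
  have ha's : ∀ s, star (a' s) = -a' s := fun s => star_eq_neg_of_hasDerivAt hs (hd s)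
  set X : ℝ → QPath := fun s => frame (a s) v with hX
  have hXc : Continuous X := (continuous_frame v).comp hac
  set b : ℝ → QPath := fun s => gaugeGen (a s) (a' s) with hb
  have hbc : Continuous b := continuous_gaugeGen hac ha'
  have hbs : ∀ s, star (b s) = -b s := fun s => star_gaugeGen _ (ha's s)
  have hb1 : ∀ s, b s 1 = 0 := fun s =>
    gaugeGen_one_eq_zero hs (hd s) fun t => by rw [hc t, hc s]
  have hb0 : ∀ s, b s 0 = 0 := fun s => gaugeGen_zero _ _
  set J : ℝ → QPath := fun s => integI (X s * a s * b s) with hJ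
  have hJc : Continuous J := integI.continuous.comp ((hXc.mul hac).mul hbc)
  set κ : ℝ → ℝ := fun s => l * (J s 1).re with hκ
  have hκc : Continuous κ := continuous_const.mul
    ((reQ.comp (ContinuousMap.evalCLM ℝ (1 : I))).continuous.comp hJc)
  -- The radial correction must have derivative `κ`. Since `b` vanishes at `u = 1`, the radial
  -- integral has derivative `-2 Re J(1)`, so this is achieved by `-C` times the radial integral.
  -- The constant `r` only normalises the starting value.
  set τ : ℝ → ℝ := fun s => -(logSlope f ‖x‖) * (radial (a s) v - r) with hτ
  have hτd : ∀ s, HasDerivAt τ (κ s) s := fun s => by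
    have h1 := hasDerivAt_radial (hs s) (ha's s) (hd s) hv2
    have h2 : gaugeGen (a s) (a' s) 1 = 0 := hb1 s
    rw [h2] at h1
    refine ((h1.sub_const r).const_mul (-(logSlope f ‖x‖))).congr_deriv ?_
    have h3 : integI (frame (a s) v * a s * gaugeGen (a s) (a' s)) = J s := rfl
    simp only [h3, hκ, hl, zero_mul, Quaternion.re_zero]
    ring
  have hτc : Continuous τ := continuous_iff_continuousAt.2 fun s => (hτd s).continuousAt
  set A : ℝ → QPath := fun s => a s + τ s • X s with hA
  have hAc : Continuous A := hac.add (hτc.smul hXc)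
  have hAs : ∀ s, star (A s) = -A s := fun s => star_shift (hs s) hv2 _
  have hAX : ∀ s, frame (A s) v = X s := fun s => frame_shift (hs s) hv2 _
  have hXs : ∀ s, star (X s) = -X s := fun s => star_frame _ hv2
  have hXX : ∀ s u, X s u * X s u = -1 := fun s u => frame_mul_self (hs s) hv1 u
  have hXd : ∀ s, HasDerivAt X (b s * X s - X s * b s) s := fun s =>
    hasDerivAt_frame (hs s) (ha's s) (hd s) v
  have hAd : ∀ s, HasDerivAt A (a' s + (τ s • (b s * X s - X s * b s) + κ s • X s)) s := fun s =>
    (hd s).add ((hτd s).smul (hXd s))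
  -- The coefficient of the radial part of the gauge parameter. The term `-l Re J` produces the
  -- triple product in the gauge variation, and the linear term `κ u` makes `m` vanish at `u = 1` as
  -- well.
  set m : ℝ → I → ℝ := fun s u => κ s * u - l * (J s u).re with hm
  set idQ : QPath := ⟨fun u : I => (u : ℝ) • (1 : ℍ[ℝ]), by fun_prop⟩ with hidQ
  set B : ℝ → QPath := fun s => b s + (κ s • (idQ * X s) - l • (reC (J s) * X s)) with hB
  have hBc : Continuous B := hbc.add ((hκc.smul (continuous_const.mul hXc)).sub
    (((reC.continuous.comp hJc).mul hXc).const_smul l))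
  have hBu : ∀ s u, B s u = b s u + m s u • X s u := fun s u => by
    simp only [hB, ContinuousMap.add_apply, ContinuousMap.sub_apply, ContinuousMap.smul_apply,
      reC_apply, ContinuousMap.mul_apply, hidQ, ContinuousMap.coe_mk, smul_mul_assoc,
      one_mul, hm]
    module
  set dB : ℝ → QPath := fun s => (a' s + (a s * b s - b s * a s)) +
    ((κ s • X s - l • (reC (X s * a s * b s) * X s)) +
      (κ s • (idQ * (a s * X s - X s * a s)) - l • (reC (J s) * (a s * X s - X s * a s)))) with hdB
  have hdBc : Continuous dB := (ha'.add ((hac.mul hbc).sub (hbc.mul hac))).add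
    (((hκc.smul hXc).sub (((reC.continuous.comp ((hXc.mul hac).mul hbc)).mul hXc).const_smul l)).add
      ((hκc.smul (continuous_const.mul ((hac.mul hXc).sub (hXc.mul hac)))).sub
        (((reC.continuous.comp hJc).mul ((hac.mul hXc).sub (hXc.mul hac))).const_smul l)))
  have hdBu : ∀ s u, dB s u = (a' s u + (a s u * b s u - b s u * a s u)) +
      ((κ s + l * triple (X s u) (a s u) (b s u)) • X s u +
        m s u • (a s u * X s u - X s u * a s u)) := fun s u => by
    simp only [hdB, ContinuousMap.add_apply, ContinuousMap.sub_apply, ContinuousMap.smul_apply,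
      reC_apply, ContinuousMap.mul_apply, hidQ, ContinuousMap.coe_mk, smul_mul_assoc,
      one_mul, hm, triple]
    module
  have hmd : ∀ s, HasDerivI (m s) (fun u => κ s + l * triple (X s u) (a s u) (b s u)) := fun s => by
    refine ((HasDerivI.coe.const_smul (κ s)).sub
      (((hasDerivI_integI (X s * a s * b s)).clm reQ).const_smul l)).congr (fun _ => rfl)
        fun u => ?_
    simp only [smul_eq_mul, mul_one, reQ_apply, ContinuousMap.mul_apply, triple]
    ring
  have hBd : ∀ s, HasDerivI (B s) (dB s) := fun s =>
    ((hasDerivI_gaugeGen (hs s) (a' s)).add ((hmd s).smul (hasDerivI_frame (hs s) v))).congr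
      (hBu s) (hdBu s)
  have hBs : ∀ s u, star (B s u) = -B s u := fun s u => by
    rw [hBu, star_add, Quaternion.star_smul, star_apply_of_star_eq_neg (hbs s) u,
      star_apply_of_star_eq_neg (hXs s) u]
    module
  have hdBs : ∀ s u, star (dB s u) = -dB s u := fun s u => by
    rw [Quaternion.star_eq_neg, hdBu]
    simp only [Quaternion.re_add, Quaternion.re_sub, Quaternion.re_smul,
      re_apply_of_star_eq_neg (ha's s) u, re_apply_of_star_eq_neg (hXs s) u,
      re_mul_comm (a s u), sub_self, smul_zero, add_zero]
  have hB0 : ∀ s, B s 0 = 0 := fun s => by simp [hBu, hb0 s, hm, hJ]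
  have hB1 : ∀ s, B s 1 = 0 := fun s => by simp [hBu, hb1 s, hm, hκ]
  set q : ℝ := -(2 / f ‖x‖) with hq
  have hchart : ∀ s, (solution f x hx (ofQC (q • A s))).chart = (x, ofQC (q • A s)) := fun s =>
    solution_chart _ _ _
  have hend : ∀ (c : RotConstraint f) (s : ℝ), c.X 0 = x → conn f c.chart = A s →
      solution f x hx (ofQC (q • A s)) = c := fun c s hc0 hcA => by
    refine Constraint.chart_injective ?_
    rw [hchart s]
    refine Prod.ext hc0.symm ?_
    rw [← hcA, conn]
    show ofQC (q • (-(f ‖c.X 0‖ / 2)) • toQC c.η) = c.η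
    rw [hc0, smul_smul, hq]
    have : -(2 / f ‖x‖) * -(f ‖x‖ / 2) = 1 := by field_simp
    rw [this, one_smul, ofQC_toQC]
  have hsolX : ∀ s u, (solution f x hx (ofQC (q • A s))).X u = ‖x‖ • ofQ (X s u) := fun s u => by
    show ‖x‖ • ofQ (frame (conn f (x, ofQC (q • A s))) (dirQ x) u) = _
    rw [conn_smul_ofQC hfR (hAs s), ← hv, hAX]
  refine ⟨fun s => solution f x hx (ofQC (q • A s)), fun s => ofQC (q • B s),
    fun s => ofQC (q • dB s), ?_, ofQC.continuous.comp (hBc.const_smul q),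
    ofQC.continuous.comp (hdBc.const_smul q), hend c₀ 0 h0 hA0, hend c₁ 1 h1 hA1,
    fun s => ⟨?_, ?_, ?_, fun u => ⟨?_, ?_⟩⟩⟩
  · rw [continuous_induced_rng]
    have h2 : Continuous fun s => (x, ofQC (q • A s)) :=
      continuous_const.prodMk (ofQC.continuous.comp (hAc.const_smul q))
    refine h2.congr fun s => ?_
    exact (hchart s).symm
  · exact ((hBd s).const_smul q).clm ofQ
  · simp [ofQC_apply, hB0]
  · simp [ofQC_apply, hB1]
  · have h2 := ((ofQ.comp (ContinuousMap.evalCLM ℝ u)).hasFDerivAt.comp_hasDerivAt s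
      (hXd s)).const_smul ‖x‖
    have h3 : (fun t => (solution f x hx (ofQC (q • A t))).X u) = fun t => ‖x‖ • ofQ (X t u) := by
      ext1 t; exact hsolX t u
    rw [h3]
    refine h2.congr_deriv ?_
    show ‖x‖ • ofQ (b s u * X s u - X s u * b s u) = _
    have hn : ‖‖x‖ • ofQ (X s u)‖ = ‖x‖ := by
      rw [norm_smul, norm_ofQ_frame (hs s) hv2 hv1]; simp
    rw [← ofQ_toQ (-sharp _ _ _), map_neg, toQ_sharp, hsolX, hn, map_smul toQ,
      toQ_ofQ (star_apply_of_star_eq_neg (hXs s) u), ofQC_apply, ContinuousMap.smul_apply,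
      map_smul ofQ, map_smul toQ, toQ_ofQ (hBs s u), ← map_smul ofQ, hBu]
    congr 1
    simp only [hq, smul_mul_assoc, mul_smul_comm, add_mul, mul_add]
    match_scalars <;> field_simp
    ring
  · have h2 := ((ofQ.comp (ContinuousMap.evalCLM ℝ u)).hasFDerivAt.comp_hasDerivAt s
      (hAd s)).const_smul q
    have h3 : (fun t => (solution f x hx (ofQC (q • A t))).η u) = fun t => q • ofQ (A t u) := by
      ext1 t
      show ofQ (q • A t u) = _
      rw [map_smul]
    rw [h3]
    refine h2.congr_deriv ?_
    show q • ofQ (a' s u + (τ s • (b s u * X s u - X s u * b s u) + κ s • X s u)) = _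
    have hn : ‖‖x‖ • ofQ (X s u)‖ = ‖x‖ := by
      rw [norm_smul, norm_ofQ_frame (hs s) hv2 hv1]; simp
    have hne := (solution f x hx (ofQC (q • A s))).X_ne_zero u
    have hη : toQ ((solution f x hx (ofQC (q • A s))).η u) = q • A s u := by
      show toQ (ofQ (q • A s u)) = _
      rw [map_smul, map_smul, toQ_ofQ (star_apply_of_star_eq_neg (hAs s) u)]
    have hβ : toQ (ofQC (q • B s) u) = q • B s u := by
      rw [ofQC_apply, ContinuousMap.smul_apply, map_smul, map_smul, toQ_ofQ (hBs s u)]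
    have hXq : toQ ((solution f x hx (ofQC (q • A s))).X u) = ‖x‖ • X s u := by
      rw [hsolX, map_smul, toQ_ofQ (star_apply_of_star_eq_neg (hXs s) u)]
    have hXn : ‖(solution f x hx (ofQC (q • A s))).X u‖ = ‖x‖ := by rw [hsolX, hn]
    have hdβ : toQ (ofQC (q • dB s) u) = q • dB s u := by
      rw [ofQC_apply, ContinuousMap.smul_apply, map_smul, map_smul, toQ_ofQ (hdBs s u)]
    rw [← ofQ_toQ (ofQC (q • dB s) u + _), map_add toQ,
      toQ_gauge_term hne (by rw [hXn]; exact hfd), hη, hβ, hdβ, hXq, hXn, ← map_smul ofQ]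
    congr 1
    have hAu : A s u = a s u + τ s • X s u := rfl
    have ht := triple_shift (hXX s u) (re_apply_of_star_eq_neg (hs s) u)
      (re_apply_of_star_eq_neg (hbs s) u) (re_apply_of_star_eq_neg (hXs s) u) (τ s) (m s u)
    rw [← hAu, ← hBu] at ht
    have ht2 : triple (‖x‖ • X s u) (q • A s u) (q • B s u) =
        ‖x‖ * q * q * triple (X s u) (a s u) (b s u) := by
      rw [← ht]
      simp only [triple, smul_mul_assoc, mul_smul_comm, Quaternion.re_smul, smul_eq_mul]
      ring
    rw [ht2, hdBu, hAu, hBu]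
    simp only [hl, logSlope, hq, smul_mul_assoc, mul_smul_comm, add_mul, mul_add]
    match_scalars <;> field_simp <;> ring

/-! ### Contracting loops of unit quaternions -/

theorem HasDerivI.exp {g dg : I → ℝ} (h : HasDerivI g dg) :
    HasDerivI (fun u => Real.exp (g u)) (fun u => Real.exp (g u) * dg u) := fun u => by
  have := (h u).exp
  simpa using! this

/-- The imaginary part of the logarithmic derivative of a path of quaternions. -/
def logDeriv (M dM : QPath) : QPath :=
  dM * Ring.inverse M - reC (dM * Ring.inverse M)

theorem star_logDeriv (M dM : QPath) : star (logDeriv M dM) = -logDeriv M dM := by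
  ext1 u
  show star (logDeriv M dM u) = -logDeriv M dM u
  rw [Quaternion.star_eq_neg]
  simp [logDeriv, reC_apply]

theorem isUnit_qpath {M : QPath} (h : ∀ u, M u ≠ 0) : IsUnit M :=
  (ContinuousMap.isUnit_iff_forall_isUnit M).2 fun u => (h u).isUnit

/-- The holonomy of the imaginary part of a logarithmic derivative. -/
theorem transport_logDeriv {M dM : QPath} (hM : HasDerivI M dM) (h : ∀ u, M u ≠ 0) :
    ∃ ρ : ℝ, 0 < ρ ∧ transport (logDeriv M dM) 1 * M 0 = ρ • M 1 := by
  set a := logDeriv M dM with ha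
  have has : star a = -a := star_logDeriv M dM
  set N := dM * Ring.inverse M with hN
  have hNM : ∀ u, dM u = N u * M u := fun u => by
    have h1 : N * M = dM := by
      rw [hN, mul_assoc, Ring.inverse_mul_cancel _ (isUnit_qpath h), mul_one]
    exact (congrArg (fun S : QPath => S u) h1).symm
  have hau : ∀ u, a u = N u - (N u).re • 1 := fun u => rfl
  -- With `M' = N M` and `a` the imaginary part of `N`, the transport of `a` accounts for `M` up to
  -- the positive scalar `exp (∫ Re N)`, which is divided out here.
  have h1 : HasDerivI (fun u => Real.exp (-(integI N u).re) • (star (transport a u) * M u))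
      (fun _ => 0) := by
    refine (((((hasDerivI_integI N).clm reQ).neg).exp).smul
      ((hasDerivI_star_transport has).mul hM)).congr (fun _ => rfl) fun u => ?_
    rw [hNM, hau]
    simp only [reQ_apply, mul_sub, neg_mul, sub_mul, mul_assoc, mul_smul_comm, smul_mul_assoc,
      mul_one]
    module
  have h2 := h1.eq_const 1
  simp only [integI_zero, Quaternion.re_zero, neg_zero, Real.exp_zero, one_smul, transport_zero,
    star_one, one_mul] at h2
  refine ⟨Real.exp (-(integI N 1).re), Real.exp_pos _, ?_⟩
  rw [← h2, mul_smul_comm, ← mul_assoc, transport_mul_star has, one_mul]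

/-- A continuously differentiable path in the quaternions does not meet some ray. -/
theorem exists_ray_not_mem {L : I → ℍ[ℝ]} {dL : QPath} (h : HasDerivI L dL) :
    ∃ p : ℍ[ℝ], ∀ (r : ℝ) (u : I), r • L u ≠ p := by
  set L' : ℝ → ℍ[ℝ] := fun t =>
    L 0 + ∫ r in (0 : ℝ)..t, Set.IccExtend (zero_le_one' ℝ) dL r with hL'
  have h1 : ∀ t, HasDerivAt L' (Set.IccExtend (zero_le_one' ℝ) dL t) t := fun t =>
    (hasDerivAt_integral_IccExtend dL t).const_add _
  have h2 : ContDiff ℝ 1 L' := by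
    rw [contDiff_one_iff_deriv]
    refine ⟨fun t => (h1 t).differentiableAt, ?_⟩
    rw [show deriv L' = Set.IccExtend (zero_le_one' ℝ) dL from funext fun t => (h1 t).deriv]
    exact dL.continuous.Icc_extend'
  -- The cone over the path is contained in a `C¹` image of `ℝ²`, which cannot fill a
  -- four-dimensional space.
  have h3 : ContDiff ℝ 1 (fun z : ℝ × ℝ => z.1 • L' z.2) :=
    contDiff_fst.smul (h2.comp contDiff_snd)
  have h4 := h3.dense_compl_range_of_finrank_lt_finrank (by
    rw [Quaternion.finrank_eq_four]; simp)
  obtain ⟨p, hp⟩ := h4.nonempty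
  refine ⟨p, fun r u hru => hp ⟨(r, (u : ℝ)), ?_⟩⟩
  rw [← hru, h.eq_integI u]
  rfl

/-- Connections with the same holonomy can be joined by a curve of such connections. -/
theorem exists_curve_of_transport_eq {a₀ a₁ : QPath} (h0 : star a₀ = -a₀) (h1 : star a₁ = -a₁)
    (h : transport a₀ 1 = transport a₁ 1) :
    ∃ a : ℝ → QPath, ContDiff ℝ ∞ a ∧ (∀ s, star (a s) = -a s) ∧ a 0 = a₀ ∧ a 1 = a₁ ∧
      ∀ s, transport (a s) 1 = transport a₀ 1 := by
  obtain ⟨p, hp⟩ : ∃ p : ℍ[ℝ], ∀ (r : ℝ) (u : I),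
      r • (star (transport a₁ u) * transport a₀ u) ≠ p := by
    refine exists_ray_not_mem (dL := -(star (transport a₁) * a₁) * transport a₀ +
      star (transport a₁) * (a₀ * transport a₀)) ?_
    exact (hasDerivI_star_transport h1).mul (hasDerivI_transport a₀)
  set ε : ℝ → ℝ := fun s => Real.sin (Real.pi / 2 * s) ^ 2 with hε
  have hεc : ContDiff ℝ ∞ ε :=
    (Real.contDiff_sin.comp (contDiff_const.mul contDiff_id)).pow 2
  have hε0 : ∀ s, 0 ≤ ε s := fun s => sq_nonneg _
  have hε1 : ∀ s, ε s ≤ 1 := fun s => Real.sin_sq_le_one _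
  set P : QPath := ContinuousMap.const I (-p) with hP
  -- Linear interpolation from `G₀` to `G₁ (-p)`. A zero would place `p` on the line spanned by some
  -- `star G₁ * G₀`, which the choice of `p` excludes. The constant right factor `-p` does not
  -- change the logarithmic derivative.
  set M : ℝ → QPath := fun s => (1 - ε s) • transport a₀ + ε s • (transport a₁ * P) with hM
  set dM : ℝ → QPath := fun s => (1 - ε s) • (a₀ * transport a₀) +
    ε s • (a₁ * transport a₁ * P) with hdM
  have hMu : ∀ s u, M s u = (1 - ε s) • transport a₀ u + ε s • (transport a₁ u * (-p)) :=
    fun s u => rfl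
  have hMd : ∀ s, HasDerivI (M s) (dM s) := fun s =>
    (((hasDerivI_transport a₀).const_smul (1 - ε s)).add
      (((hasDerivI_transport a₁).mul (HasDerivI.const (-p))).const_smul (ε s))).congr
      (fun _ => rfl) (fun u => by simp [hdM, hP])
  have hM0 : ∀ s u, M s u ≠ 0 := fun s u hz => by
    rw [hMu] at hz
    have hz2 : (1 - ε s) • (star (transport a₁ u) * transport a₀ u) = ε s • p := by
      have := congrArg (fun q => star (transport a₁ u) * q) hz
      simp only [mul_add, mul_smul_comm, mul_zero, mul_neg, ← mul_assoc,
        star_transport_mul h1 u, one_mul, smul_neg] at this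
      exact eq_of_sub_eq_zero (by rw [sub_eq_add_neg]; exact this)
    rcases eq_or_ne (ε s) 0 with h2 | h2
    · rw [h2] at hz2
      simp only [sub_zero, one_smul, zero_smul, mul_eq_zero] at hz2
      have e0 := norm_transport h0 u
      have e1 := norm_transport h1 u
      rw [← norm_star] at e1
      rcases hz2 with hz2 | hz2
      · rw [hz2, norm_zero] at e1; exact zero_ne_one e1
      · rw [hz2, norm_zero] at e0; exact zero_ne_one e0
    · refine hp ((ε s)⁻¹ * (1 - ε s)) u ?_
      rw [mul_smul, hz2, smul_smul, inv_mul_cancel₀ h2, one_smul]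
  have hp0 : p ≠ 0 := fun h2 => hp 0 0 (by simp [h2])
  refine ⟨fun s => logDeriv (M s) (dM s), ?_, fun s => star_logDeriv _ _, ?_, ?_, fun s => ?_⟩
  · have e1 : ContDiff ℝ ∞ M := ((contDiff_const.sub hεc).smul contDiff_const).add
      (hεc.smul contDiff_const)
    have e2 : ContDiff ℝ ∞ dM := ((contDiff_const.sub hεc).smul contDiff_const).add
      (hεc.smul contDiff_const)
    have e3 : ContDiff ℝ ∞ fun s => Ring.inverse (M s) := by
      rw [contDiff_iff_contDiffAt]
      intro s
      obtain ⟨w, hw⟩ := isUnit_qpath (hM0 s)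
      have := contDiffAt_ringInverse ℝ (R := QPath) (n := ∞) w
      rw [hw] at this
      exact this.comp s e1.contDiffAt
    exact (e2.mul e3).sub (reC.contDiff.comp (e2.mul e3))
  · have e1 : ε 0 = 0 := by simp [hε]
    have e2 : dM 0 * Ring.inverse (M 0) = a₀ := by
      have : dM 0 = a₀ * M 0 := by simp [hdM, hM, e1]
      rw [this, mul_assoc, Ring.mul_inverse_cancel _ (isUnit_qpath (hM0 0)), mul_one]
    ext1 u
    show (dM 0 * Ring.inverse (M 0)) u - ((dM 0 * Ring.inverse (M 0)) u).re • 1 = a₀ u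
    rw [e2, re_apply_of_star_eq_neg h0]; simp
  · have e1 : ε 1 = 1 := by simp [hε]
    have e2 : dM 1 * Ring.inverse (M 1) = a₁ := by
      have : dM 1 = a₁ * M 1 := by simp [hdM, hM, e1, mul_assoc]
      rw [this, mul_assoc, Ring.mul_inverse_cancel _ (isUnit_qpath (hM0 1)), mul_one]
    ext1 u
    show (dM 1 * Ring.inverse (M 1)) u - ((dM 1 * Ring.inverse (M 1)) u).re • 1 = a₁ u
    rw [e2, re_apply_of_star_eq_neg h1]; simp
  · obtain ⟨ρ, hρ, e1⟩ := transport_logDeriv (hMd s) (hM0 s)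
    -- Both summands of `M s` pick up the same left factor between `0` and `1`, because the two
    -- holonomies agree. So the holonomy is the original one up to a positive factor, and comparing
    -- norms shows that the factor is one.
    have e2 : M s 1 = transport a₀ 1 * M s 0 := by
      rw [hMu, hMu, ← h, transport_zero, transport_zero]
      simp only [mul_add, mul_smul_comm, mul_one, one_mul]
    rw [e2, ← smul_mul_assoc] at e1
    have e3 := mul_right_cancel₀ (hM0 s 0) e1
    have e4 := congrArg norm e3
    rw [norm_smul, norm_transport (star_logDeriv _ _), norm_transport h0, mul_one,
      Real.norm_of_nonneg hρ.le] at e4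
    rw [e3, ← e4, one_smul]

/-- Solutions with related invariants are gauge equivalent. -/
theorem PhaseSpace.mk_eq_of_orb {f : ℝ → ℝ} (hf : ContDiffOn ℝ ∞ f (Set.Ioi 0))
    (hf0 : ∀ R : ℝ, 0 < R → f R ≠ 0) {c₀ c₁ : RotConstraint f}
    (h : Orb f c₀.chart c₁.chart) : PhaseSpace.mk c₀ = PhaseSpace.mk c₁ := by
  obtain ⟨h1, θ, h2, h3⟩ := h
  set x := c₀.X 0 with hx
  have hx0 : x ≠ 0 := c₀.X_ne_zero 0
  have e0 : c₀.chart.1 = x := rfl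
  rw [e0] at h1 h2 h3
  set v := dirQ x with hv
  have hv1 : v * v = -1 := dirQ_mul_self hx0
  have hv2 : star v = -v := star_dirQ x
  have hs0 := star_conn f c₀.chart
  have hs1 := star_conn f c₁.chart
  set C := logSlope f ‖x‖ with hC
  -- The radial shift by `Cθ` cancels the factor `exp(-Cθ v)` by which the second holonomy differs
  -- from the first.
  set a₁ := conn f c₁.chart + (C * θ) • frame (conn f c₁.chart) v with ha₁
  have ht : transport (conn f c₀.chart) 1 = transport a₁ 1 := by
    rw [ha₁, transport_shift hs1 hv1, h2, mul_assoc, ← circ_add hv1]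
    simp
  obtain ⟨a, hac, has, ha0, ha1, hat⟩ :=
    exists_curve_of_transport_eq hs0 (star_shift hs1 hv2 _) ht
  refine Quot.sound (gaugeCurve_of_connections hf hf0 hx0 (a := a) (a' := deriv a) has
    (fun s => (hac.differentiable (by simp) s).hasDerivAt)
    (hac.continuous_deriv (by simp)) (fun s => by rw [hat s, ha0])
    (radial (conn f c₀.chart) v) rfl h1 ?_ ?_)
  · rw [ha0]; simp [← hv]
  -- The radial integral of `a₁` exceeds that of the first solution by `(1 - C)θ + Cθ = θ`, so the
  -- correction `-Cθ` undoes the shift defining `a₁`.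
  · rw [ha1, ← hv, frame_shift hs1 hv2, radial_shift hs1 hv2 hv1, h3, add_assoc, ← add_smul]
    rw [show C * θ + -C * (radial (conn f c₀.chart) v + (1 - C) * θ + C * θ -
      radial (conn f c₀.chart) v) = 0 by ring]
    simp

/-- Gauge equivalence in terms of the invariants. -/
theorem PhaseSpace.mk_eq_iff {f : ℝ → ℝ} (hf : ContDiffOn ℝ ∞ f (Set.Ioi 0))
    (hf0 : ∀ R : ℝ, 0 < R → f R ≠ 0) {c₀ c₁ : RotConstraint f} :
    PhaseSpace.mk c₀ = PhaseSpace.mk c₁ ↔ Orb f c₀.chart c₁.chart :=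
  ⟨PhaseSpace.orb_of_mk_eq hf hf0, PhaseSpace.mk_eq_of_orb hf hf0⟩

/-! ### Smooth quotients from submersions into a vector space -/

/-- The image of a submersion between vector spaces is a manifold onto which the map is a
submersion. -/
theorem exists_submersion_onto_image {E : Type*} [NormedAddCommGroup E] [NormedSpace ℝ E]
    [CompleteSpace E] {k : ℕ} {Ω : Set E} (hne : Ω.Nonempty) (hΩ : IsOpen Ω) {G : E → Vec k}
    (hG : ContDiffOn ℝ ∞ G Ω) (hs : ∀ e ∈ Ω, Function.Surjective (fderiv ℝ G e)) :
    ∃ (_ : ChartedSpace (Vec k) (G '' Ω)) (_ : IsManifold (𝓡 k) ∞ (G '' Ω)) (F : E → G '' Ω),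
      (∀ e ∈ Ω, (F e : Vec k) = G e) ∧ ContMDiffOn 𝓘(ℝ, E) (𝓡 k) ∞ F Ω ∧
      ∀ e ∈ Ω, Function.Surjective (mfderiv 𝓘(ℝ, E) (𝓡 k) F e) := by
  obtain ⟨e₀, he₀⟩ := hne
  have hat : ∀ e ∈ Ω, ContDiffAt ℝ ∞ G e := fun e he => (hG e he).contDiffAt (hΩ.mem_nhds he)
  have hopen : IsOpen (G '' Ω) := by
    rw [isOpen_iff_mem_nhds]
    rintro _ ⟨e, he, rfl⟩
    have h1 := (hat e he).hasStrictFDerivAt (by simp)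
    rw [← h1.map_nhds_eq_of_surj (LinearMap.range_eq_top.2 (hs e he))]
    exact Filter.image_mem_map (hΩ.mem_nhds he)
  have hemb : IsOpenEmbedding (Subtype.val : G '' Ω → Vec k) := hopen.isOpenEmbedding_subtypeVal
  have : Nonempty (G '' Ω) := ⟨⟨G e₀, e₀, he₀, rfl⟩⟩
  let _ := hemb.singletonChartedSpace
  have hman : IsManifold (𝓡 k) ∞ (G '' Ω) := hemb.isManifold_singleton
  classical
  set F : E → G '' Ω := fun e =>
    if h : e ∈ Ω then ⟨G e, e, h, rfl⟩ else ⟨G e₀, e₀, he₀, rfl⟩ with hF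
  have hFG : ∀ e ∈ Ω, (F e : Vec k) = G e := fun e he => by simp [hF, he]
  have hsm : ContMDiffOn 𝓘(ℝ, E) (𝓡 k) ∞ F Ω := by
    have h1 : ContMDiffOn 𝓘(ℝ, E) (𝓡 k) ∞ G Ω := hG.contMDiffOn
    have h0 : ContMDiffOn (𝓡 k) (𝓡 k) ∞ (hemb.toOpenPartialHomeomorph _).symm
        (range (Subtype.val : G '' Ω → Vec k)) := contMDiffOn_isOpenEmbedding_symm hemb
    have h2 := h0.comp h1
      (fun e he => by rw [Subtype.range_coe]; exact ⟨e, he, rfl⟩)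
    refine h2.congr fun e he => ?_
    rw [Function.comp_apply, ← hFG e he]
    exact (hemb.toOpenPartialHomeomorph_left_inv _).symm
  refine ⟨inferInstance, hman, F, hFG, hsm, fun e he => ?_⟩
  have hFd : MDifferentiableAt 𝓘(ℝ, E) (𝓡 k) F e :=
    ((hsm e he).contMDiffAt (hΩ.mem_nhds he)).mdifferentiableAt (by simp)
  have hvd : MDifferentiableAt (𝓡 k) (𝓡 k) (Subtype.val : G '' Ω → Vec k) (F e) :=
    have h0 : ContMDiff (𝓡 k) (𝓡 k) ∞ (Subtype.val : G '' Ω → Vec k) :=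
      contMDiff_isOpenEmbedding hemb
    h0.contMDiffAt.mdifferentiableAt (by simp)
  have h3 : mfderiv 𝓘(ℝ, E) (𝓡 k) (Subtype.val ∘ F) e = fderiv ℝ G e := by
    rw [← mfderiv_eq_fderiv]
    refine Filter.EventuallyEq.mfderiv_eq ?_
    filter_upwards [hΩ.mem_nhds he] with e' he'
    exact hFG e' he'
  have h4 := mfderiv_comp e hvd hFd
  have h5 : Function.Surjective ((mfderiv (𝓡 k) (𝓡 k) (Subtype.val : G '' Ω → Vec k) (F e)).comp
      (mfderiv 𝓘(ℝ, E) (𝓡 k) F e)) := by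
    rw [← h4, h3]; exact hs e he
  set D : Vec k →L[ℝ] Vec k := mfderiv (𝓡 k) (𝓡 k) (Subtype.val : G '' Ω → Vec k) (F e) with hD
  set D' : E →L[ℝ] Vec k := mfderiv 𝓘(ℝ, E) (𝓡 k) F e with hD'
  have h6 : Function.Surjective (D ∘ D') := h5
  -- `D ∘ D'` is surjective, so `D` is a surjective endomorphism of a finite-dimensional space,
  -- hence injective. This transfers surjectivity to `D'`.
  have h7 : Function.Injective D :=
    (LinearMap.injective_iff_surjective (f := (D : Vec k →ₗ[ℝ] Vec k))).2 h6.of_comp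
  intro y
  obtain ⟨z, hz⟩ := h6 (D y)
  exact ⟨z, h7 hz⟩

/-- The model space of two vectors. -/
def vecPair : (Vec 3 × Vec 3) ≃L[ℝ] Vec 6 :=
  ContinuousLinearEquiv.ofFinrankEq (by simp)

/-- The leaf space is taken to be the open image of `G` in `ℝ⁶`, which is why it is Hausdorff and
second countable. Only a complete invariant that is a submersion has to be supplied. -/
theorem exists_smoothQuotient {f : ℝ → ℝ} {G : Vec 3 × C(I, Vec 3) → Vec 3 × Vec 3}
    (hG : ∀ e, e.1 ≠ 0 → ContDiffAt ℝ ∞ G e)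
    (hs : ∀ e, e.1 ≠ 0 → Function.Surjective (fderiv ℝ G e))
    (hfib : ∀ c c' : RotConstraint f, G c.chart = G c'.chart ↔
      PhaseSpace.mk c = PhaseSpace.mk c') :
    ∃ (N : Type) (_ : TopologicalSpace N) (_ : ChartedSpace (Vec 6) N)
      (_ : IsManifold (𝓡 6) ∞ N) (_ : T2Space N) (_ : SecondCountableTopology N)
      (π : RotConstraint f → N), IsSmoothQuotient 6 π := by
  set Ω : Set (Vec 3 × C(I, Vec 3)) := {e | e.1 ≠ 0} with hΩ
  have hne : Ω.Nonempty := by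
    refine ⟨(EuclideanSpace.single 0 1, 0), ?_⟩
    show EuclideanSpace.single (0 : Fin 3) (1 : ℝ) ≠ 0
    simp
  obtain ⟨i1, i2, F, hF, hFs, hFd⟩ := exists_submersion_onto_image (k := 6) hne isOpen_ne_fst
    (G := vecPair ∘ G) (fun e he => (vecPair.contDiff.contDiffAt.comp e (hG e he)).contDiffWithinAt)
    (fun e he => by
      rw [ContinuousLinearEquiv.comp_fderiv]
      exact vecPair.surjective.comp (hs e he))
  refine ⟨(vecPair ∘ G) '' Ω, inferInstance, i1, i2, inferInstance, inferInstance,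
    fun c => F c.chart, ?_, ?_, F, fun c => rfl, ?_, fun c => hFd _ (c.X_ne_zero 0)⟩
  · rintro ⟨_, e, he, rfl⟩
    refine ⟨solution f e.1 he e.2, Subtype.ext ?_⟩
    show (F (solution f e.1 he e.2).chart : Vec 6) = (vecPair ∘ G) e
    rw [solution_chart]
    exact hF e he
  · intro c c'
    rw [← hfib c c', ← Subtype.coe_inj, hF _ (c.X_ne_zero 0), hF _ (c'.X_ne_zero 0)]
    exact vecPair.injective.eq_iff
  · rw [range_chart]; exact hFs

/-! ### Smoothness of the invariants -/

/-- The holonomy. -/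
def hol (f : ℝ → ℝ) (e : Vec 3 × C(I, Vec 3)) : ℍ[ℝ] := transport (conn f e) 1

/-- The radial invariant. -/
def rad (f : ℝ → ℝ) (e : Vec 3 × C(I, Vec 3)) : ℝ := radial (conn f e) (dirQ e.1)

theorem contDiff_frame : ContDiff ℝ ∞ (fun z : QPath × ℍ[ℝ] => frame z.1 z.2) := by
  have h1 : ContDiff ℝ ∞ (fun z : QPath × ℍ[ℝ] => transport z.1) :=
    contDiff_transport.comp contDiff_fst
  exact (h1.mul (contDiff_const_path.comp contDiff_snd)).mul (contDiff_starC.comp h1)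

theorem contDiff_radial : ContDiff ℝ ∞ (fun z : QPath × ℍ[ℝ] => radial z.1 z.2) :=
  ((reQ.comp ((ContinuousMap.evalCLM ℝ (1 : I)).comp
    (integI (F := ℍ[ℝ])))).contDiff.comp (contDiff_fst.mul contDiff_frame)).neg

section Smooth

variable {f : ℝ → ℝ} {e : Vec 3 × C(I, Vec 3)}

theorem contDiffAt_norm_fst (he : e.1 ≠ 0) :
    ContDiffAt ℝ ∞ (fun e : Vec 3 × C(I, Vec 3) => ‖e.1‖) e :=
  (contDiffAt_norm ℝ he).comp e contDiffAt_fst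

theorem contDiffAt_comp_norm_fst {g : ℝ → ℝ} (hg : ContDiffOn ℝ ∞ g (Set.Ioi 0)) (he : e.1 ≠ 0) :
    ContDiffAt ℝ ∞ (fun e : Vec 3 × C(I, Vec 3) => g ‖e.1‖) e :=
  (hg.contDiffAt (Ioi_mem_nhds (norm_pos_iff.2 he))).comp e (contDiffAt_norm_fst he)

theorem contDiffAt_dir (he : e.1 ≠ 0) :
    ContDiffAt ℝ ∞ (fun e : Vec 3 × C(I, Vec 3) => ‖e.1‖⁻¹ • e.1) e :=
  ((contDiffAt_norm_fst he).inv (norm_ne_zero_iff.2 he)).smul contDiffAt_fst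

theorem contDiffAt_dirQ (he : e.1 ≠ 0) :
    ContDiffAt ℝ ∞ (fun e : Vec 3 × C(I, Vec 3) => dirQ e.1) e :=
  toQ.contDiff.contDiffAt.comp e (contDiffAt_dir he)

theorem contDiffAt_conn (hf : ContDiffOn ℝ ∞ f (Set.Ioi 0)) (he : e.1 ≠ 0) :
    ContDiffAt ℝ ∞ (conn f) e :=
  (((contDiffAt_comp_norm_fst hf he).div_const 2).neg).smul
    (toQC.contDiff.contDiffAt.comp e contDiffAt_snd)

theorem contDiffAt_hol (hf : ContDiffOn ℝ ∞ f (Set.Ioi 0)) (he : e.1 ≠ 0) :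
    ContDiffAt ℝ ∞ (hol f) e :=
  (ContinuousMap.evalCLM ℝ (1 : I) : QPath →L[ℝ] ℍ[ℝ]).contDiff.contDiffAt.comp e
    ((contDiff_transport (A := ℍ[ℝ])).contDiffAt.comp e (contDiffAt_conn hf he))

theorem contDiffAt_rad (hf : ContDiffOn ℝ ∞ f (Set.Ioi 0)) (he : e.1 ≠ 0) :
    ContDiffAt ℝ ∞ (rad f) e := by
  have h1 : ContDiffAt ℝ ∞ (fun e => (conn f e, dirQ e.1)) e :=
    (contDiffAt_conn hf he).prodMk (contDiffAt_dirQ he)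
  have h2 := ContDiffAt.comp e contDiff_radial.contDiffAt h1
  exact h2

theorem contDiffOn_logSlope (hf : ContDiffOn ℝ ∞ f (Set.Ioi 0))
    (hf0 : ∀ R : ℝ, 0 < R → f R ≠ 0) : ContDiffOn ℝ ∞ (logSlope f) (Set.Ioi 0) :=
  (contDiffOn_id.mul (hf.deriv_of_isOpen isOpen_Ioi (by simp))).div hf fun R hR => hf0 R hR

theorem norm_hol (f : ℝ → ℝ) (e : Vec 3 × C(I, Vec 3)) : ‖hol f e‖ = 1 :=
  norm_transport (star_conn f e) 1

theorem frame_add_smul (a : QPath) (ξ v : ℍ[ℝ]) (s : ℝ) :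
    frame a (ξ + s • v) = frame a ξ + s • frame a v := by
  ext1 u
  simp only [frame_apply, ContinuousMap.add_apply, ContinuousMap.smul_apply, mul_add, add_mul,
    mul_smul_comm, smul_mul_assoc]

theorem fderiv_eq_of_line {E F : Type*} [NormedAddCommGroup E] [NormedSpace ℝ E]
    [NormedAddCommGroup F] [NormedSpace ℝ F] {G : E → F} {e d : E} {g : F}
    (hG : DifferentiableAt ℝ G e) (h : HasDerivAt (fun t : ℝ => G (e + t • d)) g 0) :
    fderiv ℝ G e d = g := by
  rw [← hG.lineDeriv_eq_fderiv]
  exact HasLineDerivAt.lineDeriv h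

/-- Conjugated back along the path, a transported vector is the constant `ξ`, so the integral in the
variation formula is `ξ` itself. -/
theorem fderiv_transport_frame {a : QPath} (ha : star a = -a) (ξ : ℍ[ℝ]) :
    fderiv ℝ transport a (frame a ξ) 1 = transport a 1 * ξ := by
  rw [fderiv_transport ha, ContinuousMap.mul_apply]
  congr 1
  have h1 : star (transport a) * frame a ξ * transport a = ContinuousMap.const I ξ := by
    have h2 : star (transport a) * transport a = 1 := by
      ext1 u; exact star_transport_mul ha u
    calc _ = (star (transport a) * transport a) * ContinuousMap.const I ξ *
          (star (transport a) * transport a) := by rw [frame]; noncomm_ring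
      _ = _ := by rw [h2, one_mul, mul_one]
  have h3 : HasDerivI (fun u : I => (u : ℝ) • ξ) (ContinuousMap.const I ξ) :=
    (HasDerivI.coe.smul (HasDerivI.const ξ)).congr (fun _ => rfl) (fun u => by simp)
  have := h3.eq_integI 1
  rw [h1]
  simpa using this.symm

theorem hasDerivAt_line {E F : Type*} [NormedAddCommGroup E] [NormedSpace ℝ E]
    [NormedAddCommGroup F] [NormedSpace ℝ F] {G : E → F} {e : E} (d : E)
    (hG : DifferentiableAt ℝ G e) : HasDerivAt (fun t : ℝ => G (e + t • d)) (fderiv ℝ G e d) 0 :=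
  hG.hasFDerivAt.hasLineDerivAt d

/-- The derivatives of the invariants in the directions which fix the initial point. -/
theorem exists_direction (hf : ContDiffOn ℝ ∞ f (Set.Ioi 0))
    (hf0 : ∀ R : ℝ, 0 < R → f R ≠ 0) (he : e.1 ≠ 0) {ξ : ℍ[ℝ]} (hξ : star ξ = -ξ) :
    ∃ ρ : ℝ, ∀ s : ℝ, ∃ ζ : C(I, Vec 3),
      fderiv ℝ (hol f) e (0, ζ) = hol f e * (ξ + s • dirQ e.1) ∧
      fderiv ℝ (rad f) e (0, ζ) = ρ + s := by
  set a := conn f e with ha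
  set v := dirQ e.1 with hv
  have has : star a = -a := star_conn f e
  have hv1 : v * v = -1 := dirQ_mul_self he
  have hv2 : star v = -v := star_dirQ e.1
  have hr : ContDiff ℝ ∞ (fun a : QPath => radial a v) := by
    have h1 : ContDiff ℝ ∞ (fun a : QPath => (a, v)) := contDiff_id.prodMk contDiff_const
    have h2 := ContDiff.comp contDiff_radial h1
    exact h2
  have hrd : DifferentiableAt ℝ (fun a : QPath => radial a v) a :=
    hr.differentiable (by simp) a
  have htd : DifferentiableAt ℝ (transport : QPath → QPath) a :=
    contDiff_transport.differentiable (by simp) a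
  have hX : fderiv ℝ (fun a : QPath => radial a v) a (frame a v) = 1 := by
    refine fderiv_eq_of_line hrd ?_
    have h1 : (fun t : ℝ => radial (a + t • frame a v) v) = fun t => radial a v + t := by
      ext1 t; exact radial_shift has hv2 hv1 t
    rw [h1]
    exact (hasDerivAt_id (0 : ℝ)).const_add _
  -- The number `ρ` need not be computed: varying along the transported direction `v` changes the
  -- radial integral at rate one, so `s` can compensate for it.
  refine ⟨fderiv ℝ (fun a : QPath => radial a v) a (frame a ξ), fun s => ?_⟩
  set a' := frame a (ξ + s • v) with ha'
  have ha's : star a' = -a' := star_frame _ (by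
    rw [star_add, Quaternion.star_smul, hξ, hv2]; module)
  set ζ := ofQC ((-(2 / f ‖e.1‖)) • a') with hζ
  have hζ' : conn f (e.1, ζ) = a' := conn_smul_ofQC (hf0 _ (norm_pos_iff.2 he)) ha's
  have hline : ∀ t : ℝ, conn f (e + t • ((0 : Vec 3), ζ)) = a + t • a' := fun t => by
    rw [← hζ', ha]
    simp [conn]
    module
  have hline1 : ∀ t : ℝ, (e + t • ((0 : Vec 3), ζ)).1 = e.1 := fun t => by simp
  have hl : HasDerivAt (fun t : ℝ => a + t • a') a' 0 := by
    simpa using ((hasDerivAt_id (0 : ℝ)).smul_const a').const_add a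
  refine ⟨ζ, ?_, ?_⟩
  · refine fderiv_eq_of_line ((contDiffAt_hol hf he).differentiableAt (by simp)) ?_
    have h1 : (fun t : ℝ => hol f (e + t • ((0 : Vec 3), ζ))) =
        fun t => transport (a + t • a') 1 := by
      ext1 t; rw [hol, hline]
    rw [h1]
    have h2 : HasFDerivAt transport (fderiv ℝ transport a) (a + (0 : ℝ) • a') := by
      rw [zero_smul, add_zero]; exact htd.hasFDerivAt
    have h3 := (ContinuousMap.evalCLM ℝ (1 : I)).hasFDerivAt.comp_hasDerivAt (0 : ℝ)
      (h2.comp_hasDerivAt (0 : ℝ) hl)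
    refine h3.congr_deriv ?_
    exact fderiv_transport_frame has _
  · refine fderiv_eq_of_line ((contDiffAt_rad hf he).differentiableAt (by simp)) ?_
    have h1 : (fun t : ℝ => rad f (e + t • ((0 : Vec 3), ζ))) =
        fun t => radial (a + t • a') v := by
      ext1 t; rw [rad, hline, hline1]
    rw [h1]
    have h2 : HasFDerivAt (fun a : QPath => radial a v)
        (fderiv ℝ (fun a : QPath => radial a v) a) (a + (0 : ℝ) • a') := by
      rw [zero_smul, add_zero]; exact hrd.hasFDerivAt
    refine (h2.comp_hasDerivAt (0 : ℝ) hl).congr_deriv ?_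
    rw [ha', frame_add_smul, map_add, map_smul, hX]
    simp

/-! ### The quotient when all spheres have the same area -/

theorem norm_ofQ_conj {g v : ℍ[ℝ]} (hg : ‖g‖ = 1) (hv : star v = -v) (hv1 : v * v = -1) :
    ‖ofQ (g * v * star g)‖ = 1 := by
  rw [← norm_toQ, toQ_ofQ (star_conj hv), norm_mul, norm_mul, norm_star, hg, one_mul, mul_one]
  exact norm_eq_one_of_mul_star (by rw [hv, mul_neg, hv1, neg_neg])

theorem conj_mul_circ {g v : ℍ[ℝ]} (hv1 : v * v = -1) (hv : star v = -v) (t : ℝ) :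
    g * circ v t * v * star (g * circ v t) = g * v * star g := by
  calc _ = g * (circ v t * v) * (star (circ v t) * star g) := by rw [star_mul]; noncomm_ring
    _ = g * v * (circ v t * star (circ v t)) * star g := by rw [circ_commute]; noncomm_ring
    _ = _ := by rw [circ_mul_star hv1 hv, mul_one]

/-- The initial point and the final point, the latter rescaled by the radial invariant. -/
def constQuotient (f : ℝ → ℝ) (e : Vec 3 × C(I, Vec 3)) : Vec 3 × Vec 3 :=
  (e.1, Real.exp (rad f e) • ofQ (hol f e * dirQ e.1 * star (hol f e)))

/-- For `C = 1` the orbit relation fixes the radial integral and multiplies the holonomy by an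
arbitrary element of the circle through `v`, leaving only `g v g*`. The exponential makes the radial
integral readable as the length of the second vector. -/
theorem constQuotient_eq_iff (hf : ContDiffOn ℝ ∞ f (Set.Ioi 0))
    (hf0 : ∀ R : ℝ, 0 < R → f R ≠ 0) (hC : ∀ R : ℝ, 0 < R → logSlope f R = 1)
    (c c' : RotConstraint f) : constQuotient f c.chart = constQuotient f c'.chart ↔
      PhaseSpace.mk c = PhaseSpace.mk c' := by
  rw [PhaseSpace.mk_eq_iff hf hf0]
  have hx := c.X_ne_zero 0
  set e := c.chart with he
  set e' := c'.chart with he'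
  have hx : e.1 ≠ 0 := hx
  have hv1 := dirQ_mul_self hx
  have hv2 := star_dirQ e.1
  have hC1 := hC ‖e.1‖ (norm_pos_iff.2 hx)
  have hg := norm_hol f e
  have hg' := norm_hol f e'
  constructor
  · intro h
    have h1 : e.1 = e'.1 := (Prod.ext_iff.1 h).1
    have h2 := (Prod.ext_iff.1 h).2
    simp only [constQuotient, ← h1] at h2
    have hr : rad f e = rad f e' := by
      have h3 := congrArg norm h2
      rw [norm_smul, norm_smul, norm_ofQ_conj hg hv2 hv1, norm_ofQ_conj hg' hv2 hv1, mul_one,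
        mul_one, Real.norm_eq_abs, Real.norm_eq_abs, Real.abs_exp, Real.abs_exp] at h3
      exact Real.exp_injective h3
    rw [hr] at h2
    have h4 := congrArg toQ (smul_right_injective (Vec 3) (Real.exp_ne_zero _) h2)
    rw [toQ_ofQ (star_conj hv2), toQ_ofQ (star_conj hv2)] at h4
    have h5 : (star (hol f e) * hol f e') * dirQ e.1 = dirQ e.1 * (star (hol f e) * hol f e') := by
      calc _ = star (hol f e) * (hol f e' * dirQ e.1 * star (hol f e')) * hol f e' := by
            simp only [mul_assoc, star_mul_self_of_norm_eq_one hg', mul_one]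
        _ = (star (hol f e) * hol f e) * dirQ e.1 * (star (hol f e) * hol f e') := by
            rw [← h4]; noncomm_ring
        _ = _ := by rw [star_mul_self_of_norm_eq_one hg, one_mul]
    obtain ⟨t, ht⟩ := exists_circ_of_commute hv1 hv2
      (by rw [norm_mul, norm_star, hg, hg', one_mul]) h5
    refine ⟨h1.symm, -t, ?_, ?_⟩
    · rw [hC1, one_mul, neg_neg, ← ht, ← mul_assoc]
      show hol f e' = hol f e * star (hol f e) * hol f e'
      rw [mul_star_self_of_norm_eq_one hg, one_mul]
    · rw [hC1, sub_self, zero_mul, add_zero]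
      have h6 : rad f e' = radial (conn f e') (dirQ e.1) := by rw [rad, ← h1]
      rw [← h6, ← hr]; rfl
  · rintro ⟨h1, θ, h2, h3⟩
    rw [hC1, sub_self, zero_mul, add_zero] at h3
    have h2' : hol f e' = hol f e * circ (dirQ e.1) (-(logSlope f ‖e.1‖ * θ)) := h2
    refine Prod.ext h1.symm ?_
    simp only [constQuotient]
    have h6 : rad f e' = rad f e := by rw [rad, h1, h3]; rfl
    rw [h6, h1, h2']
    rw [conj_mul_circ hv1 hv2]

theorem contDiffAt_constQuotient (hf : ContDiffOn ℝ ∞ f (Set.Ioi 0)) (he : e.1 ≠ 0) :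
    ContDiffAt ℝ ∞ (constQuotient f) e := by
  have h1 := contDiffAt_hol hf he
  exact contDiffAt_fst.prodMk ((contDiffAt_rad hf he).exp.smul
    (ofQ.contDiff.contDiffAt.comp e ((h1.mul (contDiffAt_dirQ he)).mul
      (starQ.contDiff.contDiffAt.comp e h1))))

/-- The splitting into normal and tangent parts at a point of the unit sphere: an imaginary
quaternion orthogonal to `w` anticommutes with it. -/
theorem exists_toQ_decomposition {w : ℍ[ℝ]} (hw : star w = -w) (hw1 : w * w = -1) {y : ℍ[ℝ]}
    (hy : star y = -y) : ∃ (c : ℝ) (t : ℍ[ℝ]), star t = -t ∧ t * w = -(w * t) ∧ y = c • w + t := by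
  have hre : w.re = 0 := Quaternion.star_eq_neg.1 hw
  have hre' : y.re = 0 := Quaternion.star_eq_neg.1 hy
  have hn : w.imI ^ 2 + w.imJ ^ 2 + w.imK ^ 2 = 1 := by
    have := congrArg QuaternionAlgebra.re hw1
    simp [hre] at this
    linarith
  refine ⟨y.imI * w.imI + y.imJ * w.imJ + y.imK * w.imK,
    y - (y.imI * w.imI + y.imJ * w.imJ + y.imK * w.imK) • w, ?_, ?_, by abel⟩
  · rw [star_sub, Quaternion.star_smul, hw, hy]; module
  · ext <;> simp [hre, hre']
    · linear_combination (2 * (y.imI * w.imI + y.imJ * w.imJ + y.imK * w.imK)) * hn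
    all_goals ring

/-- The first component is a projection, so it suffices to vary `η` alone: tangential variations
rotate the final direction, and radial ones change its scaling. -/
theorem surjective_fderiv_constQuotient (hf : ContDiffOn ℝ ∞ f (Set.Ioi 0))
    (hf0 : ∀ R : ℝ, 0 < R → f R ≠ 0) (he : e.1 ≠ 0) :
    Function.Surjective (fderiv ℝ (constQuotient f) e) := by
  have hv1 := dirQ_mul_self he
  have hv2 := star_dirQ e.1
  have hg := norm_hol f e
  set g := hol f e with hgdef
  set v := dirQ e.1 with hv
  set D := fderiv ℝ (constQuotient f) e with hD
  have hcd := (contDiffAt_constQuotient hf he).differentiableAt (by simp)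
  have hfst : ∀ d, (D d).1 = d.1 := fun d => by
    have h1 := (hasFDerivAt_fst (𝕜 := ℝ) (p := constQuotient f e)).comp e hcd.hasFDerivAt
    have h2 : HasFDerivAt (Prod.fst ∘ constQuotient f)
        (ContinuousLinearMap.fst ℝ (Vec 3) C(I, Vec 3)) e :=
      hasFDerivAt_fst
    exact congrArg (fun T : (Vec 3 × C(I, Vec 3)) →L[ℝ] Vec 3 => T d) (h1.unique h2)
  have hsnd : ∀ z : Vec 3, ∃ ζ : C(I, Vec 3), (D (0, ζ)).2 = z := fun z => by
    have hw1 : star (g * v * star g) = -(g * v * star g) := star_conj hv2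
    have hgg := star_mul_self_of_norm_eq_one hg
    have hgg' := mul_star_self_of_norm_eq_one hg
    obtain ⟨c, τ, hτ, hτv, hz⟩ := exists_toQ_decomposition hv2 hv1
      (y := star g * toQ ((Real.exp (rad f e))⁻¹ • z) * g) (by
        simp only [star_mul, star_star, star_toQ]; noncomm_ring)
    -- As `τ` anticommutes with `v`, this choice satisfies `[ξ, v] = τ`, so the direction `g v g*`
    -- moves by `g τ g*`. Afterwards `s = c - ρ` makes the radial integral move at rate `c`; the
    -- added multiple of `v` does not turn `g v g*`.
    obtain ⟨ρ, hρ⟩ := exists_direction hf hf0 he (ξ := (-(1 / 2) : ℝ) • (τ * v)) (by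
      rw [Quaternion.star_smul, star_mul, hv2, hτ, neg_mul_neg, hτv]; module)
    obtain ⟨ζ, h1, h2⟩ := hρ (c - ρ)
    refine ⟨ζ, ?_⟩
    have he0 : e + (0 : ℝ) • ((0 : Vec 3), ζ) = e := by
      refine Prod.ext (by simp) (ContinuousMap.ext fun u => ?_)
      show e.2 u + (0 : ℝ) • ζ u = e.2 u
      rw [zero_smul, add_zero]
    have hdh : HasDerivAt (fun t : ℝ => hol f (e + t • ((0 : Vec 3), ζ))) _ 0 :=
      hasDerivAt_line (0, ζ) ((contDiffAt_hol hf he).differentiableAt (by simp))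
    have hdr : HasDerivAt (fun t : ℝ => rad f (e + t • ((0 : Vec 3), ζ))) _ 0 :=
      hasDerivAt_line (0, ζ) ((contDiffAt_rad hf he).differentiableAt (by simp))
    rw [h1] at hdh
    rw [h2] at hdr
    have hds : HasDerivAt (fun t : ℝ => star (hol f (e + t • ((0 : Vec 3), ζ)))) _ 0 :=
      starQ.hasFDerivAt.comp_hasDerivAt (0 : ℝ) hdh
    have ho : HasDerivAt (fun t : ℝ => ofQ (hol f (e + t • ((0 : Vec 3), ζ)) * v *
        star (hol f (e + t • ((0 : Vec 3), ζ))))) _ 0 :=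
      ofQ.hasFDerivAt.comp_hasDerivAt (0 : ℝ) ((hdh.mul_const v).mul hds)
    have h3 := hdr.exp.smul ho
    have h4 : HasDerivAt (fun t : ℝ => (constQuotient f (e + t • ((0 : Vec 3), ζ))).2)
        (D (0, ζ)).2 0 :=
      (ContinuousLinearMap.snd ℝ (Vec 3) (Vec 3)).hasFDerivAt.comp_hasDerivAt (0 : ℝ)
        (hasDerivAt_line (0, ζ) hcd)
    have h5 := h4.unique (h3.congr_of_eventuallyEq (Filter.Eventually.of_forall fun t => by
      simp [constQuotient, hv]))
    rw [h5]
    simp only [he0, starQ_apply, ← hgdef, ← hv]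
    have h6 : toQ ((Real.exp (rad f e))⁻¹ • z) = g * (c • v + τ) * star g := by
      rw [← hz]
      calc _ = (g * star g) * toQ ((Real.exp (rad f e))⁻¹ • z) * (g * star g) := by
            rw [hgg', one_mul, mul_one]
        _ = _ := by noncomm_ring
    have hvt : τ * v * v = -τ := by rw [mul_assoc, hv1, mul_neg, mul_one]
    have h7 : g * ((-(1 / 2) : ℝ) • (τ * v) + (c - ρ) • v) * v * star g +
        g * v * star (g * ((-(1 / 2) : ℝ) • (τ * v) + (c - ρ) • v)) = g * τ * star g := by
      have e1 : star (g * ((-(1 / 2) : ℝ) • (τ * v) + (c - ρ) • v)) =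
          ((1 / 2 : ℝ) • (τ * v) - (c - ρ) • v) * star g := by
        rw [star_mul, star_add, Quaternion.star_smul, Quaternion.star_smul, star_mul, hv2, hτ,
          neg_mul_neg, ← neg_eq_iff_eq_neg.2 hτv]
        congr 1
        module
      rw [e1]
      have e2 : v * (τ * v) = τ := by
        rw [← mul_assoc, ← neg_eq_iff_eq_neg.2 hτv, neg_mul, hvt, neg_neg]
      have e3 : g * ((-(1 / 2) : ℝ) • (τ * v) + (c - ρ) • v) * v * star g =
          g * (((1 / 2 : ℝ) • τ) - (c - ρ) • 1) * star g := by
        congr 1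
        rw [mul_assoc g]
        congr 1
        rw [add_mul, smul_mul_assoc, hvt, smul_mul_assoc, hv1]
        module
      have e4 : g * v * (((1 / 2 : ℝ) • (τ * v) - (c - ρ) • v) * star g) =
          g * (((1 / 2 : ℝ) • τ) + (c - ρ) • 1) * star g := by
        rw [← mul_assoc, mul_assoc g]
        congr 2
        rw [mul_sub, mul_smul_comm, mul_smul_comm, e2, hv1]
        module
      rw [e3, e4, ← add_mul, ← mul_add]
      congr 2
      module
    rw [h7]
    apply toQ_injective
    rw [map_add, map_smul, map_smul, toQ_ofQ (star_conj hτ), toQ_ofQ hw1]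
    rw [map_smul, inv_smul_eq_iff₀ (Real.exp_ne_zero _)] at h6
    rw [h6]
    simp only [mul_add, add_mul, mul_smul_comm, smul_mul_assoc, smul_add]
    module
  intro y
  obtain ⟨ζ, hζ⟩ := hsnd (y.2 - (D (y.1, 0)).2)
  refine ⟨(y.1, 0) + (0, ζ), Prod.ext ?_ ?_⟩
  · rw [hfst]; simp
  · rw [map_add, Prod.snd_add, hζ]; abel

end Smooth

/-! ### The quotient when the area has no critical points -/

/-- The holonomy, corrected by the radial invariant. -/
def corrHol (f : ℝ → ℝ) (e : Vec 3 × C(I, Vec 3)) : ℍ[ℝ] :=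
  hol f e * circ (dirQ e.1) (logSlope f ‖e.1‖ / (1 - logSlope f ‖e.1‖) * rad f e)

/-- The initial direction together with the corrected holonomy scaled by the initial radius, the
real part of the latter being stored in the length of the former. -/
def regQuotient (f : ℝ → ℝ) (e : Vec 3 × C(I, Vec 3)) : Vec 3 × Vec 3 :=
  (Real.exp ((‖e.1‖ • corrHol f e).re) • (‖e.1‖⁻¹ • e.1), ofQ (‖e.1‖ • corrHol f e))

section Regular

variable {f : ℝ → ℝ} {e : Vec 3 × C(I, Vec 3)}

theorem norm_circ {v : ℍ[ℝ]} (hv : v * v = -1) (hv' : star v = -v) (t : ℝ) : ‖circ v t‖ = 1 :=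
  norm_eq_one_of_mul_star (circ_mul_star hv hv' t)

theorem norm_corrHol (he : e.1 ≠ 0) : ‖corrHol f e‖ = 1 := by
  rw [corrHol, norm_mul, norm_hol, one_mul, norm_circ (dirQ_mul_self he) (star_dirQ _)]

theorem norm_dir {x : Vec 3} (hx : x ≠ 0) : ‖‖x‖⁻¹ • x‖ = 1 := by
  rw [norm_smul, norm_inv, norm_norm, inv_mul_cancel₀ (norm_ne_zero_iff.2 hx)]

theorem eq_of_ofQ_eq {p q : ℍ[ℝ]} (h : ofQ p = ofQ q) (hre : p.re = q.re) : p = q := by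
  have h1 : p - q = toQ (ofQ (p - q)) := by
    rw [toQ_ofQ]
    rw [Quaternion.star_eq_neg]
    simp [hre]
  rw [map_sub, h, sub_self, map_zero] at h1
  exact sub_eq_zero.1 h1

/-- As `1 - C` is invertible, the radial integral determines `θ`, and `corrHol` is the holonomy
after this elimination. The length of the first vector gives the real part of `R k`, the second
vector its imaginary part. From `|k| = 1` one recovers `R` and `k`, then `X 0`. -/
theorem regQuotient_eq_iff (hf : ContDiffOn ℝ ∞ f (Set.Ioi 0))
    (hf0 : ∀ R : ℝ, 0 < R → f R ≠ 0) (hC : ∀ R : ℝ, 0 < R → logSlope f R ≠ 1)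
    (c c' : RotConstraint f) : regQuotient f c.chart = regQuotient f c'.chart ↔
      PhaseSpace.mk c = PhaseSpace.mk c' := by
  rw [PhaseSpace.mk_eq_iff hf hf0]
  have hx : c.chart.1 ≠ 0 := c.X_ne_zero 0
  have hx' : c'.chart.1 ≠ 0 := c'.X_ne_zero 0
  set e := c.chart with he
  set e' := c'.chart with he'
  have hv1 := dirQ_mul_self hx
  have hC1 : 1 - logSlope f ‖e.1‖ ≠ 0 := sub_ne_zero.2 (hC ‖e.1‖ (norm_pos_iff.2 hx)).symm
  constructor
  · intro h
    have h1 := (Prod.ext_iff.1 h).1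
    have h2 := (Prod.ext_iff.1 h).2
    simp only [regQuotient] at h1 h2
    have hre : (‖e.1‖ • corrHol f e).re = (‖e'.1‖ • corrHol f e').re := by
      have h3 := congrArg norm h1
      rw [norm_smul _ (‖e.1‖⁻¹ • e.1), norm_smul _ (‖e'.1‖⁻¹ • e'.1), norm_dir hx,
        norm_dir hx', mul_one, mul_one, Real.norm_eq_abs,
        Real.norm_eq_abs, Real.abs_exp, Real.abs_exp] at h3
      exact Real.exp_injective h3
    have hq := eq_of_ofQ_eq h2 hre
    have hR : ‖e.1‖ = ‖e'.1‖ := by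
      have h3 := congrArg norm hq
      rwa [norm_smul, norm_smul, norm_corrHol hx, norm_corrHol hx', mul_one, mul_one, norm_norm,
        norm_norm] at h3
    have hk : corrHol f e = corrHol f e' := by
      rw [← hR] at hq
      exact smul_right_injective ℍ[ℝ] (norm_ne_zero_iff.2 hx) hq
    have hxx : e'.1 = e.1 := by
      rw [hre, ← hR] at h1
      have h3 := smul_right_injective (Vec 3) (Real.exp_ne_zero _) h1
      exact (smul_right_injective (Vec 3) (inv_ne_zero (norm_ne_zero_iff.2 hx)) h3).symm
    refine ⟨hxx, (rad f e' - rad f e) / (1 - logSlope f ‖e.1‖), ?_, ?_⟩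
    · have h4 : hol f e' = hol f e' * circ (dirQ e.1)
          (logSlope f ‖e.1‖ / (1 - logSlope f ‖e.1‖) * rad f e') * circ (dirQ e.1)
          (-(logSlope f ‖e.1‖ / (1 - logSlope f ‖e.1‖) * rad f e')) := by
        rw [mul_assoc, ← circ_add hv1, add_neg_cancel, circ_zero, mul_one]
      have h5 : hol f e' * circ (dirQ e.1)
          (logSlope f ‖e.1‖ / (1 - logSlope f ‖e.1‖) * rad f e') = corrHol f e := by
        rw [hk, corrHol, hxx]
      rw [h5, corrHol, mul_assoc, ← circ_add hv1] at h4
      rw [hol, hol] at h4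
      rw [h4]
      congr 2
      field_simp
      ring
    · have h6 : rad f e' = radial (conn f e') (dirQ e.1) := by rw [rad, hxx]
      have h7 : rad f e = radial (conn f e) (dirQ e.1) := rfl
      rw [mul_div_cancel₀ _ hC1, ← h6, ← h7]
      ring
  · rintro ⟨h1, θ, h2, h3⟩
    have hk : corrHol f e' = corrHol f e := by
      have h6 : rad f e' = rad f e + (1 - logSlope f ‖e.1‖) * θ := by rw [rad, h1, h3]; rfl
      have h2' : hol f e' = hol f e * circ (dirQ e.1) (-(logSlope f ‖e.1‖ * θ)) := h2
      rw [corrHol, corrHol, h6, h1, h2', mul_assoc, ← circ_add hv1]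
      congr 2
      field_simp
      ring
    simp only [regQuotient, hk, h1]

theorem contDiffAt_corrHol (hf : ContDiffOn ℝ ∞ f (Set.Ioi 0))
    (hf0 : ∀ R : ℝ, 0 < R → f R ≠ 0) (hC : ∀ R : ℝ, 0 < R → logSlope f R ≠ 1) (he : e.1 ≠ 0) :
    ContDiffAt ℝ ∞ (corrHol f) e := by
  have h1 : ContDiffAt ℝ ∞ (fun e : Vec 3 × C(I, Vec 3) => logSlope f ‖e.1‖) e :=
    contDiffAt_comp_norm_fst (contDiffOn_logSlope hf hf0) he
  have h2 : ContDiffAt ℝ ∞ (fun e : Vec 3 × C(I, Vec 3) =>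
      logSlope f ‖e.1‖ / (1 - logSlope f ‖e.1‖) * rad f e) e :=
    (h1.div (contDiffAt_const.sub h1)
      (sub_ne_zero.2 (hC ‖e.1‖ (norm_pos_iff.2 he)).symm)).mul (contDiffAt_rad hf he)
  have h3 := ContDiffAt.comp e contDiff_circ.contDiffAt ((contDiffAt_dirQ he).prodMk h2)
  exact (contDiffAt_hol hf he).mul h3

theorem contDiffAt_regQuotient (hf : ContDiffOn ℝ ∞ f (Set.Ioi 0))
    (hf0 : ∀ R : ℝ, 0 < R → f R ≠ 0) (hC : ∀ R : ℝ, 0 < R → logSlope f R ≠ 1) (he : e.1 ≠ 0) :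
    ContDiffAt ℝ ∞ (regQuotient f) e := by
  have h1 : ContDiffAt ℝ ∞ (fun e : Vec 3 × C(I, Vec 3) => ‖e.1‖ • corrHol f e) e :=
    (contDiffAt_norm_fst he).smul (contDiffAt_corrHol hf hf0 hC he)
  have h2 : ContDiffAt ℝ ∞ (fun e : Vec 3 × C(I, Vec 3) => (‖e.1‖ • corrHol f e).re) e :=
    reQ.contDiff.contDiffAt.comp e h1
  exact (h2.exp.smul (contDiffAt_dir he)).prodMk (ofQ.contDiff.contDiffAt.comp e h1)

/-- The corrected holonomy can be moved in every direction tangent to the unit quaternions without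
moving the initial point. -/
theorem exists_direction_corrHol (hf : ContDiffOn ℝ ∞ f (Set.Ioi 0))
    (hf0 : ∀ R : ℝ, 0 < R → f R ≠ 0) (hC : ∀ R : ℝ, 0 < R → logSlope f R ≠ 1) (he : e.1 ≠ 0)
    {ξ : ℍ[ℝ]} (hξ : star ξ = -ξ) :
    ∃ ζ : C(I, Vec 3), fderiv ℝ (corrHol f) e (0, ζ) = corrHol f e * ξ := by
  have hv1 := dirQ_mul_self he
  have hv2 := star_dirQ e.1
  have hC1 : 1 - logSlope f ‖e.1‖ ≠ 0 := sub_ne_zero.2 (hC ‖e.1‖ (norm_pos_iff.2 he)).symm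
  set v := dirQ e.1 with hv
  set μ := logSlope f ‖e.1‖ / (1 - logSlope f ‖e.1‖) with hμ
  set z := circ v (μ * rad f e) with hz
  have hzz : z * star z = 1 := circ_mul_star hv1 hv2 _
  have hzz' : star z * z = 1 := star_mul_self_of_norm_eq_one (norm_circ hv1 hv2 _)
  obtain ⟨ρ, hρ⟩ := exists_direction hf hf0 he (ξ := z * ξ * star z) (star_conj hξ)
  -- With `s = -Cρ` the radial integral moves at rate `(1 - C)ρ`, so the correcting angle moves at
  -- rate `Cρ` and cancels `s`.
  obtain ⟨ζ, h1, h2⟩ := hρ (-(logSlope f ‖e.1‖ * ρ))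
  refine ⟨ζ, fderiv_eq_of_line ((contDiffAt_corrHol hf hf0 hC he).differentiableAt (by simp)) ?_⟩
  have hdh := hasDerivAt_line (0, ζ) ((contDiffAt_hol hf he).differentiableAt (by simp))
  have hdr := hasDerivAt_line (0, ζ) ((contDiffAt_rad hf he).differentiableAt (by simp))
  have he0 : e + (0 : ℝ) • ((0 : Vec 3), ζ) = e := by
    refine Prod.ext (by simp) (ContinuousMap.ext fun u => ?_)
    show e.2 u + (0 : ℝ) • ζ u = e.2 u
    rw [zero_smul, add_zero]
  rw [h1] at hdh
  rw [h2] at hdr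
  have h3 : HasDerivAt (fun t : ℝ => circ v (μ * rad f (e + t • ((0 : Vec 3), ζ)))) _ 0 :=
    (hasDerivAt_circ hv1 _).scomp (0 : ℝ) (hdr.const_mul μ)
  have h4 := hdh.mul h3
  refine (h4.congr_of_eventuallyEq (Filter.Eventually.of_forall fun t => ?_)).congr_deriv ?_
  · have h5 : (e + t • ((0 : Vec 3), ζ)).1 = e.1 := by simp
    rw [corrHol, h5]
    rfl
  · simp only [he0, corrHol, ← hμ, ← hv, ← hz]
    have h5 : v * z = z * v := (circ_commute v _).symm
    have h6 : μ * (ρ + -(logSlope f ‖e.1‖ * ρ)) = logSlope f ‖e.1‖ * ρ := by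
      rw [hμ]; field_simp; ring
    rw [h6]
    have h7 : z * ξ * star z * z = z * ξ := by rw [mul_assoc, hzz', mul_one]
    rw [mul_assoc (hol f e), add_mul, h7, smul_mul_assoc, h5, mul_smul_comm, mul_add, mul_assoc,
      mul_smul_comm]
    module

theorem star_mul_fderiv_corrHol (hf : ContDiffOn ℝ ∞ f (Set.Ioi 0))
    (hf0 : ∀ R : ℝ, 0 < R → f R ≠ 0) (hC : ∀ R : ℝ, 0 < R → logSlope f R ≠ 1) (he : e.1 ≠ 0)
    (d : Vec 3 × C(I, Vec 3)) :
    (star (corrHol f e) * fderiv ℝ (corrHol f) e d).re = 0 := by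
  have hd := ((contDiffAt_corrHol hf hf0 hC he).differentiableAt (by simp)).hasFDerivAt
  have hs : HasFDerivAt (fun e => star (corrHol f e)) (starQ.comp (fderiv ℝ (corrHol f) e)) e :=
    starQ.hasFDerivAt.comp e hd
  have h1 := hs.mul' hd
  have h2 : HasFDerivAt (fun e => star (corrHol f e) * corrHol f e)
      (0 : (Vec 3 × C(I, Vec 3)) →L[ℝ] ℍ[ℝ]) e := by
    refine (hasFDerivAt_const (1 : ℍ[ℝ]) e).congr_of_eventuallyEq ?_
    filter_upwards [isOpen_ne_fst.mem_nhds he] with e' he'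
    exact star_mul_self_of_norm_eq_one (norm_corrHol he')
  have h3 := congrArg (fun T : (Vec 3 × C(I, Vec 3)) →L[ℝ] ℍ[ℝ] => (T d).re) (h1.unique h2)
  simp [starQ_apply] at h3
  simp
  linarith

theorem fderiv_norm_fst (he : e.1 ≠ 0) (d : Vec 3 × C(I, Vec 3)) :
    fderiv ℝ (fun e : Vec 3 × C(I, Vec 3) => ‖e.1‖) e d = ‖e.1‖⁻¹ * inner ℝ e.1 d.1 := by
  have h := (hasFDerivAt_norm_of_ne_zero he).comp e
    (hasFDerivAt_fst (𝕜 := ℝ) (E := Vec 3) (F := C(I, Vec 3)))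
  have h1 : HasFDerivAt (fun e : Vec 3 × C(I, Vec 3) => ‖e.1‖) _ e := h
  rw [h1.fderiv]
  simp

/-- The prescribed variation of `(E v, Im (R k))` is solved for those of `v`, `R` and `k`. The
initial point realises the first two, and `η` alone then adjusts the third. -/
theorem surjective_fderiv_regQuotient (hf : ContDiffOn ℝ ∞ f (Set.Ioi 0))
    (hf0 : ∀ R : ℝ, 0 < R → f R ≠ 0) (hC : ∀ R : ℝ, 0 < R → logSlope f R ≠ 1) (he : e.1 ≠ 0) :
    Function.Surjective (fderiv ℝ (regQuotient f) e) := by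
  rintro ⟨y, z⟩
  have hR : ‖e.1‖ ≠ 0 := norm_ne_zero_iff.2 he
  set v : Vec 3 := ‖e.1‖⁻¹ • e.1 with hv
  have hvx : e.1 = ‖e.1‖ • v := by rw [hv, smul_inv_smul₀ hR]
  have hvv : inner ℝ v v = (1 : ℝ) := by
    rw [real_inner_self_eq_norm_sq, hv, norm_dir he, one_pow]
  set k := corrHol f e with hk
  have hkk : k * star k = 1 := mul_star_self_of_norm_eq_one (norm_corrHol he)
  set E := Real.exp ((‖e.1‖ • k).re) with hE
  have hE0 : E ≠ 0 := Real.exp_ne_zero _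
  -- The radial part of `y / E` must come from the exponent, so `b` is the required derivative of
  -- `Re (R k)`; the tangential part `w` is the required derivative of `v`.
  set b : ℝ := inner ℝ v (E⁻¹ • y) with hb
  set w : Vec 3 := E⁻¹ • y - b • v with hw
  have hvw : inner ℝ v w = (0 : ℝ) := by
    rw [hw, inner_sub_right, ← hb, inner_smul_right, hvv, mul_one, sub_self]
  set q : ℍ[ℝ] := (b : ℍ[ℝ]) + toQ z with hq
  have hqre : q.re = b := by simp [hq]
  -- From `(R k)' = q` and `k* k'` imaginary, the radius must change at rate `Re (k* q)`.
  set r : ℝ := (star k * q).re with hr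
  set x₁ : Vec 3 := ‖e.1‖ • w + r • v with hx₁
  set m : ℍ[ℝ] := star k * fderiv ℝ (corrHol f) e (x₁, 0) with hm
  have hmre : m.re = 0 := star_mul_fderiv_corrHol hf hf0 hC he _
  -- Here `m` is the change of the corrected holonomy already caused by moving the initial point; it
  -- is subtracted.
  obtain ⟨ζ, hζ⟩ := exists_direction_corrHol hf hf0 hC he
    (ξ := ‖e.1‖⁻¹ • (star k * q - (r : ℍ[ℝ])) - m) (by
      rw [Quaternion.star_eq_neg]; simp [hmre, hr])
  have hDk : fderiv ℝ (corrHol f) e (x₁, ζ) =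
      ‖e.1‖⁻¹ • (q - r • k) := by
    have h1 : ((x₁, ζ) : Vec 3 × C(I, Vec 3)) = (x₁, 0) + (0, ζ) := by simp
    rw [h1, map_add, hζ, ← hk, mul_sub, hm, ← mul_assoc k (star k), hkk, one_mul, mul_smul_comm,
      mul_sub, ← mul_assoc, hkk, one_mul, ← Quaternion.coe_commutes, Quaternion.coe_mul_eq_smul]
    abel
  have hinner : inner ℝ e.1 x₁ = ‖e.1‖ * r := by
    have h1 : inner ℝ e.1 x₁ = inner ℝ (‖e.1‖ • v) x₁ := by rw [← hvx]
    rw [h1, hx₁, inner_smul_left, inner_add_right, inner_smul_right, inner_smul_right, hvw,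
      hvv]
    simp
  refine ⟨(x₁, ζ), fderiv_eq_of_line
    ((contDiffAt_regQuotient hf hf0 hC he).differentiableAt (by simp)) ?_⟩
  have he0 : e + (0 : ℝ) • (x₁, ζ) = e := by
    refine Prod.ext (by simp) (ContinuousMap.ext fun u => ?_)
    show e.2 u + (0 : ℝ) • ζ u = e.2 u
    rw [zero_smul, add_zero]
  have hdn := hasDerivAt_line (x₁, ζ) ((contDiffAt_norm_fst he).differentiableAt (by simp))
  rw [fderiv_norm_fst he, hinner, inv_mul_cancel_left₀ hR] at hdn
  have hdk := hasDerivAt_line (x₁, ζ) ((contDiffAt_corrHol hf hf0 hC he).differentiableAt (by simp))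
  rw [hDk] at hdk
  have hdx : HasDerivAt (fun t : ℝ => (e + t • (x₁, ζ)).1) x₁ 0 :=
    hasDerivAt_line (x₁, ζ) (differentiableAt_fst (p := e)) |>.congr_deriv (by
      rw [fderiv_fst]; rfl)
  have hdq := hdn.smul hdk
  have hdre : HasDerivAt (fun t : ℝ =>
      (‖(e + t • (x₁, ζ)).1‖ • corrHol f (e + t • (x₁, ζ))).re) _ 0 :=
    reQ.hasFDerivAt.comp_hasDerivAt (0 : ℝ) hdq
  have hdo : HasDerivAt (fun t : ℝ =>
      ofQ (‖(e + t • (x₁, ζ)).1‖ • corrHol f (e + t • (x₁, ζ)))) _ 0 :=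
    ofQ.hasFDerivAt.comp_hasDerivAt (0 : ℝ) hdq
  have hdv : HasDerivAt (fun t : ℝ => ‖(e + t • (x₁, ζ)).1‖⁻¹ • (e + t • (x₁, ζ)).1) _ 0 :=
    (hdn.inv (by rw [he0]; exact hR)).smul hdx
  refine ((hdre.exp.smul hdv).prodMk hdo).congr_deriv ?_
  have hqq : ‖e.1‖ • ‖e.1‖⁻¹ • (q - r • k) + r • k = q := by
    rw [smul_inv_smul₀ hR]; abel
  simp only [he0, ← hk, hqq]
  refine Prod.ext ?_ ?_
  · have h1 : reQ q = b := hqre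
    have h3 : (-r / ‖e.1‖ ^ 2) • e.1 = -(‖e.1‖⁻¹ * r) • v := by
      rw [hv, smul_smul]
      congr 1
      field_simp
    have h4 : ‖e.1‖⁻¹ • x₁ + (-r / ‖e.1‖ ^ 2) • e.1 = w := by
      rw [h3, hx₁, smul_add, inv_smul_smul₀ hR]
      module
    have h5 : E • w = y - (E * b) • v := by rw [hw, smul_sub, smul_inv_smul₀ hE0, smul_smul]
    simp only [Pi.inv_apply, he0, h1, ← hE, h4, h5, ← hv, sub_add_cancel]
  · show ofQ q = z
    rw [hq, map_add, ofQ_toQ]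
    have h2 : ofQ (b : ℍ[ℝ]) = 0 := by ext i; fin_cases i <;> rfl
    rw [h2, zero_add]

end Regular

/-! ### Translations of the radial component -/

theorem circ_eq_circ_iff {v : ℍ[ℝ]} (hv : v * v = -1) (hv' : star v = -v) (s t : ℝ) :
    circ v s = circ v t ↔ ∃ m : ℤ, s - t = m * (2 * Real.pi) := by
  rw [← circ_eq_one_iff hv']
  constructor
  · intro h
    rw [sub_eq_add_neg, circ_add hv, h, ← circ_add hv, add_neg_cancel, circ_zero]
  · intro h
    rw [← sub_add_cancel s t, circ_add hv, h, one_mul]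

/-- Adding a constant multiple of the direction of the solution to the covector. -/
def radialShift (f : ℝ → ℝ) (e : Vec 3 × C(I, Vec 3)) (p : ℝ) : Vec 3 × C(I, Vec 3) :=
  (e.1, e.2 + p • ofQC (frame (conn f e) (dirQ e.1)))

section Shift

variable {f : ℝ → ℝ} {e : Vec 3 × C(I, Vec 3)}

theorem conn_radialShift (f : ℝ → ℝ) (e : Vec 3 × C(I, Vec 3)) (p : ℝ) :
    conn f (radialShift f e p) = conn f e + (-(f ‖e.1‖ / 2) * p) • frame (conn f e) (dirQ e.1) := by
  have h : toQC (ofQC (frame (conn f e) (dirQ e.1))) = frame (conn f e) (dirQ e.1) :=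
    toQC_ofQC (star_frame _ (star_dirQ _))
  rw [conn, radialShift, map_add, map_smul, h, smul_add, smul_smul]
  rfl

theorem hol_radialShift (he : e.1 ≠ 0) (p : ℝ) :
    hol f (radialShift f e p) = hol f e * circ (dirQ e.1) (-(f ‖e.1‖ / 2) * p) := by
  rw [hol, conn_radialShift, transport_shift (star_conn f e) (dirQ_mul_self he)]
  simp [hol]

theorem rad_radialShift (he : e.1 ≠ 0) (p : ℝ) :
    rad f (radialShift f e p) = rad f e + -(f ‖e.1‖ / 2) * p := by
  rw [rad, conn_radialShift]
  exact radial_shift (star_conn f e) (star_dirQ _) (dirQ_mul_self he) _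

end Shift

/-! ### Critical points of the area -/

theorem deriv_leafArea {f : ℝ → ℝ} (hf : ContDiffOn ℝ ∞ f (Set.Ioi 0))
    (hf0 : ∀ R : ℝ, 0 < R → f R ≠ 0) {R : ℝ} (hR : 0 < R) :
    HasDerivAt (leafArea f) (4 * Real.pi * (1 - logSlope f R) / f R) R := by
  have h1 : HasDerivAt f (deriv f R) R :=
    ((hf.contDiffAt (Ioi_mem_nhds hR)).differentiableAt (by simp)).hasDerivAt
  have h2 := ((hasDerivAt_id R).const_mul (4 * Real.pi)).div h1 (hf0 R hR)
  refine h2.congr_deriv ?_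
  have := hf0 R hR
  simp only [logSlope, id]
  field_simp

theorem deriv_leafArea_eq_zero_iff {f : ℝ → ℝ} (hf : ContDiffOn ℝ ∞ f (Set.Ioi 0))
    (hf0 : ∀ R : ℝ, 0 < R → f R ≠ 0) {R : ℝ} (hR : 0 < R) :
    deriv (leafArea f) R = 0 ↔ logSlope f R = 1 := by
  rw [(deriv_leafArea hf hf0 hR).deriv, div_eq_zero_iff, or_iff_left (hf0 R hR), mul_eq_zero,
    or_iff_right (by positivity), sub_eq_zero, eq_comm]

theorem logSlope_eq_one_of_leafArea_const {f : ℝ → ℝ} (hf : ContDiffOn ℝ ∞ f (Set.Ioi 0))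
    (hf0 : ∀ R : ℝ, 0 < R → f R ≠ 0)
    (h : ∀ R₁ R₂ : ℝ, 0 < R₁ → 0 < R₂ → leafArea f R₁ = leafArea f R₂) {R : ℝ} (hR : 0 < R) :
    logSlope f R = 1 := by
  rw [← deriv_leafArea_eq_zero_iff hf hf0 hR]
  have h1 : leafArea f =ᶠ[𝓝 R] fun _ => leafArea f R := by
    filter_upwards [Ioi_mem_nhds hR] with R' hR' using h R' R hR' hR
  rw [h1.deriv_eq, deriv_const]

theorem leafArea_const_of_logSlope_eq_one {f : ℝ → ℝ} (hf : ContDiffOn ℝ ∞ f (Set.Ioi 0))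
    (hf0 : ∀ R : ℝ, 0 < R → f R ≠ 0) (h : ∀ R : ℝ, 0 < R → logSlope f R = 1) {R₁ R₂ : ℝ}
    (h₁ : 0 < R₁) (h₂ : 0 < R₂) : leafArea f R₁ = leafArea f R₂ :=
  isOpen_Ioi.is_const_of_deriv_eq_zero isPreconnected_Ioi
    (fun _ hR => (deriv_leafArea hf hf0 hR).differentiableAt.differentiableWithinAt)
    (fun R hR => (deriv_leafArea_eq_zero_iff hf hf0 hR).2 (h R hR)) h₁ h₂

theorem exists_smoothQuotient_of_regular {f : ℝ → ℝ} (hf : ContDiffOn ℝ ∞ f (Set.Ioi 0))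
    (hf0 : ∀ R : ℝ, 0 < R → f R ≠ 0)
    (h : ¬ ((∃ R₁ R₂ : ℝ, 0 < R₁ ∧ 0 < R₂ ∧ leafArea f R₁ ≠ leafArea f R₂) ∧
      ∃ R : ℝ, 0 < R ∧ deriv (leafArea f) R = 0)) :
    ∃ (N : Type) (_ : TopologicalSpace N) (_ : ChartedSpace (Vec 6) N)
      (_ : IsManifold (𝓡 6) ∞ N) (_ : T2Space N) (_ : SecondCountableTopology N)
      (π : RotConstraint f → N), IsSmoothQuotient 6 π := by
  by_cases hc : ∃ R₁ R₂ : ℝ, 0 < R₁ ∧ 0 < R₂ ∧ leafArea f R₁ ≠ leafArea f R₂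
  · have hC : ∀ R : ℝ, 0 < R → logSlope f R ≠ 1 := fun R hR hR1 =>
      h ⟨hc, R, hR, (deriv_leafArea_eq_zero_iff hf hf0 hR).2 hR1⟩
    exact exists_smoothQuotient (fun e he => contDiffAt_regQuotient hf hf0 hC he)
      (fun e he => surjective_fderiv_regQuotient hf hf0 hC he) (regQuotient_eq_iff hf hf0 hC)
  · have hC : ∀ R : ℝ, 0 < R → logSlope f R = 1 := fun R hR => by
      refine logSlope_eq_one_of_leafArea_const hf hf0 (fun R₁ R₂ h₁ h₂ => ?_) hR
      by_contra hne
      exact hc ⟨R₁, R₂, h₁, h₂, hne⟩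
    exact exists_smoothQuotient (fun e he => contDiffAt_constQuotient hf he)
      (fun e he => surjective_fderiv_constQuotient hf hf0 he) (constQuotient_eq_iff hf hf0 hC)

/-- Otherwise the open set where `C ≠ 1` and the exterior of that set would separate the half-line.
Both are nonempty: the first because `A` is not constant, the second because it contains the
critical point. -/
theorem exists_critical_mem_closure {f : ℝ → ℝ} (hf : ContDiffOn ℝ ∞ f (Set.Ioi 0))
    (hf0 : ∀ R : ℝ, 0 < R → f R ≠ 0)
    (hc : ∃ R₁ R₂ : ℝ, 0 < R₁ ∧ 0 < R₂ ∧ leafArea f R₁ ≠ leafArea f R₂)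
    (hR : ∃ R : ℝ, 0 < R ∧ deriv (leafArea f) R = 0) :
    ∃ R : ℝ, 0 < R ∧ logSlope f R = 1 ∧ R ∈ closure {R : ℝ | 0 < R ∧ logSlope f R ≠ 1} := by
  by_contra! hcon
  obtain ⟨R, hR, hR0⟩ := hR
  obtain ⟨R₁, R₂, h₁, h₂, hne⟩ := hc
  set S := {R : ℝ | 0 < R ∧ logSlope f R ≠ 1} with hS
  have hSo : IsOpen S :=
    (contDiffOn_logSlope hf hf0).continuousOn.isOpen_inter_preimage isOpen_Ioi isOpen_ne
  have hS1 : S.Nonempty := by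
    by_contra hS1
    rw [Set.not_nonempty_iff_eq_empty] at hS1
    refine hne (leafArea_const_of_logSlope_eq_one hf hf0 (fun R' hR' => ?_) h₁ h₂)
    by_contra hR1
    exact (hS1 ▸ (⟨hR', hR1⟩ : R' ∈ S) : R' ∈ (∅ : Set ℝ))
  obtain ⟨R₃, -, h4, h5⟩ := (isPreconnected_Ioi (a := (0 : ℝ))) S (closure S)ᶜ hSo
    isClosed_closure.isOpen_compl (fun R' hR' => by
      by_cases h : logSlope f R' = 1
      · exact Or.inr (hcon R' hR' h)
      · exact Or.inl ⟨hR', h⟩)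
    (hS1.imp fun R' hR' => ⟨hR'.1, hR'⟩)
    ⟨R, hR, hcon R hR ((deriv_leafArea_eq_zero_iff hf hf0 hR).1 hR0)⟩
  exact h5 (subset_closure h4)

/-! ### Failure of smoothness at a critical point -/

/-- A solution which stays on a ray, with constant radial covector. -/
def rayPoint (f : ℝ → ℝ) (R p : ℝ) : Vec 3 × C(I, Vec 3) :=
  radialShift f (R • EuclideanSpace.single 0 1, 0) p

theorem norm_smul_single {R : ℝ} (hR : 0 < R) :
    ‖R • (EuclideanSpace.single 0 1 : Vec 3)‖ = R := by
  rw [norm_smul]; simp [abs_of_pos hR]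

theorem smul_single_ne_zero {R : ℝ} (hR : 0 < R) :
    R • (EuclideanSpace.single 0 1 : Vec 3) ≠ 0 :=
  norm_ne_zero_iff.1 (by rw [norm_smul_single hR]; exact hR.ne')

/-- With zero initial covector the transport is trivial, and for positive radius the direction is
constant, so the solution is given by an evidently continuous formula. -/
theorem continuousAt_rayPoint {f : ℝ → ℝ} {R p : ℝ} (hR : 0 < R) :
    ContinuousAt (fun z : ℝ × ℝ => rayPoint f z.1 z.2) (R, p) := by
  have h1 : Continuous (fun z : ℝ × ℝ => ((z.1 • EuclideanSpace.single 0 1,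
      z.2 • ofQC (frame 0 (toQ (EuclideanSpace.single 0 1)))) : Vec 3 × C(I, Vec 3))) := by
    fun_prop
  refine h1.continuousAt.congr ?_
  filter_upwards [continuousAt_fst.preimage_mem_nhds (Ioi_mem_nhds hR)] with z hz
  have hz' : 0 < z.1 := hz
  have h2 : dirQ (z.1 • EuclideanSpace.single 0 1) = toQ (EuclideanSpace.single 0 1) := by
    rw [dirQ, norm_smul_single hz', inv_smul_smul₀ hz'.ne']
  have h3 : conn f (z.1 • EuclideanSpace.single 0 1, 0) = 0 := by
    rw [conn, map_zero, smul_zero]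
  rw [rayPoint, radialShift, h2, h3, zero_add]

/-- Passing from `p` to `p'` changes the holonomy angle and the radial integral by the same amount
`-(f/2)(p' - p)`. Comparing this with `-Cθ` modulo `2π` and with `(1 - C)θ` forces `θ` into `2πℤ`.
-/
theorem orb_rayPoint_iff {f : ℝ → ℝ} (hf0 : ∀ R : ℝ, 0 < R → f R ≠ 0) {R : ℝ} (hR : 0 < R)
    (p p' : ℝ) : Orb f (rayPoint f R p) (rayPoint f R p') ↔
      ∃ m : ℤ, p' = p + m * (4 * Real.pi * (1 - logSlope f R) / f R) := by
  set e : Vec 3 × C(I, Vec 3) := (R • EuclideanSpace.single 0 1, 0) with he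
  have hx : e.1 ≠ 0 := smul_single_ne_zero hR
  have hn : ‖e.1‖ = R := norm_smul_single hR
  have hv := dirQ_mul_self hx
  have hv' := star_dirQ e.1
  have h1 : ∀ p, transport (conn f (rayPoint f R p)) 1 =
      hol f e * circ (dirQ e.1) (-(f R / 2) * p) :=
    fun p => (hol_radialShift hx p).trans (by rw [hn])
  have h2 : ∀ p, radial (conn f (rayPoint f R p)) (dirQ e.1) = rad f e + -(f R / 2) * p :=
    fun p => (rad_radialShift hx p).trans (by rw [hn])
  have h3 : ∀ p, (rayPoint f R p).1 = e.1 := fun _ => rfl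
  have hfR := hf0 R hR
  have hg : hol f e ≠ 0 := norm_ne_zero_iff.1 (by rw [norm_hol]; exact one_ne_zero)
  have h4 : ∀ θ : ℝ, circ (dirQ e.1) (-(f R / 2) * p') = circ (dirQ e.1) (-(f R / 2) * p) *
      circ (dirQ e.1) (-(logSlope f R * θ)) ↔
      ∃ m : ℤ, -(f R / 2) * p' - (-(f R / 2) * p + -(logSlope f R * θ)) = m * (2 * Real.pi) :=
    fun θ => by rw [← circ_add hv, circ_eq_circ_iff hv hv']
  simp only [Orb, h1, h2, h3, true_and, hn, mul_assoc, mul_right_inj' hg]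
  constructor
  · rintro ⟨θ, h5, h6⟩
    obtain ⟨m, hm⟩ := (h4 θ).1 h5
    refine ⟨-m, ?_⟩
    have h7 : θ = m * (2 * Real.pi) := by linear_combination hm - h6
    rw [h7] at h6
    push_cast
    field_simp
    linear_combination (-2) * h6
  · rintro ⟨m, rfl⟩
    refine ⟨-m * (2 * Real.pi), (h4 _).2 ⟨-m, ?_⟩, ?_⟩
    · push_cast
      field_simp
      ring
    · field_simp
      ring

/-- At `R` the ray points for different `p` lie on different leaves, but at nearby radii with `C ≠
1` they are identified modulo periods tending to zero. Continuity then forces two different leaves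
to coincide. -/
theorem isSingular_of_critical {f : ℝ → ℝ} (hf : ContDiffOn ℝ ∞ f (Set.Ioi 0))
    (hf0 : ∀ R : ℝ, 0 < R → f R ≠ 0) {R : ℝ} (hR : 0 < R) (hR1 : logSlope f R = 1)
    (hcl : R ∈ closure {R : ℝ | 0 < R ∧ logSlope f R ≠ 1}) :
    IsSingular puncturedSpace (rotBivector f) := by
  rintro ⟨k, N, _, _, _, π, hπ⟩
  obtain ⟨F, hF, hFs, -⟩ := hπ.submersion
  set S := {R : ℝ | 0 < R ∧ logSlope f R ≠ 1} with hS
  set φ : ℝ × ℝ → N := fun z => F (rayPoint f z.1 z.2) with hφ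
  have hφc : ∀ p : ℝ, ContinuousAt φ (R, p) := fun p => by
    have h1 : ContinuousAt F (rayPoint f R p) :=
      (hFs.continuousOn _ (by rw [range_chart]; exact smul_single_ne_zero hR)).continuousAt
        (by rw [range_chart]; exact isOpen_ne_fst.mem_nhds (smul_single_ne_zero hR))
    exact ContinuousAt.comp (f := fun z : ℝ × ℝ => rayPoint f z.1 z.2) h1 (continuousAt_rayPoint hR)
  have hφe : ∀ (R' : ℝ) (_ : 0 < R') (p p' : ℝ), φ (R', p) = φ (R', p') ↔
      ∃ m : ℤ, p' = p + m * (4 * Real.pi * (1 - logSlope f R') / f R') := fun R' hR' p p' => by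
    rw [← orb_rayPoint_iff hf0 hR']
    have h1 : ∀ p, (solution f (rayPoint f R' p).1 (smul_single_ne_zero hR')
        (rayPoint f R' p).2).chart = rayPoint f R' p := fun p => solution_chart _ _ _
    rw [hφ]
    simp only
    rw [← h1 p, ← h1 p', hF, hF, hπ.fibres, PhaseSpace.mk_eq_iff hf hf0]
  set χ := chartAt (Vec k) (φ (R, 0)) with hχ
  have hsrc : ∀ᶠ p in 𝓝 (0 : ℝ), φ (R, p) ∈ χ.source := by
    have h1 : ContinuousAt (fun p : ℝ => φ (R, p)) 0 :=
      ContinuousAt.comp (f := fun p : ℝ => (R, p)) (hφc 0) (by fun_prop)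
    exact h1.preimage_mem_nhds (χ.open_source.mem_nhds (mem_chart_source _ _))
  -- A small nonzero `p` puts both leaves into one chart domain. Limits are unique there even if `N`
  -- is not Hausdorff.
  obtain ⟨p, hp, hp0⟩ := ((hsrc.filter_mono nhdsWithin_le_nhds).and
    (self_mem_nhdsWithin (a := (0 : ℝ)) (s := {0}ᶜ))).exists
  set d : ℝ → ℝ := fun R' => 4 * Real.pi * (1 - logSlope f R') / f R' with hd
  have hdc : Filter.Tendsto d (𝓝[S] R) (𝓝 0) := by
    have h1 : ContinuousAt (logSlope f) R :=
      (contDiffOn_logSlope hf hf0).continuousOn.continuousAt (Ioi_mem_nhds hR)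
    have h2 : ContinuousAt f R := hf.continuousOn.continuousAt (Ioi_mem_nhds hR)
    have h3 : ContinuousAt d R :=
      (continuousAt_const.mul (continuousAt_const.sub h1)).div h2 (hf0 R hR)
    have h4 : d R = 0 := by simp [hd, hR1]
    rw [← h4]
    exact h3.tendsto.mono_left nhdsWithin_le_nhds
  -- Rounding `p` to a multiple of the period `d R'` costs at most `|d R'|`. The rounded value is
  -- equivalent to zero at radius `R'`.
  have hgc : Filter.Tendsto (fun R' => (⌊p / d R'⌋ : ℝ) * d R') (𝓝[S] R) (𝓝 p) := by
    rw [tendsto_iff_norm_sub_tendsto_zero]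
    refine squeeze_zero' (Filter.Eventually.of_forall fun _ => norm_nonneg _)
      (g := fun R' => |d R'|) ?_ (by simpa using hdc.abs)
    filter_upwards [self_mem_nhdsWithin] with R' hR'
    have h1 : d R' ≠ 0 := by
      have := hf0 R' hR'.1
      have := sub_ne_zero.2 hR'.2.symm
      simp only [hd]
      positivity
    have h2 : (⌊p / d R'⌋ : ℝ) * d R' - p = -(Int.fract (p / d R') * d R') := by
      rw [Int.fract]; field_simp; ring
    rw [h2, norm_neg, norm_mul, Real.norm_eq_abs, Real.norm_eq_abs,
      abs_of_nonneg (Int.fract_nonneg _)]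
    exact mul_le_of_le_one_left (abs_nonneg _) (Int.fract_lt_one _).le
  have hid : Filter.Tendsto (fun R' : ℝ => R') (𝓝[S] R) (𝓝 R) := nhdsWithin_le_nhds
  have hl0 : Filter.Tendsto (fun R' => χ (φ (R', 0))) (𝓝[S] R) (𝓝 (χ (φ (R, 0)))) :=
    ((χ.continuousAt (mem_chart_source _ _)).tendsto.comp (hφc 0).tendsto).comp
      (hid.prodMk_nhds tendsto_const_nhds)
  have hlp : Filter.Tendsto (fun R' => χ (φ (R', (⌊p / d R'⌋ : ℝ) * d R'))) (𝓝[S] R)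
      (𝓝 (χ (φ (R, p)))) :=
    ((χ.continuousAt hp).tendsto.comp (hφc p).tendsto).comp (hid.prodMk_nhds hgc)
  have : (𝓝[S] R).NeBot := mem_closure_iff_nhdsWithin_neBot.1 hcl
  have hlim : χ (φ (R, 0)) = χ (φ (R, p)) := by
    refine tendsto_nhds_unique hl0 (hlp.congr' ?_)
    filter_upwards [self_mem_nhdsWithin] with R' hR'
    rw [(hφe R' hR'.1 0 _).2 ⟨⌊p / d R'⌋, by rw [zero_add]⟩]
  obtain ⟨m, hm⟩ := (hφe R hR 0 p).1 (χ.injOn (mem_chart_source _ _) hp hlim)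
  rw [hR1, sub_self, mul_zero, zero_div, mul_zero, add_zero] at hm
  exact hp0 hm

/-! ### A section of the circle bundle over a punctured sphere -/

/-- The unit quaternion which conjugates `b` into `v`, for imaginary units `v ≠ -b`. -/
def sect (b v : ℍ[ℝ]) : ℍ[ℝ] := ‖1 - v * b‖⁻¹ • (1 - v * b)

section Sect

variable {b v : ℍ[ℝ]}

theorem one_sub_mul_ne_zero (hb : b * b = -1) (hvb : v ≠ -b) : 1 - v * b ≠ 0 := by
  intro h
  have h1 : (1 - v * b) * b = b + v := by rw [sub_mul, mul_assoc, hb]; noncomm_ring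
  rw [h, zero_mul] at h1
  exact hvb (eq_neg_of_add_eq_zero_right h1.symm)

theorem norm_sect (hb : b * b = -1) (hvb : v ≠ -b) : ‖sect b v‖ = 1 := by
  rw [sect, norm_smul, norm_inv, norm_norm,
    inv_mul_cancel₀ (norm_ne_zero_iff.2 (one_sub_mul_ne_zero hb hvb))]

theorem sect_mul (hb : b * b = -1) (hv : v * v = -1) : sect b v * b = v * sect b v := by
  have h : (1 - v * b) * b = v * (1 - v * b) := by
    rw [sub_mul, mul_sub, mul_assoc, hb, ← mul_assoc, hv]; noncomm_ring
  rw [sect, smul_mul_assoc, mul_smul_comm, h]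

/-- The section carries the circle through `b` to the circle through `v`, so fibres over different
directions can be compared with one fixed circle. -/
theorem circ_mul_sect (hb : b * b = -1) (hv : v * v = -1) (t : ℝ) :
    circ v t * sect b v = sect b v * circ b t := by
  simp only [circ, add_mul, mul_add, smul_mul_assoc, mul_smul_comm, one_mul, mul_one,
    sect_mul hb hv]

theorem sect_conj (hb : b * b = -1) (hv : v * v = -1) (hvb : v ≠ -b) :
    sect b v * b * star (sect b v) = v := by
  rw [sect_mul hb hv, mul_assoc, mul_star_self_of_norm_eq_one (norm_sect hb hvb), mul_one]

theorem star_sect_mul (hb : b * b = -1) (hb' : star b = -b) (hv : v * v = -1)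
    (hv' : star v = -v) : star (sect b v) * v = b * star (sect b v) := by
  have h := congrArg star (sect_mul hb hv)
  rw [star_mul, star_mul, hb', hv', neg_mul, mul_neg, neg_inj] at h
  exact h.symm

theorem contDiffAt_sect (hb : b * b = -1) (hvb : v ≠ -b) : ContDiffAt ℝ ∞ (sect b) v := by
  have h : ContDiffAt ℝ ∞ (fun v : ℍ[ℝ] => 1 - v * b) v :=
    contDiffAt_const.sub (contDiffAt_id.mul contDiffAt_const)
  exact ((h.norm ℝ (one_sub_mul_ne_zero hb hvb)).inv
    (norm_ne_zero_iff.2 (one_sub_mul_ne_zero hb hvb))).smul h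

end Sect

/-! ### The momentum conjugate to the radius -/

/-- The direction of the end point. -/
def endDirQ (f : ℝ → ℝ) (e : Vec 3 × C(I, Vec 3)) : ℍ[ℝ] :=
  hol f e * dirQ e.1 * star (hol f e)

/-- The holonomy relative to the section. -/
def twist (f : ℝ → ℝ) (b : ℍ[ℝ]) (e : Vec 3 × C(I, Vec 3)) : ℍ[ℝ] :=
  star (sect b (endDirQ f e)) * hol f e * sect b (dirQ e.1)

/-- The initial point is not zero, and neither end point has the direction `-b`. -/
def Avoids (f : ℝ → ℝ) (b : ℍ[ℝ]) (e : Vec 3 × C(I, Vec 3)) : Prop :=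
  e.1 ≠ 0 ∧ dirQ e.1 ≠ -b ∧ endDirQ f e ≠ -b

/-- The momentum determined by an angle of the relative holonomy. -/
def momentum (f : ℝ → ℝ) (e : Vec 3 × C(I, Vec 3)) (ψ : ℝ) : ℝ :=
  -(2 / f ‖e.1‖) * (logSlope f ‖e.1‖ * rad f e + (1 - logSlope f ‖e.1‖) * ψ)

/-- `p` is the momentum for some angle of the relative holonomy. -/
def IsMomentum (f : ℝ → ℝ) (b : ℍ[ℝ]) (e : Vec 3 × C(I, Vec 3)) (p : ℝ) : Prop :=
  ∃ ψ : ℝ, twist f b e = circ b ψ ∧ p = momentum f e ψ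

section Momentum

variable {f : ℝ → ℝ} {b : ℍ[ℝ]} {e e' : Vec 3 × C(I, Vec 3)}

theorem endDirQ_mul_self (he : e.1 ≠ 0) : endDirQ f e * endDirQ f e = -1 := by
  have hg := star_mul_self_of_norm_eq_one (norm_hol f e)
  have hg' := mul_star_self_of_norm_eq_one (norm_hol f e)
  calc _ = hol f e * (dirQ e.1 * (star (hol f e) * hol f e) * dirQ e.1) * star (hol f e) := by
        rw [endDirQ]; noncomm_ring
    _ = _ := by rw [hg, mul_one, dirQ_mul_self he, mul_neg, mul_one, neg_mul, hg']

theorem star_endDirQ (f : ℝ → ℝ) (e : Vec 3 × C(I, Vec 3)) : star (endDirQ f e) = -endDirQ f e :=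
  star_conj (star_dirQ e.1)

theorem endDirQ_mul_hol (f : ℝ → ℝ) (e : Vec 3 × C(I, Vec 3)) :
    endDirQ f e * hol f e = hol f e * dirQ e.1 := by
  rw [endDirQ, mul_assoc, star_mul_self_of_norm_eq_one (norm_hol f e), mul_one]

theorem norm_twist (hb : b * b = -1) (he : Avoids f b e) : ‖twist f b e‖ = 1 := by
  rw [twist, norm_mul, norm_mul, norm_star, norm_sect hb he.2.1, norm_sect hb he.2.2, norm_hol,
    one_mul, one_mul]

/-- The holonomy carries the initial direction to the final one, and the sections carry both back to
`b`; hence the relative holonomy fixes `b` and is an angle. -/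
theorem twist_commute (hb : b * b = -1) (hb' : star b = -b) (he : e.1 ≠ 0) :
    twist f b e * b = b * twist f b e := by
  rw [twist, mul_assoc, sect_mul hb (dirQ_mul_self he), ← mul_assoc, mul_assoc _ (hol f e),
    ← endDirQ_mul_hol, ← mul_assoc, star_sect_mul hb hb' (endDirQ_mul_self he) (star_endDirQ f e)]
  noncomm_ring

theorem hol_eq_twist (hb : b * b = -1) (he : Avoids f b e) :
    hol f e = sect b (endDirQ f e) * twist f b e * star (sect b (dirQ e.1)) := by
  have h1 := mul_star_self_of_norm_eq_one (norm_sect hb he.2.1)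
  have h2 := mul_star_self_of_norm_eq_one (norm_sect hb he.2.2)
  calc _ = (sect b (endDirQ f e) * star (sect b (endDirQ f e))) * hol f e *
        (sect b (dirQ e.1) * star (sect b (dirQ e.1))) := by rw [h1, h2, one_mul, mul_one]
    _ = _ := by rw [twist]; noncomm_ring

theorem endDirQ_of_hol (he : e.1 ≠ 0) (h1 : e'.1 = e.1) {t : ℝ}
    (h : hol f e' = hol f e * circ (dirQ e.1) t) : endDirQ f e' = endDirQ f e := by
  rw [endDirQ, h1, h, conj_mul_circ (dirQ_mul_self he) (star_dirQ e.1), endDirQ]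

theorem twist_of_hol (hb : b * b = -1) (he : e.1 ≠ 0) (h1 : e'.1 = e.1) {t : ℝ}
    (h : hol f e' = hol f e * circ (dirQ e.1) t) : twist f b e' = twist f b e * circ b t := by
  rw [twist, endDirQ_of_hol he h1 h, h1, h, ← mul_assoc, mul_assoc _ (circ _ t),
    circ_mul_sect hb (dirQ_mul_self he), twist]
  noncomm_ring

theorem exists_isMomentum (hb : b * b = -1) (hb' : star b = -b) (he : Avoids f b e) :
    ∃ p, IsMomentum f b e p := by
  obtain ⟨ψ, hψ⟩ := exists_circ_of_commute hb hb' (norm_twist hb he) (twist_commute hb hb' he.1)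
  exact ⟨_, ψ, hψ, rfl⟩

/-- The only freedom is to change `ψ` by multiples of `2π`, which changes `p` by multiples of
`-(2/f)(1 - C) 2π`. -/
theorem IsMomentum.iff_exists (hb : b * b = -1) (hb' : star b = -b) {p : ℝ}
    (h : IsMomentum f b e p) (p' : ℝ) : IsMomentum f b e p' ↔
      ∃ m : ℤ, p' = p + m * (4 * Real.pi * (1 - logSlope f ‖e.1‖) / f ‖e.1‖) := by
  obtain ⟨ψ, hψ, rfl⟩ := h
  constructor
  · rintro ⟨ψ', hψ', rfl⟩
    obtain ⟨m, hm⟩ := (circ_eq_circ_iff hb hb' ψ' ψ).1 (hψ' ▸ hψ)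
    refine ⟨-m, ?_⟩
    have h1 : ψ' = ψ + m * (2 * Real.pi) := by linarith
    rw [momentum, momentum, h1]
    push_cast
    ring
  · rintro ⟨m, rfl⟩
    refine ⟨ψ + (-m : ℤ) * (2 * Real.pi), ?_, ?_⟩
    · rw [hψ, circ_eq_circ_iff hb hb']
      exact ⟨m, by push_cast; ring⟩
    · rw [momentum, momentum]
      push_cast
      ring

/-- The changes `(1 - C)θ` of the radial integral and `-Cθ` of the angle cancel in the combination
with weights `C` and `1 - C`. -/
theorem IsMomentum.of_orb (hb : b * b = -1) (he : e.1 ≠ 0) (h : Orb f e e') {p : ℝ}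
    (hp : IsMomentum f b e p) : IsMomentum f b e' p := by
  obtain ⟨h1, θ, h2, h3⟩ := h
  obtain ⟨ψ, hψ, rfl⟩ := hp
  refine ⟨ψ + -(logSlope f ‖e.1‖ * θ), ?_, ?_⟩
  · rw [circ_add hb, ← hψ, twist_of_hol hb he h1 h2]
  · have h6 : rad f e' = rad f e + (1 - logSlope f ‖e.1‖) * θ := by rw [rad, h1, h3]; rfl
    rw [momentum, momentum, h6, h1]
    ring

theorem IsMomentum.orb (hf0 : ∀ R : ℝ, 0 < R → f R ≠ 0) (hb : b * b = -1) (he : Avoids f b e)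
    (he' : Avoids f b e') (h1 : e'.1 = e.1) (h2 : endDirQ f e' = endDirQ f e) {p : ℝ}
    (hp : IsMomentum f b e p) (hp' : IsMomentum f b e' p) : Orb f e e' := by
  obtain ⟨ψ, hψ, rfl⟩ := hp
  obtain ⟨ψ', hψ', h3⟩ := hp'
  have hf : -(2 / f ‖e.1‖) ≠ 0 := neg_ne_zero.2 (div_ne_zero two_ne_zero
    (hf0 _ (norm_pos_iff.2 he.1)))
  rw [momentum, momentum, h1] at h3
  have h4 := mul_left_cancel₀ hf h3
  -- Equal momenta mean `C Δρ + (1 - C) Δψ = 0`. Then `θ = Δρ - Δψ` satisfies both `-Cθ = Δψ` and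
  -- `(1 - C)θ = Δρ`, without dividing by `C` or `1 - C`.
  refine ⟨h1, (rad f e' - rad f e) - (ψ' - ψ), ?_, ?_⟩
  · have h5 : -(logSlope f ‖e.1‖ * ((rad f e' - rad f e) - (ψ' - ψ))) = ψ' - ψ := by
      linear_combination h4
    have h6 := hol_eq_twist hb he'
    have h7 := hol_eq_twist hb he
    have h8 : star (sect b (dirQ e.1)) * circ (dirQ e.1) (ψ' - ψ) =
        circ b (ψ' - ψ) * star (sect b (dirQ e.1)) := by
      have hs := star_mul_self_of_norm_eq_one (norm_sect hb he.2.1)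
      have hs' := mul_star_self_of_norm_eq_one (norm_sect hb he.2.1)
      calc _ = star (sect b (dirQ e.1)) * (circ (dirQ e.1) (ψ' - ψ) * sect b (dirQ e.1)) *
            star (sect b (dirQ e.1)) := by rw [mul_assoc, mul_assoc, hs', mul_one]
        _ = _ := by
          rw [circ_mul_sect hb (dirQ_mul_self he.1), ← mul_assoc, hs, one_mul]
    show hol f e' = hol f e * circ (dirQ e.1) _
    rw [h5, h7, mul_assoc, h8, h6, h2, h1, hψ, hψ']
    have h9 : circ b ψ' = circ b ψ * circ b (ψ' - ψ) := by rw [← circ_add hb]; congr 1; ring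
    rw [h9]
    noncomm_ring
  · have h6 : rad f e' = radial (conn f e') (dirQ e.1) := by rw [rad, h1]
    have h7 : rad f e = radial (conn f e) (dirQ e.1) := rfl
    rw [← h6, ← h7]
    linear_combination (-1 : ℝ) * h4

/-- The angle and the radial integral both change by `-(f/2) t`, and their weights `C` and `1 - C`
add up to one. -/
theorem IsMomentum.radialShift (hf0 : ∀ R : ℝ, 0 < R → f R ≠ 0) (hb : b * b = -1)
    (he : e.1 ≠ 0) {p : ℝ} (hp : IsMomentum f b e p) (t : ℝ) :
    IsMomentum f b (radialShift f e t) (p + t) := by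
  obtain ⟨ψ, hψ, rfl⟩ := hp
  have h1 : (PoissonSigma.radialShift f e t).1 = e.1 := rfl
  refine ⟨ψ + -(f ‖e.1‖ / 2) * t, ?_, ?_⟩
  · rw [circ_add hb, ← hψ, twist_of_hol hb he h1 (hol_radialShift he t)]
  · have h2 := hf0 _ (norm_pos_iff.2 he)
    rw [momentum, momentum, rad_radialShift he, h1]
    field_simp
    ring

theorem contDiffAt_endDirQ (hf : ContDiffOn ℝ ∞ f (Set.Ioi 0)) (he : e.1 ≠ 0) :
    ContDiffAt ℝ ∞ (endDirQ f) e := by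
  have h1 := contDiffAt_hol hf he
  have h2 : ContDiffAt ℝ ∞ (fun e => star (hol f e)) e := starQ.contDiff.contDiffAt.comp e h1
  exact (h1.mul (contDiffAt_dirQ he)).mul h2

theorem contDiffAt_twist (hf : ContDiffOn ℝ ∞ f (Set.Ioi 0)) (hb : b * b = -1)
    (he : Avoids f b e) : ContDiffAt ℝ ∞ (twist f b) e := by
  have h1 : ContDiffAt ℝ ∞ (fun e => sect b (endDirQ f e)) e :=
    ContDiffAt.comp (g := sect b) e (contDiffAt_sect hb he.2.2) (contDiffAt_endDirQ hf he.1)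
  have h2 : ContDiffAt ℝ ∞ (fun e : Vec 3 × C(I, Vec 3) => sect b (dirQ e.1)) e :=
    ContDiffAt.comp (g := sect b) e (contDiffAt_sect hb he.2.1) (contDiffAt_dirQ he.1)
  have h3 : ContDiffAt ℝ ∞ (fun e => star (sect b (endDirQ f e))) e :=
    starQ.contDiff.contDiffAt.comp e h1
  exact (h3.mul (contDiffAt_hol hf he.1)).mul h2

theorem eventually_avoids (hf : ContDiffOn ℝ ∞ f (Set.Ioi 0)) (he : Avoids f b e) :
    ∀ᶠ e' in 𝓝 e, Avoids f b e' := by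
  have h : ∀ᶠ e' : Vec 3 × C(I, Vec 3) in 𝓝 e, e'.1 ≠ 0 := isOpen_ne_fst.mem_nhds he.1
  exact h.and (((contDiffAt_dirQ he.1).continuousAt.eventually_ne he.2.1).and
      ((contDiffAt_endDirQ hf he.1).continuousAt.eventually_ne he.2.2))

/-- The momentum can be chosen locally as a smooth function. -/
theorem exists_local_momentum (hf : ContDiffOn ℝ ∞ f (Set.Ioi 0))
    (hf0 : ∀ R : ℝ, 0 < R → f R ≠ 0) (hb : b * b = -1) (hb' : star b = -b)
    (he : Avoids f b e) : ∃ (O : Set (Vec 3 × C(I, Vec 3))) (p : Vec 3 × C(I, Vec 3) → ℝ),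
      IsOpen O ∧ e ∈ O ∧ ContDiffOn ℝ ∞ p O ∧ ∀ e' ∈ O, IsMomentum f b e' (p e') := by
  obtain ⟨ψ₀, hψ₀⟩ := exists_circ_of_commute hb hb' (norm_twist hb he) (twist_commute hb hb' he.1)
  set q : Vec 3 × C(I, Vec 3) → ℍ[ℝ] := fun e => twist f b e * circ b (-ψ₀) with hq
  have hqs : ∀ e, Avoids f b e → ContDiffAt ℝ ∞ q e := fun e he =>
    (contDiffAt_twist hf hb he).mul contDiffAt_const
  -- The sine of the angle relative to `ψ₀`. Near `e` the real part, which is the cosine, is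
  -- positive, so `arcsin` recovers the angle smoothly.
  set s : Vec 3 × C(I, Vec 3) → ℝ := fun e => -(q e * b).re with hs
  have hss : ∀ e, Avoids f b e → ContDiffAt ℝ ∞ s e := fun e he =>
    (reQ.contDiff.contDiffAt.comp e ((hqs e he).mul contDiffAt_const)).neg
  have hq0 : q e = 1 := by
    simp only [hq]
    rw [hψ₀, ← circ_add hb, add_neg_cancel, circ_zero]
  have hbre : b.re = 0 := Quaternion.star_eq_neg.1 hb'
  have hs0 : s e = 0 := by simp [hs, hq0, hbre]
  have hqre : ∀ᶠ e' in 𝓝 e, 0 < (q e').re :=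
    (reQ.continuous.continuousAt.comp (hqs e he).continuousAt).eventually_const_lt
      (by show 0 < (q e).re; rw [hq0]; simp)
  have hs1 : ∀ᶠ e' in 𝓝 e, -1 < s e' :=
    (hss e he).continuousAt.eventually_const_lt (by rw [hs0]; norm_num)
  have hs2 : ∀ᶠ e' in 𝓝 e, s e' < 1 :=
    (hss e he).continuousAt.eventually_lt_const (by rw [hs0]; norm_num)
  obtain ⟨O, hO, hOo, heO⟩ := eventually_nhds_iff.1
    (((eventually_avoids hf he).and hqre).and (hs1.and hs2))
  refine ⟨O, fun e => momentum f e (ψ₀ + Real.arcsin (s e)), hOo, heO, fun e' he' => ?_,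
    fun e' he' => ⟨_, ?_, rfl⟩⟩
  · obtain ⟨⟨h1, -⟩, h2, h3⟩ := hO e' he'
    have h4 : ContDiffAt ℝ ∞ (fun e : Vec 3 × C(I, Vec 3) => logSlope f ‖e.1‖) e' :=
      contDiffAt_comp_norm_fst (contDiffOn_logSlope hf hf0) h1.1
    have h5 : ContDiffAt ℝ ∞ (fun e => Real.arcsin (s e)) e' :=
      (Real.contDiffAt_arcsin h2.ne' h3.ne).comp e' (hss e' h1)
    have h6 : ContDiffAt ℝ ∞ (fun e : Vec 3 × C(I, Vec 3) => f ‖e.1‖) e' :=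
      contDiffAt_comp_norm_fst hf h1.1
    exact (((contDiffAt_const.div h6 (hf0 _ (norm_pos_iff.2 h1.1))).neg).mul
      ((h4.mul (contDiffAt_rad hf h1.1)).add
        ((contDiffAt_const.sub h4).mul (contDiffAt_const.add h5)))).contDiffWithinAt
  · obtain ⟨⟨h1, h2⟩, h3, h4⟩ := hO e' he'
    obtain ⟨ψ, hψ⟩ := exists_circ_of_commute hb hb' (norm_twist hb h1) (twist_commute hb hb' h1.1)
    have h5 : q e' = circ b (ψ - ψ₀) := by
      simp only [hq]
      rw [hψ, ← circ_add hb, sub_eq_add_neg]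
    have h6 : (q e').re = Real.cos (ψ - ψ₀) := by rw [h5]; simp [circ, hbre]
    have h7 : s e' = Real.sin (ψ - ψ₀) := by
      simp only [hs]
      rw [h5, circ, add_mul, smul_mul_assoc, smul_mul_assoc, hb]
      simp [hbre]
    have h8 : q e' = circ b (Real.arcsin (s e')) := by
      rw [circ, Real.sin_arcsin h3.le h4.le, Real.cos_arcsin, h7, h5, circ,
        ← Real.cos_sq', Real.sqrt_sq (h6 ▸ h2.le)]
    have h9 : twist f b e' = q e' * circ b ψ₀ := by
      simp only [hq]
      rw [mul_assoc, ← circ_add hb, neg_add_cancel, circ_zero, mul_one]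
    rw [h9, h8, ← circ_add hb, add_comm]

end Momentum

/-! ### Solutions with prescribed end points and momentum -/

/-- A path of quaternions from `1` to `(1 - w b) (1 - b v)`. -/
def jointPath (b v w : ℍ[ℝ]) : QPath :=
  ⟨fun u => (1 - (u : ℝ) • (w * b)) * (1 - (u : ℝ) • (b * v)), by fun_prop⟩

/-- The derivative of `jointPath`. -/
def jointPathDeriv (b v w : ℍ[ℝ]) : QPath :=
  ⟨fun u => -(w * b) * (1 - (u : ℝ) • (b * v)) + (1 - (u : ℝ) • (w * b)) * -(b * v), by fun_prop⟩

theorem hasDerivI_jointPath (b v w : ℍ[ℝ]) :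
    HasDerivI (jointPath b v w) (jointPathDeriv b v w) := by
  have h : ∀ z : ℍ[ℝ], HasDerivI (fun u : I => 1 - (u : ℝ) • z) (fun _ => -z) := fun z =>
    ((HasDerivI.const (1 : ℍ[ℝ])).sub (HasDerivI.coe.smul (HasDerivI.const z))).congr
      (fun _ => rfl) fun u => by simp
  exact ((h (w * b)).mul (h (b * v))).congr (fun _ => rfl) fun u => rfl

theorem one_sub_smul_ne_zero {z : ℍ[ℝ]} (hz : ‖z‖ = 1) (hz1 : 1 - z ≠ 0) (u : I) :
    1 - (u : ℝ) • z ≠ 0 := by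
  intro h
  have h1 := congrArg norm (sub_eq_zero.1 h)
  rw [norm_smul, hz, mul_one, norm_one, Real.norm_of_nonneg u.2.1] at h1
  rw [← h1, one_smul] at h
  exact hz1 h

theorem norm_of_imaginary_unit {v : ℍ[ℝ]} (hv : v * v = -1) (hv' : star v = -v) : ‖v‖ = 1 :=
  norm_eq_one_of_mul_star (by rw [hv', mul_neg, hv, neg_neg])

section Joint

variable {f : ℝ → ℝ} {b v w : ℍ[ℝ]}

theorem star_one_sub_mul (hb' : star b = -b) (hv' : star v = -v) :
    star (1 - v * b) = 1 - b * v := by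
  rw [star_sub, star_one, star_mul, hb', hv', neg_mul_neg]

/-- For `|z| = 1` a zero of `1 - u z` on `[0,1]` requires `u = 1` and `z = 1`; the excluded
direction `-b` is the only one giving `z = 1`. -/
theorem jointPath_ne_zero (hb : b * b = -1) (hb' : star b = -b) (hv : v * v = -1)
    (hv' : star v = -v) (hvb : v ≠ -b) (hw : w * w = -1) (hw' : star w = -w) (hwb : w ≠ -b)
    (u : I) : jointPath b v w u ≠ 0 := by
  have hbn := norm_of_imaginary_unit hb hb'
  refine mul_ne_zero (one_sub_smul_ne_zero ?_ (one_sub_mul_ne_zero hb hwb) u)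
    (one_sub_smul_ne_zero ?_ ?_ u)
  · rw [norm_mul, norm_of_imaginary_unit hw hw', hbn, one_mul]
  · rw [norm_mul, norm_of_imaginary_unit hv hv', hbn, one_mul]
  · rw [← star_one_sub_mul hb' hv']
    exact star_ne_zero.2 (one_sub_mul_ne_zero hb hvb)

/-- The path ends at a positive multiple of `sect b w * star (sect b v)`; its normalisation is the
holonomy of the imaginary logarithmic derivative. -/
theorem transport_jointPath (hb : b * b = -1) (hb' : star b = -b) (hv : v * v = -1)
    (hv' : star v = -v) (hvb : v ≠ -b) (hw : w * w = -1) (hw' : star w = -w) (hwb : w ≠ -b) :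
    transport (logDeriv (jointPath b v w) (jointPathDeriv b v w)) 1 =
      sect b w * star (sect b v) := by
  obtain ⟨ρ, hρ, h⟩ := transport_logDeriv (hasDerivI_jointPath b v w)
    (jointPath_ne_zero hb hb' hv hv' hvb hw hw' hwb)
  have h0 : jointPath b v w 0 = 1 := by simp [jointPath]
  have h1 : jointPath b v w 1 = (‖1 - w * b‖ * ‖1 - v * b‖) • (sect b w * star (sect b v)) := by
    have e1 : ∀ {z : ℍ[ℝ]}, z ≠ -b → 1 - z * b = ‖1 - z * b‖ • sect b z := fun hz => by
      rw [sect, smul_inv_smul₀ (norm_ne_zero_iff.2 (one_sub_mul_ne_zero hb hz))]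
    have e2 : jointPath b v w 1 = (1 - w * b) * star (1 - v * b) := by
      rw [star_one_sub_mul hb' hv']; simp [jointPath]
    have e3 : (1 - w * b) * star (1 - v * b) =
        (‖1 - w * b‖ • sect b w) * star (‖1 - v * b‖ • sect b v) := by
      rw [← e1 hwb, ← e1 hvb]
    rw [e2, e3, Quaternion.star_smul, smul_mul_smul_comm]
  rw [h0, mul_one, h1, smul_smul] at h
  have h2 := congrArg norm h
  rw [norm_transport (star_logDeriv _ _), norm_smul, norm_mul (sect b w), norm_star,
    norm_sect hb hwb,
    norm_sect hb hvb, mul_one, mul_one, Real.norm_of_nonneg (by positivity)] at h2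
  rw [h, ← h2, one_smul]

theorem continuous_logDeriv {Z : Type*} [TopologicalSpace Z] {M dM : Z → QPath}
    (hM : Continuous M) (hdM : Continuous dM) (h : ∀ z u, M z u ≠ 0) :
    Continuous fun z => logDeriv (M z) (dM z) := by
  have h1 : Continuous fun z => Ring.inverse (M z) := by
    refine continuous_iff_continuousAt.2 fun z => ?_
    obtain ⟨y, hy⟩ := isUnit_qpath (h z)
    have h2 := NormedRing.inverse_continuousAt y
    rw [hy] at h2
    exact ContinuousAt.comp (g := Ring.inverse) h2 hM.continuousAt
  exact (hdM.mul h1).sub (reC.continuous.comp (hdM.mul h1))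

theorem continuous_logDeriv_jointPath (hb : b * b = -1) (hb' : star b = -b) {Z : Type*}
    [TopologicalSpace Z] {v w : Z → ℍ[ℝ]} (hvc : Continuous v) (hwc : Continuous w)
    (hv : ∀ z, v z * v z = -1) (hv' : ∀ z, star (v z) = -v z) (hvb : ∀ z, v z ≠ -b)
    (hw : ∀ z, w z * w z = -1) (hw' : ∀ z, star (w z) = -w z) (hwb : ∀ z, w z ≠ -b) :
    Continuous fun z => logDeriv (jointPath b (v z) (w z)) (jointPathDeriv b (v z) (w z)) := by
  refine continuous_logDeriv (ContinuousMap.continuous_of_continuous_uncurry _ ?_)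
    (ContinuousMap.continuous_of_continuous_uncurry _ ?_) fun z u =>
      jointPath_ne_zero hb hb' (hv z) (hv' z) (hvb z) (hw z) (hw' z) (hwb z) u
  · show Continuous fun y : Z × I => (1 - (y.2 : ℝ) • (w y.1 * b)) *
      (1 - (y.2 : ℝ) • (b * v y.1))
    fun_prop
  · show Continuous fun y : Z × I => -(w y.1 * b) * (1 - (y.2 : ℝ) • (b * v y.1)) +
      (1 - (y.2 : ℝ) • (w y.1 * b)) * -(b * v y.1)
    fun_prop

theorem continuous_comp_of_contDiffAt {Z F : Type*} [TopologicalSpace Z] [NormedAddCommGroup F]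
    [NormedSpace ℝ F] {e : Z → Vec 3 × C(I, Vec 3)} (he : Continuous e) (h : ∀ z, (e z).1 ≠ 0)
    {G : Vec 3 × C(I, Vec 3) → F} (hG : ∀ e, e.1 ≠ 0 → ContDiffAt ℝ ∞ G e) :
    Continuous fun z => G (e z) :=
  continuous_iff_continuousAt.2 fun z =>
    ContinuousAt.comp (g := G) (hG _ (h z)).continuousAt he.continuousAt

theorem endDirQ_of_hol_eq_sect {e : Vec 3 × C(I, Vec 3)} (hb : b * b = -1) (he : e.1 ≠ 0)
    (hvb : dirQ e.1 ≠ -b) (hw : w * w = -1) (hwb : w ≠ -b)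
    (h : hol f e = sect b w * star (sect b (dirQ e.1))) :
    endDirQ f e = w ∧ twist f b e = 1 := by
  have h1 : endDirQ f e = w := by
    have h2 : sect b (dirQ e.1) * b = dirQ e.1 * sect b (dirQ e.1) :=
      sect_mul hb (dirQ_mul_self he)
    have hs := star_mul_self_of_norm_eq_one (norm_sect hb hvb)
    calc _ = sect b w * (star (sect b (dirQ e.1)) * (dirQ e.1 * sect b (dirQ e.1))) *
          star (sect b w) := by rw [endDirQ, h, star_mul, star_star]; noncomm_ring
      _ = _ := by rw [← h2, ← mul_assoc (star _), hs, one_mul, sect_conj hb hw hwb]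
  refine ⟨h1, ?_⟩
  rw [twist, h1, h, ← mul_assoc, star_mul_self_of_norm_eq_one (norm_sect hb hwb), one_mul,
    star_mul_self_of_norm_eq_one (norm_sect hb hvb)]

/-- Solutions can be chosen continuously with given end points and momentum. -/
theorem exists_continuous_section (hf : ContDiffOn ℝ ∞ f (Set.Ioi 0))
    (hf0 : ∀ R : ℝ, 0 < R → f R ≠ 0) (hb : b * b = -1) (hb' : star b = -b) {Z : Type*}
    [TopologicalSpace Z] {x : Z → Vec 3} {w : Z → ℍ[ℝ]} {p : Z → ℝ} (hx : Continuous x)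
    (hwc : Continuous w) (hp : Continuous p) (hx0 : ∀ z, x z ≠ 0) (hxb : ∀ z, dirQ (x z) ≠ -b)
    (hw : ∀ z, w z * w z = -1) (hw' : ∀ z, star (w z) = -w z) (hwb : ∀ z, w z ≠ -b) :
    ∃ e : Z → Vec 3 × C(I, Vec 3), Continuous e ∧ ∀ z, (e z).1 = x z ∧
      endDirQ f (e z) = w z ∧ IsMomentum f b (e z) (p z) := by
  have hxn : Continuous fun z => ‖x z‖ := hx.norm
  have hpos : ∀ z, 0 < ‖x z‖ := fun z => norm_pos_iff.2 (hx0 z)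
  have hcomp : ∀ {g : ℝ → ℝ}, ContDiffOn ℝ ∞ g (Set.Ioi 0) → Continuous fun z => g ‖x z‖ :=
    fun hg => hg.continuousOn.comp_continuous hxn hpos
  have hfx := hcomp hf
  have hfx0 : ∀ z, f ‖x z‖ ≠ 0 := fun z => hf0 _ (hpos z)
  have hv : Continuous fun z => dirQ (x z) :=
    toQ.continuous.comp ((hxn.inv₀ fun z => (hpos z).ne').smul hx)
  set a : Z → QPath := fun z =>
    logDeriv (jointPath b (dirQ (x z)) (w z)) (jointPathDeriv b (dirQ (x z)) (w z)) with ha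
  have hac : Continuous a :=
     continuous_logDeriv_jointPath hb hb' hv hwc (fun z => dirQ_mul_self (hx0 z))
      (fun z => star_dirQ _) hxb hw hw' hwb
  set e₀ : Z → Vec 3 × C(I, Vec 3) := fun z => (x z, ofQC ((-(2 / f ‖x z‖)) • a z)) with he₀
  have he₀c : Continuous e₀ :=
    hx.prodMk (ofQC.continuous.comp (((continuous_const.div hfx hfx0).neg).smul hac))
  have hconn : ∀ z, conn f (e₀ z) = a z := fun z => conn_smul_ofQC (hfx0 z) (star_logDeriv _ _)
  have hrad : Continuous fun z => rad f (e₀ z) :=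
    continuous_comp_of_contDiffAt he₀c hx0 fun _ h => contDiffAt_rad hf h
  -- The base solution has trivial relative holonomy, so `ψ = 0` gives it the momentum `-(2/f) C ρ`.
  -- A radial shift by `t` adds what is missing to `p`.
  set t : Z → ℝ := fun z => p z + 2 / f ‖x z‖ * (logSlope f ‖x z‖ * rad f (e₀ z)) with ht
  have htc : Continuous t := hp.add ((continuous_const.div hfx hfx0).mul
    ((hcomp (contDiffOn_logSlope hf hf0)).mul hrad))
  refine ⟨fun z => radialShift f (e₀ z) (t z), ?_, fun z => ?_⟩
  · have h0 : Continuous fun z => (a z, dirQ (x z)) := hac.prodMk hv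
    have h1 := Continuous.comp contDiff_frame.continuous h0
    simp only [radialShift, hconn]
    have h2 : Continuous fun z => (e₀ z).2 + t z • ofQC (frame (a z) (dirQ (x z))) :=
      he₀c.snd.add (htc.smul (ofQC.continuous.comp h1))
    exact hx.prodMk h2
  · have h1 : hol f (e₀ z) = sect b (w z) * star (sect b (dirQ (e₀ z).1)) := by
      rw [hol, hconn]
      exact transport_jointPath hb hb' (dirQ_mul_self (hx0 z)) (star_dirQ _) (hxb z) (hw z)
        (hw' z) (hwb z)
    have h7 : (e₀ z).1 ≠ 0 := hx0 z
    obtain ⟨h2, h3⟩ := endDirQ_of_hol_eq_sect hb h7 (hxb z) (hw z) (hwb z) h1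
    have h0 : (radialShift f (e₀ z) (t z)).1 = (e₀ z).1 := rfl
    refine ⟨rfl, ?_, ?_⟩
    · exact (endDirQ_of_hol h7 h0 (hol_radialShift h7 (t z))).trans h2
    · have h4 : IsMomentum f b (e₀ z) (momentum f (e₀ z) 0) := ⟨0, by rw [h3, circ_zero], rfl⟩
      have h5 := h4.radialShift hf0 hb h7 (t z)
      have h6 : momentum f (e₀ z) 0 + t z = p z := by
        simp only [momentum, ht, he₀]
        ring
      rwa [h6] at h5

end Joint

/-! ### The quotient of the radius and the momentum -/

theorem exists_homeomorph_of_isQuotientMap {A B B' : Type*} [TopologicalSpace A]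
    [TopologicalSpace B] [TopologicalSpace B'] {m : A → B} {m' : A → B'} (hm : IsQuotientMap m)
    (hm' : IsQuotientMap m') (h : ∀ a a', m a = m a' ↔ m' a = m' a') :
    ∃ Φ : B ≃ₜ B', ∀ a, Φ (m a) = m' a := by
  have h1 : ∀ a, m' (Function.surjInv hm.surjective (m a)) = m' a := fun a =>
    (h _ _).1 (Function.surjInv_eq hm.surjective _)
  have h2 : ∀ a, m (Function.surjInv hm'.surjective (m' a)) = m a := fun a =>
    (h _ _).2 (Function.surjInv_eq hm'.surjective _)
  refine ⟨{ toFun := fun y => m' (Function.surjInv hm.surjective y)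
            invFun := fun y => m (Function.surjInv hm'.surjective y)
            left_inv := fun y => ?_
            right_inv := fun y => ?_
            continuous_toFun := ?_
            continuous_invFun := ?_ }, h1⟩
  · exact (h2 _).trans (Function.surjInv_eq hm.surjective y)
  · exact (h1 _).trans (Function.surjInv_eq hm'.surjective y)
  · rw [hm.continuous_iff]
    exact hm'.continuous.congr fun a => (h1 a).symm
  · rw [hm'.continuous_iff]
    exact hm.continuous.congr fun a => (h2 a).symm

section QuotientQ

variable {f : ℝ → ℝ} {U : Set ℝ}

/-- The period of the momentum. -/
def period (f : ℝ → ℝ) (R : ℝ) : ℝ := 4 * Real.pi * (1 - logSlope f R) / f R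

theorem QuotientQ.mk_eq_iff {R R' : U} {p p' : ℝ} :
    (QuotientQ.mk R p : QuotientQ f U) = QuotientQ.mk R' p' ↔
      R' = R ∧ ∃ m : ℤ, p' = p + m * period f R := by
  constructor
  · intro h
    have h1 := Quot.eqvGen_exact h
    suffices ∀ z z' : U × ℝ, Relation.EqvGen (fun a b : U × ℝ =>
        b = (a.1, a.2 + 4 * Real.pi * (1 - logSlope f (a.1 : ℝ)) / f (a.1 : ℝ))) z z' →
        z'.1 = z.1 ∧ ∃ m : ℤ, z'.2 = z.2 + m * period f z.1 from this _ _ h1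
    intro z z' hz
    induction hz with
    | rel z z' h => subst h; exact ⟨rfl, 1, by simp [period]⟩
    | refl z => exact ⟨rfl, 0, by simp⟩
    | symm z z' _ ih =>
      obtain ⟨h1, m, h2⟩ := ih
      exact ⟨h1.symm, -m, by rw [h2, h1]; push_cast; ring⟩
    | trans z z' z'' _ _ ih ih' =>
      obtain ⟨h1, m, h2⟩ := ih
      obtain ⟨h3, k, h4⟩ := ih'
      exact ⟨h3.trans h1, m + k, by rw [h4, h2, h1]; push_cast; ring⟩
  · rintro ⟨rfl, m, rfl⟩
    have h1 : ∀ p : ℝ, (QuotientQ.mk R' (p + period f R') : QuotientQ f U) = QuotientQ.mk R' p :=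
      fun p =>
      (Quot.sound (r := fun a b : U × ℝ => b = (a.1, a.2 + 4 * Real.pi *
        (1 - logSlope f (a.1 : ℝ)) / f (a.1 : ℝ))) (a := (R', p))
        (b := (R', p + period f R')) rfl).symm
    symm
    induction m with
    | zero => simp
    | succ n ih =>
      rw [← ih, ← h1 (p + ((n : ℤ) : ℝ) * period f R')]
      congr 1
      push_cast
      ring
    | pred n ih =>
      rw [← ih, ← h1 (p + ((-(n : ℤ) - 1 : ℤ) : ℝ) * period f R')]
      congr 1
      push_cast
      ring

theorem continuous_period (hf : ContDiffOn ℝ ∞ f (Set.Ioi 0)) (hf0 : ∀ R : ℝ, 0 < R → f R ≠ 0)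
    (hU : U ⊆ Set.Ioi 0) : Continuous fun R : U => period f R :=
  (continuous_const.mul (continuous_const.sub
    ((contDiffOn_logSlope hf hf0).continuousOn.comp_continuous continuous_subtype_val
      fun R => hU R.2))).div (hf.continuousOn.comp_continuous continuous_subtype_val
      fun R => hU R.2) fun R => hf0 R (hU R.2)

/-- The saturation of an open set is the union of its preimages under the continuous translations by
multiples of the period. -/
theorem QuotientQ.isOpenQuotientMap (hf : ContDiffOn ℝ ∞ f (Set.Ioi 0))
    (hf0 : ∀ R : ℝ, 0 < R → f R ≠ 0) (hU : U ⊆ Set.Ioi 0) :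
    IsOpenQuotientMap (fun z : U × ℝ => (QuotientQ.mk z.1 z.2 : QuotientQ f U)) := by
  have hq : IsQuotientMap (fun z : U × ℝ => (QuotientQ.mk z.1 z.2 : QuotientQ f U)) :=
    isQuotientMap_quot_mk
  refine ⟨hq.surjective, hq.continuous, fun W hW => ?_⟩
  rw [← hq.isOpen_preimage]
  have h1 : (fun z : U × ℝ => (QuotientQ.mk z.1 z.2 : QuotientQ f U)) ⁻¹'
      ((fun z : U × ℝ => (QuotientQ.mk z.1 z.2 : QuotientQ f U)) '' W) =
      ⋃ m : ℤ, (fun z : U × ℝ => (z.1, z.2 + m * period f z.1)) ⁻¹' W := by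
    ext z
    simp only [mem_preimage, mem_image, mem_iUnion, Prod.exists]
    constructor
    · rintro ⟨R, p, h, h'⟩
      obtain ⟨rfl, m, h2⟩ := QuotientQ.mk_eq_iff.1 h'.symm
      exact ⟨m, h2 ▸ h⟩
    · rintro ⟨m, h⟩
      exact ⟨_, _, h, (QuotientQ.mk_eq_iff.2 ⟨rfl, m, rfl⟩).symm⟩
  rw [h1]
  have h2 := continuous_period hf hf0 hU
  exact isOpen_iUnion fun m => hW.preimage
    (continuous_fst.prodMk (continuous_snd.add (continuous_const.mul (h2.comp continuous_fst))))

end QuotientQ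

/-! ### Polar coordinates -/

section Polar

variable {f : ℝ → ℝ} {U : Set ℝ} {V : Set S2}

theorem norm_S2 (v : S2) : ‖(v : Vec 3)‖ = 1 := mem_sphere_zero_iff_norm.1 v.2

theorem dir_smul_S2 {R : ℝ} (hR : 0 < R) (v : S2) :
    ‖R • (v : Vec 3)‖ = R ∧ ‖R • (v : Vec 3)‖⁻¹ • (R • (v : Vec 3)) = v := by
  have h : ‖R • (v : Vec 3)‖ = R := by
    rw [norm_smul, norm_S2, mul_one, Real.norm_of_nonneg hR.le]
  exact ⟨h, by rw [h, inv_smul_smul₀ hR.ne']⟩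

theorem polarBox_pos (hU : U ⊆ Set.Ioi 0) {x : Vec 3} (hx : x ∈ polarBox U V) : 0 < ‖x‖ :=
  hU hx.1

theorem dir_mem_sphere {x : Vec 3} (hx : x ≠ 0) : ‖x‖⁻¹ • x ∈ Metric.sphere (0 : Vec 3) 1 :=
  mem_sphere_zero_iff_norm.2 (norm_dir hx)

theorem mem_polarBox_iff {x : Vec 3} (hx : x ≠ 0) :
    x ∈ polarBox U V ↔ ‖x‖ ∈ U ∧ (⟨‖x‖⁻¹ • x, dir_mem_sphere hx⟩ : S2) ∈ V := by
  have hx' : ‖x‖ ≠ 0 := norm_ne_zero_iff.2 hx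
  refine and_congr_right fun _ => ⟨?_, fun h => ⟨_, h, (smul_inv_smul₀ hx' x).symm⟩⟩
  rintro ⟨v, hv, h⟩
  have h1 : (⟨‖x‖⁻¹ • x, dir_mem_sphere hx⟩ : S2) = v :=
    Subtype.ext ((inv_smul_eq_iff₀ hx').2 h)
  rwa [h1]

/-- The direction of a point of a polar box. -/
def polarDir (hU : U ⊆ Set.Ioi 0) (x : polarBox U V) : V :=
  ⟨⟨‖(x : Vec 3)‖⁻¹ • (x : Vec 3), dir_mem_sphere (norm_pos_iff.1 (polarBox_pos hU x.2))⟩,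
    ((mem_polarBox_iff (norm_pos_iff.1 (polarBox_pos hU x.2))).1 x.2).2⟩

theorem continuous_polarDir (hU : U ⊆ Set.Ioi 0) :
    Continuous (polarDir hU : polarBox U V → V) :=
  ((((continuous_subtype_val.norm).inv₀ fun x => (polarBox_pos hU x.2).ne').smul
    continuous_subtype_val).subtype_mk _).subtype_mk _

theorem isOpen_polarBox (hUo : IsOpen U) (hU : U ⊆ Set.Ioi 0) (hV : IsOpen V) :
    IsOpen (polarBox U V) := by
  obtain ⟨W, hW, rfl⟩ := isOpen_induced_iff.1 hV
  have h1 : polarBox U (Subtype.val ⁻¹' W) = {x : Vec 3 | x ≠ 0} ∩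
      (fun x => (‖x‖, ‖x‖⁻¹ • x)) ⁻¹' (U ×ˢ W) := by
    ext x
    constructor
    · intro hx
      have hx0 := norm_pos_iff.1 (polarBox_pos hU hx)
      exact ⟨hx0, (mem_polarBox_iff hx0).1 hx⟩
    · rintro ⟨hx0, hx⟩
      exact (mem_polarBox_iff hx0).2 hx
  rw [h1]
  refine ContinuousOn.isOpen_inter_preimage ?_ isOpen_ne (hUo.prod hW)
  exact continuous_norm.continuousOn.prodMk
    ((continuous_norm.continuousOn.inv₀ fun x hx => norm_ne_zero_iff.2 hx).smul continuousOn_id)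

theorem Constraint.X_one (c : RotConstraint f) :
    c.X 1 = ‖c.X 0‖ • ofQ (endDirQ f c.chart) := by
  apply toQ_injective
  rw [c.toQ_X, map_smul, toQ_ofQ (star_endDirQ f _)]
  rfl

theorem Constraint.dirQ_X_one (c : RotConstraint f) : dirQ (c.X 1) = endDirQ f c.chart := by
  rw [dirQ, c.norm_X, map_smul, c.toQ_X, inv_smul_smul₀ (norm_ne_zero_iff.2 (c.X_ne_zero 0))]
  rfl

theorem continuous_X_zero : Continuous fun c : RotConstraint f => c.X 0 :=
  Constraint.continuous_chart.fst

theorem continuous_X_one (hf : ContDiffOn ℝ ∞ f (Set.Ioi 0)) :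
    Continuous fun c : RotConstraint f => c.X 1 := by
  have h1 : Continuous fun c : RotConstraint f => endDirQ f c.chart :=
    continuous_comp_of_contDiffAt Constraint.continuous_chart (fun c => c.X_ne_zero 0)
      fun _ h => contDiffAt_endDirQ hf h
  simp only [Constraint.X_one]
  exact continuous_X_zero.norm.smul (ofQ.continuous.comp h1)

/-! ### The local phase space and its polar map -/

theorem isQuotientMap_mk : IsQuotientMap (PhaseSpace.mk : RotConstraint f → _) :=
  isQuotientMap_quot_mk

theorem isOpen_localPhaseSpace (hf : ContDiffOn ℝ ∞ f (Set.Ioi 0)) (hUo : IsOpen U)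
    (hU : U ⊆ Set.Ioi 0) (hV : IsOpen V) : IsOpen (localPhaseSpace f U V) := by
  rw [← isQuotientMap_mk.isOpen_preimage]
  exact ((isOpen_polarBox hUo hU hV).preimage continuous_X_zero).inter
    ((isOpen_polarBox hUo hU hV).preimage (continuous_X_one hf))

theorem dirQ_ne_of_mem_polarBox (hU : U ⊆ Set.Ioi 0) {s : S2} (hs : s ∉ V) {x : Vec 3}
    (hx : x ∈ polarBox U V) : dirQ x ≠ toQ (s : Vec 3) := by
  intro h
  have h1 : polarDir hU ⟨x, hx⟩ = s := Subtype.ext (toQ_injective h)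
  exact hs (h1 ▸ (polarDir hU ⟨x, hx⟩).2)

/-- The solutions with end points in the polar box. -/
abbrev PolarConstraint (f : ℝ → ℝ) (U : Set ℝ) (V : Set S2) : Type :=
  (PhaseSpace.mk : RotConstraint f → _) ⁻¹' localPhaseSpace f U V

theorem PolarConstraint.avoids (hU : U ⊆ Set.Ioi 0) {s : S2} (hs : s ∉ V)
    (c : PolarConstraint f U V) : Avoids f (-toQ (s : Vec 3)) c.1.chart := by
  refine ⟨c.1.X_ne_zero 0, ?_, ?_⟩
  · rw [neg_neg]
    exact dirQ_ne_of_mem_polarBox hU hs c.2.1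
  · rw [neg_neg, ← Constraint.dirQ_X_one]
    exact dirQ_ne_of_mem_polarBox hU hs c.2.2

/-- The directions of the end points and the class of the radius and the momentum. -/
def polarMap (hU : U ⊆ Set.Ioi 0) (s : S2) (c : PolarConstraint f U V) :
    V × V × QuotientQ f U :=
  (polarDir hU ⟨c.1.X 0, c.2.1⟩, polarDir hU ⟨c.1.X 1, c.2.2⟩,
    QuotientQ.mk ⟨‖c.1.X 0‖, c.2.1.1⟩
      (Classical.epsilon (IsMomentum f (-toQ (s : Vec 3)) c.1.chart)))

theorem base_mul_self (s : S2) : -toQ (s : Vec 3) * -toQ (s : Vec 3) = -1 := by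
  rw [neg_mul_neg, toQ_mul_self, norm_S2]
  simp

theorem star_base (s : S2) : star (-toQ (s : Vec 3)) = - -toQ (s : Vec 3) := by
  rw [star_neg, star_toQ]

/-- All momenta of one solution differ by periods, so the arbitrary choice in `polarMap` does not
affect the class. -/
theorem polarMap_eq_mk_iff (hU : U ⊆ Set.Ioi 0) {s : S2} (hs : s ∉ V) (c : PolarConstraint f U V)
    (R : U) (p : ℝ) : (polarMap hU s c).2.2 = QuotientQ.mk R p ↔
      (R : ℝ) = ‖c.1.X 0‖ ∧ IsMomentum f (-toQ (s : Vec 3)) c.1.chart p := by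
  have h1 := Classical.epsilon_spec
    (exists_isMomentum (base_mul_self s) (star_base s) (c.avoids hU hs))
  have h2 : R = ⟨‖c.1.X 0‖, c.2.1.1⟩ ↔ (R : ℝ) = ‖c.1.X 0‖ := Subtype.ext_iff
  rw [h1.iff_exists (base_mul_self s) (star_base s) p, ← h2]
  exact QuotientQ.mk_eq_iff

theorem polarMap_eq_iff (hf : ContDiffOn ℝ ∞ f (Set.Ioi 0)) (hf0 : ∀ R : ℝ, 0 < R → f R ≠ 0)
    (hU : U ⊆ Set.Ioi 0) {s : S2} (hs : s ∉ V) (c c' : PolarConstraint f U V) :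
    PhaseSpace.mk c.1 = PhaseSpace.mk c'.1 ↔ polarMap hU s c = polarMap hU s c' := by
  obtain ⟨p, hp⟩ := exists_isMomentum (base_mul_self s) (star_base s) (c'.avoids hU hs)
  have h3 := (polarMap_eq_mk_iff hU hs c' ⟨‖c'.1.X 0‖, c'.2.1.1⟩ p).2 ⟨rfl, hp⟩
  constructor
  · intro h
    have h0 : c.1.X 0 = c'.1.X 0 := congrArg PhaseSpace.l h
    have h1 : c.1.X 1 = c'.1.X 1 := congrArg PhaseSpace.r h
    refine Prod.ext ?_ (Prod.ext ?_ ?_)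
    · simp only [polarMap, h0]
    · simp only [polarMap, h1]
    · rw [h3, polarMap_eq_mk_iff hU hs]
      exact ⟨by rw [h0], hp.of_orb (base_mul_self s) (c'.1.X_ne_zero 0)
        ((PhaseSpace.mk_eq_iff hf hf0).1 h.symm)⟩
  · intro h
    have h0 : dirQ (c.1.X 0) = dirQ (c'.1.X 0) :=
      congrArg (fun z : V × V × QuotientQ f U => toQ ((z.1 : S2) : Vec 3)) h
    have h1 : dirQ (c.1.X 1) = dirQ (c'.1.X 1) :=
      congrArg (fun z : V × V × QuotientQ f U => toQ ((z.2.1 : S2) : Vec 3)) h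
    rw [← h] at h3
    obtain ⟨h4, h5⟩ := (polarMap_eq_mk_iff hU hs c _ p).1 h3
    have h6 : c'.1.X 0 = c.1.X 0 := by
      apply toQ_injective
      rw [← norm_smul_dirQ (c.1.X_ne_zero 0), ← norm_smul_dirQ (c'.1.X_ne_zero 0), h0]
      congr 1
    rw [Constraint.dirQ_X_one, Constraint.dirQ_X_one] at h1
    rw [PhaseSpace.mk_eq_iff hf hf0]
    exact h5.orb hf0 (base_mul_self s) (c.avoids hU hs) (c'.avoids hU hs) h6 h1.symm hp

theorem exists_local_momentum_polarMap (hf : ContDiffOn ℝ ∞ f (Set.Ioi 0))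
    (hf0 : ∀ R : ℝ, 0 < R → f R ≠ 0) (hU : U ⊆ Set.Ioi 0) {s : S2} (hs : s ∉ V)
    (c₀ : PolarConstraint f U V) :
    ∃ (O : Set (Vec 3 × C(I, Vec 3))) (p : Vec 3 × C(I, Vec 3) → ℝ),
      IsOpen O ∧ c₀.1.chart ∈ O ∧ ContDiffOn ℝ ∞ p O ∧ ∀ c : PolarConstraint f U V,
        c.1.chart ∈ O →
          (polarMap hU s c).2.2 = QuotientQ.mk ⟨‖c.1.X 0‖, c.2.1.1⟩ (p c.1.chart) := by
  obtain ⟨O, p, hO, h1, h2, h3⟩ :=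
    exists_local_momentum hf hf0 (base_mul_self s) (star_base s) (c₀.avoids hU hs)
  exact ⟨O, p, hO, h1, h2, fun c hc => (polarMap_eq_mk_iff hU hs c _ _).2 ⟨rfl, h3 _ hc⟩⟩

/-- The chosen momentum may jump by periods, but locally its class is also that of a smooth
momentum. -/
theorem continuous_polarMap (hf : ContDiffOn ℝ ∞ f (Set.Ioi 0))
    (hf0 : ∀ R : ℝ, 0 < R → f R ≠ 0) (hU : U ⊆ Set.Ioi 0) {s : S2} (hs : s ∉ V) :
    Continuous (polarMap hU s : PolarConstraint f U V → _) := by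
  have hX : Continuous fun c : PolarConstraint f U V => c.1.X 0 :=
    continuous_X_zero.comp continuous_subtype_val
  refine ((continuous_polarDir hU).comp (hX.subtype_mk _)).prodMk
    (((continuous_polarDir hU).comp
      (((continuous_X_one hf).comp continuous_subtype_val).subtype_mk _)).prodMk ?_)
  refine continuous_iff_continuousAt.2 fun c₀ => ?_
  obtain ⟨O, p, hO, h1, h2, h3⟩ := exists_local_momentum_polarMap hf hf0 hU hs c₀
  have hch : Continuous fun c : PolarConstraint f U V => c.1.chart :=
    Constraint.continuous_chart.comp continuous_subtype_val
  have hp : ContinuousAt (fun c : PolarConstraint f U V => p c.1.chart) c₀ :=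
    ContinuousAt.comp (g := p) (h2.continuousOn.continuousAt (hO.mem_nhds h1)) hch.continuousAt
  have hn : Continuous fun c : PolarConstraint f U V => (⟨‖c.1.X 0‖, c.2.1.1⟩ : U) :=
    hX.norm.subtype_mk _
  have h4 := ContinuousAt.comp (g := fun z : U × ℝ => (QuotientQ.mk z.1 z.2 : QuotientQ f U))
    (QuotientQ.isOpenQuotientMap hf hf0 hU).continuous.continuousAt
    (hn.continuousAt.prodMk hp)
  refine h4.congr ?_
  filter_upwards [hch.continuousAt.preimage_mem_nhds (hO.mem_nhds h1)] with c hc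
  exact (h3 c hc).symm

/-- A continuous family of solutions, parametrised by the end directions, the radius and a real
momentum, lifts the projection to `V × V × Q` through the polar map. A continuous map through which
a quotient map factors continuously is itself a quotient map. -/
theorem isQuotientMap_polarMap (hf : ContDiffOn ℝ ∞ f (Set.Ioi 0))
    (hf0 : ∀ R : ℝ, 0 < R → f R ≠ 0) (hU : U ⊆ Set.Ioi 0) {s : S2} (hs : s ∉ V) :
    IsQuotientMap (polarMap hU s : PolarConstraint f U V → _) := by
  -- Products of quotient maps need not be quotient maps; openness of the factors is what makes this
  -- one work.
  have hκ : IsQuotientMap (Prod.map id (Prod.map id fun z : U × ℝ => QuotientQ.mk z.1 z.2) :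
      V × V × (U × ℝ) → V × V × QuotientQ f U) :=
    (IsOpenQuotientMap.id.prodMap (IsOpenQuotientMap.id.prodMap
      (QuotientQ.isOpenQuotientMap hf hf0 hU))).isQuotientMap
  have hpos : ∀ z : V × V × (U × ℝ), 0 < (z.2.2.1 : ℝ) := fun z => hU z.2.2.1.2
  have hne : ∀ v : V, toQ ((v : S2) : Vec 3) ≠ - -toQ (s : Vec 3) := fun v h => by
    rw [neg_neg] at h
    exact hs ((Subtype.ext (toQ_injective h) : (v : S2) = s) ▸ v.2)
  have hdir : ∀ z : V × V × (U × ℝ),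
      dirQ ((z.2.2.1 : ℝ) • ((z.1 : S2) : Vec 3)) = toQ ((z.1 : S2) : Vec 3) := fun z => by
    rw [dirQ, (dir_smul_S2 (hpos z) _).2]
  have hx0 : ∀ z : V × V × (U × ℝ), (z.2.2.1 : ℝ) • ((z.1 : S2) : Vec 3) ≠ 0 := fun z =>
    norm_ne_zero_iff.1 (by rw [(dir_smul_S2 (hpos z) _).1]; exact (hpos z).ne')
  obtain ⟨e, hec, he⟩ := exists_continuous_section hf hf0 (base_mul_self s) (star_base s)
    (Z := V × V × (U × ℝ)) (x := fun z => (z.2.2.1 : ℝ) • ((z.1 : S2) : Vec 3))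
    (w := fun z => toQ ((z.2.1 : S2) : Vec 3)) (p := fun z => z.2.2.2) (by fun_prop) (by fun_prop)
    (by fun_prop) hx0 (fun z => by rw [hdir]; exact hne _)
    (fun z => by rw [toQ_mul_self, norm_S2]; simp) (fun z => star_toQ _) (fun z => hne _)
  have he0 : ∀ z, (e z).1 ≠ 0 := fun z => by rw [(he z).1]; exact hx0 z
  have hX0 : ∀ z, (solution f (e z).1 (he0 z) (e z).2).X 0 =
      (z.2.2.1 : ℝ) • ((z.1 : S2) : Vec 3) := fun z => by
    rw [← (he z).1]
    exact congrArg Prod.fst (solution_chart (f := f) _ (he0 z) (e z).2)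
  have hX1 : ∀ z, (solution f (e z).1 (he0 z) (e z).2).X 1 =
      (z.2.2.1 : ℝ) • ((z.2.1 : S2) : Vec 3) := fun z => by
    rw [Constraint.X_one, hX0, solution_chart, (he z).2.1, ofQ_toQ, (dir_smul_S2 (hpos z) _).1]
  have hbox : ∀ (R : U) (v : V), (R : ℝ) • ((v : S2) : Vec 3) ∈ polarBox U V := fun R v => by
    have h := (dir_smul_S2 (hU R.2) (v : S2)).1
    refine ⟨?_, v, v.2, ?_⟩
    · rw [h]; exact R.2
    · rw [h]
  have hmem : ∀ z, PhaseSpace.mk (solution f (e z).1 (he0 z) (e z).2) ∈ localPhaseSpace f U V :=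
    fun z => by
      constructor
      · show (solution f (e z).1 (he0 z) (e z).2).X 0 ∈ _
        rw [hX0]; exact hbox _ _
      · show (solution f (e z).1 (he0 z) (e z).2).X 1 ∈ _
        rw [hX1]; exact hbox _ _
  set σ' : V × V × (U × ℝ) → PolarConstraint f U V := fun z => ⟨_, hmem z⟩ with hσ
  have hσc : Continuous σ' := by
    refine Continuous.subtype_mk (continuous_induced_rng.2 ?_) _
    exact hec.congr fun z => (solution_chart _ (he0 z) _).symm
  refine IsQuotientMap.of_comp hσc (continuous_polarMap hf hf0 hU hs) ?_
  have hcomp : polarMap hU s ∘ σ' =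
      Prod.map id (Prod.map id fun z : U × ℝ => QuotientQ.mk z.1 z.2) := by
    funext z
    refine Prod.ext (Subtype.ext (Subtype.ext ?_)) (Prod.ext (Subtype.ext (Subtype.ext ?_)) ?_)
    · show ‖(σ' z).1.X 0‖⁻¹ • (σ' z).1.X 0 = _
      rw [hσ]
      simp only
      rw [hX0, (dir_smul_S2 (hpos z) _).2]
      rfl
    · show ‖(σ' z).1.X 1‖⁻¹ • (σ' z).1.X 1 = _
      rw [hσ]
      simp only
      rw [hX1, (dir_smul_S2 (hpos z) _).2]
      rfl
    · show (polarMap hU s (σ' z)).2.2 = QuotientQ.mk z.2.2.1 z.2.2.2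
      rw [polarMap_eq_mk_iff hU hs]
      refine ⟨?_, ?_⟩
      · show _ = ‖(solution f (e z).1 (he0 z) (e z).2).X 0‖
        rw [hX0, (dir_smul_S2 (hpos z) _).1]
      · show IsMomentum f _ (solution f (e z).1 (he0 z) (e z).2).chart _
        rw [solution_chart]
        exact (he z).2.2
  rw [hcomp]
  exact hκ

theorem chart_eq_radialShift {c c' : RotConstraint f} {t : ℝ} (hX : c'.X = c.X)
    (hη : ∀ u, c'.η u = c.η u + t • (‖c.X u‖⁻¹ • c.X u)) :
    c'.chart = radialShift f c.chart t := by
  refine Prod.ext (congrArg (fun X : C(I, Vec 3) => X 0) hX) (ContinuousMap.ext fun u => ?_)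
  show c'.η u = c.η u + t • ofQ (frame (conn f c.chart) (dirQ (c.X 0)) u)
  rw [hη]
  congr 2
  apply toQ_injective
  rw [map_smul, c.toQ_X, c.norm_X, inv_smul_smul₀ (norm_ne_zero_iff.2 (c.X_ne_zero 0)), toQ_ofQ]
  exact star_apply_of_star_eq_neg (star_frame _ (star_dirQ _)) u

theorem exists_polarIdentification (hf : ContDiffOn ℝ ∞ f (Set.Ioi 0))
    (hf0 : ∀ R : ℝ, 0 < R → f R ≠ 0) (hUo : IsOpen U) (hU : U ⊆ Set.Ioi 0) (hV : IsOpen V)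
    (hVn : V ≠ Set.univ) :
    ∃ Φ : localPhaseSpace f U V ≃ₜ V × V × QuotientQ f U, IsPolarIdentification f U V Φ := by
  -- A direction missed by `V` is where the section of the circle bundle is singular; the base
  -- direction is its antipode.
  obtain ⟨s, hs⟩ := (Set.ne_univ_iff_exists_notMem V).1 hVn
  -- Over an open subset the restricted projection is still a quotient map, so it can be compared
  -- with `polarMap`, which has the same fibres.
  have hm := isQuotientMap_mk.restrictPreimage_isOpen (isOpen_localPhaseSpace hf hUo hU hV)
  obtain ⟨Φ, hΦ⟩ := exists_homeomorph_of_isQuotientMap hm (isQuotientMap_polarMap hf hf0 hU hs)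
    fun c c' => by
      rw [← polarMap_eq_iff hf hf0 hU hs]
      exact Subtype.ext_iff
  have hΦ' : ∀ (c : RotConstraint f) (h : PhaseSpace.mk c ∈ localPhaseSpace f U V),
      Φ ⟨PhaseSpace.mk c, h⟩ = polarMap hU s ⟨c, h⟩ := fun c h => hΦ ⟨c, h⟩
  refine ⟨Φ, ?_, ?_, ?_, ?_⟩
  · rintro ⟨g, hg⟩
    obtain ⟨c, rfl⟩ := isQuotientMap_mk.surjective g
    rw [hΦ']
    exact (smul_inv_smul₀ (norm_ne_zero_iff.2 (c.X_ne_zero 0)) _).symm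
  · rintro ⟨g, hg⟩
    obtain ⟨c, rfl⟩ := isQuotientMap_mk.surjective g
    rw [hΦ']
    exact (smul_inv_smul₀ (norm_ne_zero_iff.2 (c.X_ne_zero 1)) _).symm
  · intro c₀ h₀
    obtain ⟨O, p, hO, h1, h2, h3⟩ := exists_local_momentum_polarMap hf hf0 hU hs ⟨c₀, h₀⟩
    exact ⟨O, p, hO, h1, h2, fun c h hc => by rw [hΦ']; exact h3 ⟨c, h⟩ hc⟩
  · intro c c' t h h' hX hη R p hp
    rw [hΦ'] at hp ⊢
    rw [polarMap_eq_mk_iff hU hs] at hp ⊢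
    refine ⟨by rw [hp.1, hX], ?_⟩
    show IsMomentum f _ c'.chart _
    rw [chart_eq_radialShift hX hη]
    exact hp.2.radialShift hf0 (base_mul_self s) (c.X_ne_zero 0) t

end Polar

end PoissonSigma

end

theorem mainTheorem6 (f : ℝ → ℝ) (hf : ContDiffOn ℝ ∞ f (Set.Ioi 0))
    (hf0 : ∀ R : ℝ, 0 < R → f R ≠ 0) :
    (PoissonSigma.IsSingular PoissonSigma.puncturedSpace (PoissonSigma.rotBivector f) ↔
      (∃ R₁ R₂ : ℝ, 0 < R₁ ∧ 0 < R₂ ∧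
        PoissonSigma.leafArea f R₁ ≠ PoissonSigma.leafArea f R₂) ∧
      (∃ R : ℝ, 0 < R ∧ deriv (PoissonSigma.leafArea f) R = 0)) ∧
    (¬ PoissonSigma.IsSingular PoissonSigma.puncturedSpace (PoissonSigma.rotBivector f) →
      ∃ (N : Type) (_ : TopologicalSpace N) (_ : ChartedSpace (PoissonSigma.Vec 6) N)
        (_ : IsManifold (𝓡 6) ∞ N) (_ : T2Space N) (_ : SecondCountableTopology N)
        (π : PoissonSigma.Constraint PoissonSigma.puncturedSpace
          (PoissonSigma.rotBivector f) → N),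
        PoissonSigma.IsSmoothQuotient 6 π) ∧
    (∀ (U : Set ℝ) (V : Set PoissonSigma.S2), IsOpen U → U ⊆ Set.Ioi 0 →
      IsOpen V → V ≠ Set.univ →
      ∃ Φ : PoissonSigma.localPhaseSpace f U V ≃ₜ V × V × PoissonSigma.QuotientQ f U,
        PoissonSigma.IsPolarIdentification f U V Φ) := by
  have hreg := PoissonSigma.exists_smoothQuotient_of_regular hf hf0
  refine ⟨⟨fun hs => ?_, ?_⟩, fun hns => hreg fun h => hns ?_, ?_⟩
  · by_contra h
    obtain ⟨N, i₁, i₂, i₃, -, -, π, hπ⟩ := hreg h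
    exact hs ⟨6, N, i₁, i₂, i₃, π, hπ⟩
  · rintro ⟨hc, hR⟩
    obtain ⟨R, hR, hR1, hcl⟩ := PoissonSigma.exists_critical_mem_closure hf hf0 hc hR
    exact PoissonSigma.isSingular_of_critical hf hf0 hR hR1 hcl
  · obtain ⟨R, hR, hR1, hcl⟩ := PoissonSigma.exists_critical_mem_closure hf hf0 h.1 h.2
    exact PoissonSigma.isSingular_of_critical hf hf0 hR hR1 hcl
  · intro U V hUo hU hV hVn
    exact PoissonSigma.exists_polarIdentification hf hf0 hUo hU hV hVn
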